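/- Let $T>0$ and let $\mathbf f_t=(\mathbf f^{(1)}_t,\dots,\mathbf f^{(m)}_t)$, $t\in[0,T]$, be an $m$-dimensional standard Wiener process with independent components, with respect to a filtration $(\mathrm F_t)_{t\in[0,T]}$ (that is, $\mathbf f$ is adapted and $\mathbf f_t-\mathbf f_s$ is independent of $\mathrm F_s$ for $s\le t$). Let $\{\phi_j\}_{j\ge 0}$ be one of the following two complete orthonormal systems in $L_2([0,T])$: the Legendre system $\phi_j(x)=\sqrt{\tfrac{2j+1}{T}}\,P_j\!\left(\left(x-\tfrac T2\right)\tfrac 2T\right)$, where $P_j$ is the $j$-th Legendre polynomial, or the trigonometric system $\phi_0(x)=\tfrac1{\sqrt T}$, $\phi_{2r-1}(x)=\sqrt{\tfrac 2T}\sin\tfrac{2\pi r x}{T}$, $\phi_{2r}(x)=\sqrt{\tfrac 2T}\cos\tfrac{2\pi r x}{T}$ $(r\ge1)$. Put $$\zeta^{(i)}_j=\int_0^T\phi_j(s)\,d\mathbf f^{(i)}_s,\qquad \mathbf f^{(i)p}_\tau=\sum_{j=0}^p\int_0^\tau\phi_j(s)\,ds\;\zeta^{(i)}_j,\qquad C_{j_2j_1}=\int_0^T\phi_{j_2}(s)\int_0^s\phi_{j_1}(\tau)\,d\tau\,ds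 .$$ Let $\int$ and $\int^{*}$ with respect to $d\mathbf f$ denote the It\^o integral (the mean-square limit of integrals of approximating adapted step processes) and the Stratonovich integral (the mean-square limit, as the mesh of the partition tends to $0$, of the sums $\sum_k\frac12(X_{t_k}+X_{t_{k+1}})(B_{t_{k+1}}-B_{t_k})$), and let $\operatorname{l.i.m.}$ denote the limit in mean square. Then for all $i_1,i_2\in\{1,\dots,m\}$ all of the stochastic integrals below exist, and the following hold. (1) For every $p$ and every outcome, the iterated Riemann--Stieltjes integral exists and $$\int_0^T\!\int_0^s d\mathbf f^{(i_1)p}_\tau\,d\mathbf f^{(i_2)p}_s=\sum_{j_1,j_2=0}^pC_{j_2j_1}\zeta^{(i_1)}_{j_1}\zeta^{(i_2)}_{j_2}.$$ (2) It converges in mean square to the double Stratonovich integral: $$\operatorname*{l.i.m.}_{p\to\infty}\int_0^T\!\int_0^s d\mathbf f^{(i_1)p}_\tau\,d\mathbf f^{(i_2)p}_s=\int_0^{*T}\!\int_0^{*s}d\mathbf f^{(i_1)}_\tau\,d\mathbf f^{(i_2)}_s .$$ (3) In terms of the It\^o integral, $$\operatorname*{l.i.m.}_{p\to\infty}\sum_{j_1,j_2=0}^pC_{j_2j_1}\Bigl(\zeta^{(i_1)}_{j_1}\zeta^{(i_2)}_{j_2}-\mathbf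 1_{\{i_1=i_2\}}\mathbf 1_{\{j_1=j_2\}}\Bigr)=\int_0^T\!\int_0^s d\mathbf f^{(i_1)}_\tau\,d\mathbf f^{(i_2)}_s,$$ $$\operatorname*{l.i.m.}_{p\to\infty}\int_0^T\!\int_0^s d\mathbf f^{(i_1)p}_\tau\,d\mathbf f^{(i_2)p}_s=\int_0^T\!\int_0^s d\mathbf f^{(i_1)}_\tau\,d\mathbf f^{(i_2)}_s+\mathbf 1_{\{i_1=i_2\}}\sum_{j=0}^\infty C_{jj}.$$ (4) $C_{jj}=\frac12\left(\int_0^T\phi_j(\tau)\,d\tau\right)^2$ for every $j$, the series $\sum_jC_{jj}$ converges, and $\sum_{j=0}^\infty C_{jj}=\frac12\left(\int_0^T\phi_0(\tau)\,d\tau\right)^2=\frac T2$. -/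

import Mathlib

open MeasureTheory ProbabilityTheory Filter Topology Set
open scoped ENNReal

noncomputable section

namespace WongZakai

/-! ### Partitions and the Riemann–Stieltjes integral -/

/-- A finite partition `a = t 0 ≤ t 1 ≤ … ≤ t n = b` of `[a, b]`
(the values `t k` with `k > n` play no role). -/
structure Partition (a b : ℝ) where
  n : ℕ
  t : ℕ → ℝ
  mono : Monotone t
  t_zero : t 0 = a
  t_n : t n = b

/-- All the steps of the partition are smaller than `δ`. -/
def Partition.MeshLT {a b : ℝ} (π : Partition a b) (δ : ℝ) : Prop :=
  ∀ k < π.n, π.t (k + 1) - π.t k < δ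

/-- `I` is the Riemann–Stieltjes integral `∫_a^b g dh`: the sums
`∑ g(ξ_k) (h(t_{k+1}) - h(t_k))`, with arbitrary tags `ξ_k ∈ [t_k, t_{k+1}]`,
tend to `I` as the mesh of the partition tends to `0`. -/
def HasRSIntegral (g h : ℝ → ℝ) (a b I : ℝ) : Prop :=
  a ≤ b ∧ ∀ ε > 0, ∃ δ > 0, ∀ π : Partition a b, π.MeshLT δ →
    ∀ ξ : ℕ → ℝ, (∀ k < π.n, ξ k ∈ Icc (π.t k) (π.t (k + 1))) →
      |∑ k ∈ Finset.range π.n, g (ξ k) * (h (π.t (k + 1)) - h (π.t k)) - I| < ε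

/-- `I` is the iterated Riemann–Stieltjes integral `∫_0^T (∫_0^s dg(τ)) dh(s)`. -/
def HasIteratedRSIntegral (g h : ℝ → ℝ) (T I : ℝ) : Prop :=
  ∃ J : ℝ → ℝ, (∀ s ∈ Icc 0 T, HasRSIntegral (fun _ => 1) g 0 s (J s)) ∧
    HasRSIntegral J h 0 T I

/-! ### The Wiener process -/

variable {Ω : Type*} {mΩ : MeasurableSpace Ω}

/-- `f` is an `m`-dimensional standard Wiener process on `[0, T]` with respect to the filtration
`F`, with independent components: it starts at `0`, is adapted, its increments over `[s, t]` are
independent of `F s`, each component has increments of law `N(0, t - s)`, the component processes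
are independent, and the paths are almost surely continuous on `[0, T]`. -/
structure IsWienerProcess {m : ℕ} (F : Filtration ℝ mΩ) (P : Measure Ω) (T : ℝ)
    (f : Fin m → ℝ → Ω → ℝ) : Prop where
  zero : ∀ i, ∀ᵐ ω ∂P, f i 0 ω = 0
  adapted : ∀ i, ∀ t ∈ Icc 0 T, StronglyMeasurable[F t] (f i t)
  law_increment : ∀ i, ∀ s t, 0 ≤ s → s ≤ t → t ≤ T →
    HasLaw (fun ω => f i t ω - f i s ω) (gaussianReal 0 (t - s).toNNReal) P
  indep_past : ∀ s t, 0 ≤ s → s ≤ t → t ≤ T →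
    Indep (MeasurableSpace.comap (fun ω (i : Fin m) => f i t ω - f i s ω) inferInstance) (F s) P
  indep_components : iIndepFun (fun (i : Fin m) (ω : Ω) (t : Icc (0 : ℝ) T) => f i t ω) P
  continuous_paths : ∀ᵐ ω ∂P, ∀ i, ContinuousOn (fun t => f i t ω) (Icc 0 T)

/-! ### Mean-square limits and stochastic integrals -/

/-- `Y = l.i.m. X p` as `p → ∞`: convergence in the mean-square sense. -/
structure TendstoMeanSquare (P : Measure Ω) (X : ℕ → Ω → ℝ) (Y : Ω → ℝ) : Prop where
  memLp : ∀ p, MemLp (X p) 2 P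
  memLp_limit : MemLp Y 2 P
  tendsto : Tendsto (fun p => eLpNorm (X p - Y) 2 P) atTop (𝓝 0)

/-- A simple (step) process on `[a, b]`: square integrable random values `ξ k` on `(t k, t (k+1)]`,
where `ξ k` is measurable with respect to `F (t k)`. -/
structure SimpleProcess (F : Filtration ℝ mΩ) (P : Measure Ω) (a b : ℝ) extends Partition a b where
  ξ : ℕ → Ω → ℝ
  measurable_ξ : ∀ k < n, StronglyMeasurable[F (t k)] (ξ k)
  memLp_ξ : ∀ k < n, MemLp (ξ k) 2 P

/-- The value of a simple process at time `s`. -/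
def SimpleProcess.value {F : Filtration ℝ mΩ} {P : Measure Ω} {a b : ℝ}
    (S : SimpleProcess F P a b) (s : ℝ) (ω : Ω) : ℝ :=
  ∑ k ∈ Finset.range S.n, (Ioc (S.t k) (S.t (k + 1))).indicator (fun _ => S.ξ k ω) s

/-- The stochastic integral `∑ ξ_k (B(t_{k+1}) - B(t_k))` of a simple process. -/
def SimpleProcess.integral {F : Filtration ℝ mΩ} {P : Measure Ω} {a b : ℝ}
    (S : SimpleProcess F P a b) (B : ℝ → Ω → ℝ) (ω : Ω) : ℝ :=
  ∑ k ∈ Finset.range S.n, S.ξ k ω * (B (S.t (k + 1)) ω - B (S.t k) ω)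

/-- The random variable `Y` is (a version of) the Itô integral `∫_a^b X_s dB_s`: there are simple
processes `S n` with `∫_a^b E |S n (s) - X s|² ds → 0` whose integrals tend to `Y` in mean square.
The inner integral is the expectation, so that the notion does not change when each `X s` is
modified on a null set that depends on `s`. -/
def HasItoIntegral (F : Filtration ℝ mΩ) (P : Measure Ω) (B : ℝ → Ω → ℝ) (a b : ℝ)
    (X : ℝ → Ω → ℝ) (Y : Ω → ℝ) : Prop :=
  (∀ s ∈ Icc a b, AEStronglyMeasurable (X s) P) ∧
  ∃ S : ℕ → SimpleProcess F P a b,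
    (∀ n, AEMeasurable (fun s => ∫⁻ ω, ‖(S n).value s ω - X s ω‖ₑ ^ 2 ∂P)
      (volume.restrict (Icc a b))) ∧
    Tendsto (fun n => ∫⁻ s in Icc a b, ∫⁻ ω, ‖(S n).value s ω - X s ω‖ₑ ^ 2 ∂P) atTop (𝓝 0) ∧
    TendstoMeanSquare P (fun n => (S n).integral B) Y

/-- `Y` is (a version of) the iterated Itô integral `∫_0^T ∫_0^s dB_τ dB'_s`. -/
def HasIteratedItoIntegral (F : Filtration ℝ mΩ) (P : Measure Ω) (B B' : ℝ → Ω → ℝ) (T : ℝ)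
    (Y : Ω → ℝ) : Prop :=
  ∃ X : ℝ → Ω → ℝ, (∀ s ∈ Icc 0 T, HasItoIntegral F P B 0 s (fun _ _ => 1) (X s)) ∧
    HasItoIntegral F P B' 0 T X Y

/-- The random variable `Y` is (a version of) the Stratonovich integral `∫_a^{*b} X_s dB_s`: the
mean-square limit of `∑ (X(t_k) + X(t_{k+1})) / 2 * (B(t_{k+1}) - B(t_k))` as the mesh of the
partition tends to `0`. -/
def HasStratonovichIntegral (P : Measure Ω) (B : ℝ → Ω → ℝ) (a b : ℝ)
    (X : ℝ → Ω → ℝ) (Y : Ω → ℝ) : Prop :=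
  a ≤ b ∧ (∀ s ∈ Icc a b, AEStronglyMeasurable (X s) P) ∧ MemLp Y 2 P ∧
  ∀ ε : ℝ, 0 < ε → ∃ δ > 0, ∀ π : Partition a b, π.MeshLT δ →
    eLpNorm (fun ω => ∑ k ∈ Finset.range π.n, (X (π.t k) ω + X (π.t (k + 1)) ω) / 2 *
      (B (π.t (k + 1)) ω - B (π.t k) ω) - Y ω) 2 P < ENNReal.ofReal ε

/-- `Y` is (a version of) the iterated Stratonovich integral `∫_0^{*T} ∫_0^{*s} dB_τ dB'_s`. -/
def HasIteratedStratonovichIntegral (P : Measure Ω) (B B' : ℝ → Ω → ℝ) (T : ℝ)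
    (Y : Ω → ℝ) : Prop :=
  ∃ X : ℝ → Ω → ℝ, (∀ s ∈ Icc 0 T, HasStratonovichIntegral P B 0 s (fun _ _ => 1) (X s)) ∧
    HasStratonovichIntegral P B' 0 T X Y

/-! ### The orthonormal systems -/

/-- The classical Legendre polynomial `P_j` on `[-1, 1]` (`P_j(1) = 1`); Mathlib's
`shiftedLegendre j` is the polynomial `P_j(1 - 2x)`. -/
def legendre (j : ℕ) (x : ℝ) : ℝ :=
  Polynomial.aeval ((1 - x) / 2) (Polynomial.shiftedLegendre j)

/-- The orthonormal system of Legendre polynomials in `L²([0, T])`. -/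
def legendreSystem (T : ℝ) (j : ℕ) (x : ℝ) : ℝ :=
  √((2 * j + 1) / T) * legendre j ((x - T / 2) * (2 / T))

/-- The orthonormal system of trigonometric functions in `L²([0, T])`: `φ_0 = 1/√T`,
`φ_{2r-1}(x) = √(2/T) sin(2πrx/T)`, `φ_{2r}(x) = √(2/T) cos(2πrx/T)` for `r ≥ 1`.
In both cases `r = (j + 1) / 2`, rounded down. -/
def trigonometricSystem (T : ℝ) (j : ℕ) (x : ℝ) : ℝ :=
  1 / √T *
    if j = 0 then 1
    else if Odd j then √2 * Real.sin (2 * Real.pi * ((j + 1) / 2 : ℕ) * x / T)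
    else √2 * Real.cos (2 * Real.pi * ((j + 1) / 2 : ℕ) * x / T)

/-- The coefficient `C_{j₂ j₁} = ∫_0^T φ_{j₂}(s) ∫_0^s φ_{j₁}(τ) dτ ds`. -/
def doubleCoeff (φ : ℕ → ℝ → ℝ) (T : ℝ) (j₂ j₁ : ℕ) : ℝ :=
  ∫ s in (0 : ℝ)..T, φ j₂ s * ∫ τ in (0 : ℝ)..s, φ j₁ τ

/-- The path `τ ↦ ∑_{j=0}^p (∫_0^τ φ_j(s) ds) z_j`. -/
def seriesApprox (φ : ℕ → ℝ → ℝ) (z : ℕ → ℝ) (p : ℕ) (τ : ℝ) : ℝ :=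
  ∑ j ∈ Finset.range (p + 1), (∫ s in (0 : ℝ)..τ, φ j s) * z j

end WongZakai

end

open WongZakai

namespace WongZakai

/-! ### Partitions and Riemann–Stieltjes integrals -/

namespace Partition

variable {a b : ℝ}

/-! The truncated paths are continuously differentiable, so their iterated Riemann–Stieltjes
integral is an ordinary integral, bilinear in the Gaussian coefficients. All the content is in the
mean-square limit of the double sum.

Averaging end points turns the left-point sum into itself plus half the sum of products of
increments (`trapezoidSum_shift`). The Stratonovich integral is therefore the Itô integral plus half
the limit of `crossSum`, which is `T` for equal components and `0` for independent ones. In both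
cases this limit follows from orthogonality of the terms over disjoint intervals
(`meshTendsto_zero_of_orthogonal`).

For equal components nothing has to converge. By integration by parts, `C i j + C j i` is the
product of the means of `φ i` and `φ j`. Since `φ 0` is constant, every other `φ j` has mean zero.
The double sum is then `T / 2 * ζ 0 ^ 2` for every `p`, which is almost surely half the square of
the increment of the path over `[0, T]`. The trapezoidal sums telescope to the same variable.

For independent components the products `ζ j₁ * ζ' j₂` are orthonormal, the Itô integral `J` has
coefficient `C j₂ j₁` along each, and its squared norm is `T ^ 2 / 2`. The mean-square error is thus
`T ^ 2 / 2` minus the partial sum of the squared coefficients. It is nonnegative, so only a lower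
bound on that sum is needed, and completeness of the system is not invoked. Explicit entries
suffice: for Legendre functions the neighbouring pairs, whose squares telescope; for trigonometric
functions the pairs containing a sine, which give `ζ(2) = π² / 6`.

The Itô integral is handled by an isometry for simple processes over arbitrary overlapping
intervals. It yields uniqueness, and existence as a limit of left-point sums for mean-square
continuous integrands. Moments of integrals are then limits of moments of left-point sums, which are
Riemann–Stieltjes sums. -/

theorem mem_Icc (π : Partition a b) {k : ℕ} (hk : k ≤ π.n) : π.t k ∈ Icc a b := by
  refine ⟨?_, ?_⟩
  · exact π.t_zero.symm.trans_le (π.mono (Nat.zero_le k))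
  · exact (π.mono hk).trans_eq π.t_n

theorem le (π : Partition a b) : a ≤ b := by
  have := π.mem_Icc (Nat.zero_le _)
  exact this.1.trans this.2

theorem step_le (π : Partition a b) (k : ℕ) : π.t k ≤ π.t (k + 1) := π.mono (Nat.le_succ k)

theorem sum_sub (π : Partition a b) (h : ℝ → ℝ) :
    ∑ k ∈ Finset.range π.n, (h (π.t (k + 1)) - h (π.t k)) = h b - h a := by
  rw [Finset.sum_range_sub (fun k => h (π.t k)), π.t_zero, π.t_n]

/-- The partition of `[a, b]` into `N + 1` equal steps. -/
noncomputable def equi (hab : a ≤ b) (N : ℕ) : Partition a b where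
  n := N + 1
  t k := min b (a + k * ((b - a) / (N + 1)))
  mono := by
    intro i j hij
    have : 0 ≤ (b - a) / (N + 1) := div_nonneg (sub_nonneg.2 hab) (by positivity)
    have h2 : (i : ℝ) ≤ j := by exact_mod_cast hij
    exact min_le_min le_rfl (by gcongr)
  t_zero := by simp [hab]
  t_n := by
    have : (N : ℝ) + 1 ≠ 0 := by positivity
    push_cast
    rw [mul_div_cancel₀ _ this]; simp

theorem equi_step_le (hab : a ≤ b) (N k : ℕ) :
    (equi hab N).t (k + 1) - (equi hab N).t k ≤ (b - a) / (N + 1) := by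
  have h0 : 0 ≤ (b - a) / (N + 1) := div_nonneg (sub_nonneg.2 hab) (by positivity)
  simp only [equi]
  push_cast
  rcases le_total b (a + k * ((b - a) / (N + 1))) with h | h
  · rw [min_eq_left h]; linarith [min_le_left b (a + (k + 1) * ((b - a) / (N + 1)))]
  · rw [min_eq_right h]; linarith [min_le_right b (a + (k + 1) * ((b - a) / (N + 1)))]

theorem eventually_meshLT (hab : a ≤ b) {δ : ℝ} (hδ : 0 < δ) :
    ∀ᶠ N in atTop, (equi hab N).MeshLT δ := by
  have h : Tendsto (fun N : ℕ => (b - a) / ((N : ℝ) + 1)) atTop (𝓝 0) :=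
    tendsto_const_nhds.div_atTop (tendsto_atTop_add_const_right _ _ tendsto_natCast_atTop_atTop)
  filter_upwards [h.eventually (gt_mem_nhds hδ)] with N hN k _
  exact (equi_step_le hab N k).trans_lt hN

theorem exists_meshLT (hab : a ≤ b) {δ : ℝ} (hδ : 0 < δ) : ∃ π : Partition a b, π.MeshLT δ := by
  obtain ⟨N, hN⟩ := (eventually_meshLT hab hδ).exists
  exact ⟨_, hN⟩

end Partition

/-- Riemann–Stieltjes sums of a continuous function against an indefinite integral converge. -/
theorem hasRSIntegral_of_primitive {a b : ℝ} (hab : a ≤ b) {g h ψ : ℝ → ℝ}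
    (hg : ContinuousOn g (Icc a b)) (hψ : IntervalIntegrable ψ volume a b)
    (hh : ∀ s ∈ Icc a b, ∀ t ∈ Icc a b, s ≤ t → h t - h s = ∫ x in s..t, ψ x) :
    HasRSIntegral g h a b (∫ x in a..b, g x * ψ x) := by
  refine ⟨hab, fun ε hε => ?_⟩
  set M := ∫ x in a..b, |ψ x|
  have hM : 0 ≤ M := intervalIntegral.integral_nonneg hab fun _ _ => abs_nonneg _
  have huc := isCompact_Icc.uniformContinuousOn_of_continuous hg
  rw [Metric.uniformContinuousOn_iff] at huc
  -- `M` bounds the variation of `h`, so an oscillation of `g` below `ε / (M + 1)` costs at most `ε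
  -- * M / (M + 1) < ε`. The `+ 1` covers `M = 0`.
  obtain ⟨δ, hδ, H⟩ := huc (ε / (M + 1)) (by positivity)
  refine ⟨δ, hδ, fun π hπ ξ hξ => ?_⟩
  have sub : ∀ k < π.n, uIcc (π.t k) (π.t (k + 1)) ⊆ uIcc a b := fun k hk => by
    rw [uIcc_of_le (π.step_le k), uIcc_of_le hab]
    exact Icc_subset_Icc (π.mem_Icc hk.le).1 (π.mem_Icc hk).2
  have i1 : ∀ k < π.n, IntervalIntegrable ψ volume (π.t k) (π.t (k + 1)) := fun k hk =>
    hψ.mono_set (sub k hk)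
  have i2 : ∀ k < π.n, IntervalIntegrable (fun x => g x * ψ x) volume (π.t k) (π.t (k + 1)) :=
    fun k hk => (hψ.continuousOn_mul (by rwa [uIcc_of_le hab])).mono_set (sub k hk)
  have e1 : ∫ x in a..b, g x * ψ x
      = ∑ k ∈ Finset.range π.n, ∫ x in (π.t k)..(π.t (k + 1)), g x * ψ x := by
    rw [intervalIntegral.sum_integral_adjacent_intervals i2, π.t_zero, π.t_n]
  have e2 : M = ∑ k ∈ Finset.range π.n, ∫ x in (π.t k)..(π.t (k + 1)), |ψ x| := by
    rw [intervalIntegral.sum_integral_adjacent_intervals (fun k hk => (i1 k hk).abs),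
      π.t_zero, π.t_n]
  rw [e1, ← Finset.sum_sub_distrib]
  calc _ ≤ ∑ k ∈ Finset.range π.n, ε / (M + 1) * ∫ x in (π.t k)..(π.t (k + 1)), |ψ x| := by
        refine (Finset.abs_sum_le_sum_abs _ _).trans (Finset.sum_le_sum fun k hk => ?_)
        have hk := Finset.mem_range.1 hk
        have hst := π.step_le k
        have hxk : ∀ x ∈ Icc (π.t k) (π.t (k + 1)), x ∈ Icc a b := fun x hx =>
          ⟨(π.mem_Icc hk.le).1.trans hx.1, hx.2.trans (π.mem_Icc hk).2⟩
        rw [hh _ (π.mem_Icc hk.le) _ (π.mem_Icc hk) hst, ← intervalIntegral.integral_const_mul,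
          ← intervalIntegral.integral_sub ((i1 k hk).const_mul _) (i2 k hk),
          ← intervalIntegral.integral_const_mul]
        refine (intervalIntegral.abs_integral_le_integral_abs hst).trans ?_
        refine intervalIntegral.integral_mono_on hst
          (((i1 k hk).const_mul _).sub (i2 k hk)).abs ((i1 k hk).abs.const_mul _) fun x hx => ?_
        rw [← sub_mul, abs_mul]
        refine mul_le_mul_of_nonneg_right ?_ (abs_nonneg _)
        have hd : dist (ξ k) x < δ := by
          rw [Real.dist_eq, abs_lt]
          have := hπ k hk
          have h1 := hξ k hk
          constructor <;> linarith [h1.1, h1.2, hx.1, hx.2]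
        have := H _ (hxk _ (hξ k hk)) _ (hxk _ hx) hd
        rw [Real.dist_eq] at this
        exact this.le
    _ = ε * (M / (M + 1)) := by rw [← Finset.mul_sum, ← e2]; ring
    _ < ε * 1 := by
        gcongr
        rw [div_lt_one (by positivity)]; linarith
    _ = ε := mul_one _

/-- With the left end points as tags, a partition fine enough for both integrals gives the same sum.
The two integrands need only agree on `[a, b]` because the inner integral in `HasIteratedRSIntegral`
is prescribed only there. -/
theorem HasRSIntegral.unique {g g' h : ℝ → ℝ} {a b I I' : ℝ} (hI : HasRSIntegral g h a b I)
    (hI' : HasRSIntegral g' h a b I') (hg : ∀ s ∈ Icc a b, g s = g' s) : I = I' := by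
  refine eq_of_forall_dist_le fun ε hε => ?_
  obtain ⟨δ, hδ, H⟩ := hI.2 (ε / 2) (by positivity)
  obtain ⟨δ', hδ', H'⟩ := hI'.2 (ε / 2) (by positivity)
  obtain ⟨π, hπ⟩ := Partition.exists_meshLT hI.1 (lt_min hδ hδ')
  have h1 := H π (fun k hk => (hπ k hk).trans_le (min_le_left _ _)) π.t
    fun k _ => ⟨le_rfl, π.step_le k⟩
  have h2 := H' π (fun k hk => (hπ k hk).trans_le (min_le_right _ _)) π.t
    fun k _ => ⟨le_rfl, π.step_le k⟩
  rw [Finset.sum_congr rfl fun k hk => by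
    rw [hg _ (π.mem_Icc (Finset.mem_range.1 hk).le)]] at h1
  rw [Real.dist_eq]
  rw [abs_lt] at h1 h2
  rw [abs_le]
  constructor <;> linarith [h1.1, h1.2, h2.1, h2.2]

theorem HasRSIntegral.one_eq {g : ℝ → ℝ} {a b I : ℝ} (hI : HasRSIntegral (fun _ => 1) g a b I) :
    I = g b - g a := by
  refine eq_of_forall_dist_le fun ε hε => ?_
  obtain ⟨δ, hδ, H⟩ := hI.2 ε hε
  obtain ⟨π, hπ⟩ := Partition.exists_meshLT hI.1 hδ
  have h1 := H π hπ π.t fun k _ => ⟨le_rfl, π.step_le k⟩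
  simp only [one_mul, π.sum_sub] at h1
  rw [Real.dist_eq, abs_sub_comm]
  exact h1.le

theorem hasRSIntegral_one (g : ℝ → ℝ) {a b : ℝ} (hab : a ≤ b) :
    HasRSIntegral (fun _ => 1) g a b (g b - g a) :=
  ⟨hab, fun ε hε => ⟨1, one_pos, fun π _ ξ _ => by simpa [π.sum_sub] using hε⟩⟩

/-- Used to identify limits of expectations: along `equi`, the moments of left-point sums turn out
to be Riemann–Stieltjes sums of this form. -/
theorem HasRSIntegral.tendsto_equi {g h : ℝ → ℝ} {a b I : ℝ} (hI : HasRSIntegral g h a b I)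
    (hab : a ≤ b) :
    Tendsto (fun N => ∑ k ∈ Finset.range (Partition.equi hab N).n,
      g ((Partition.equi hab N).t k) *
        (h ((Partition.equi hab N).t (k + 1)) - h ((Partition.equi hab N).t k))) atTop (𝓝 I) := by
  rw [Metric.tendsto_nhds]
  intro ε hε
  obtain ⟨δ, hδ, H⟩ := hI.2 ε hε
  filter_upwards [Partition.eventually_meshLT hab hδ] with N hN
  exact H _ hN _ fun k _ => ⟨le_rfl, Partition.step_le _ k⟩

/-- The iterated Riemann–Stieltjes integral of two truncated expansions. -/
theorem hasIteratedRSIntegral_seriesApprox_iff {φ : ℕ → ℝ → ℝ} (hφ : ∀ j, Continuous (φ j)) {T : ℝ}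
    (hT : 0 ≤ T) (z z' : ℕ → ℝ) (p : ℕ) (R : ℝ) :
    HasIteratedRSIntegral (seriesApprox φ z p) (seriesApprox φ z' p) T R ↔
      R = ∑ j₁ ∈ Finset.range (p + 1), ∑ j₂ ∈ Finset.range (p + 1),
          doubleCoeff φ T j₂ j₁ * (z j₁ * z' j₂) := by
  have hz : ∀ z : ℕ → ℝ, seriesApprox φ z p 0 = 0 := fun z => by simp [seriesApprox]
  have hc : ∀ j, Continuous fun s => ∫ x in (0 : ℝ)..s, φ j x := fun j =>
    intervalIntegral.continuous_primitive (fun _ _ => (hφ j).intervalIntegrable _ _) _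
  have hcz : Continuous (seriesApprox φ z p) := by
    unfold seriesApprox
    exact continuous_finsetSum _ fun j _ => (hc j).mul continuous_const
  have key : HasRSIntegral (seriesApprox φ z p) (seriesApprox φ z' p) 0 T
      (∑ j₁ ∈ Finset.range (p + 1), ∑ j₂ ∈ Finset.range (p + 1),
          doubleCoeff φ T j₂ j₁ * (z j₁ * z' j₂)) := by
    have := hasRSIntegral_of_primitive hT (g := seriesApprox φ z p) (h := seriesApprox φ z' p)
      (ψ := fun x => ∑ j ∈ Finset.range (p + 1), φ j x * z' j) hcz.continuousOn
      ((continuous_finsetSum _ fun j _ => (hφ j).mul continuous_const).intervalIntegrable _ _)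
      (fun s _ t _ _ => by
        rw [intervalIntegral.integral_finsetSum (f := fun j x => φ j x * z' j) fun j _ =>
          Continuous.intervalIntegrable ((hφ j).mul continuous_const) _ _]
        unfold seriesApprox
        rw [← Finset.sum_sub_distrib]
        refine Finset.sum_congr rfl fun j _ => ?_
        rw [intervalIntegral.integral_mul_const, ← sub_mul,
          intervalIntegral.integral_interval_sub_left ((hφ j).intervalIntegrable _ _)
            ((hφ j).intervalIntegrable _ _)])
    convert this using 1
    simp_rw [seriesApprox, Finset.sum_mul_sum]
    rw [intervalIntegral.integral_finsetSum fun j _ => Continuous.intervalIntegrable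
      (continuous_finsetSum _ fun k _ => by have := hc j; have := hφ k; fun_prop) _ _]
    refine Finset.sum_congr rfl fun j _ => ?_
    rw [intervalIntegral.integral_finsetSum fun k _ => Continuous.intervalIntegrable
      (by have := hc j; have := hφ k; fun_prop) _ _]
    refine Finset.sum_congr rfl fun k _ => ?_
    rw [doubleCoeff, ← intervalIntegral.integral_mul_const]
    congr 1
    ext x
    ring
  constructor
  · rintro ⟨J, hJ, hR⟩
    -- Any admissible inner integral equals the path on `[0, T]`, because the path starts at `0`.
    exact hR.unique key fun s hs => by rw [(hJ s hs).one_eq, hz, sub_zero]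
  · rintro rfl
    refine ⟨_, fun s hs => ?_, key⟩
    simpa [hz] using hasRSIntegral_one (seriesApprox φ z p) hs.1

/-! ### Mean-square convergence -/

section MeanSquare

variable {Ω : Type*} {mΩ : MeasurableSpace Ω} {P : Measure Ω}

theorem eLpNorm_two_sq (X : Ω → ℝ) : eLpNorm X 2 P ^ 2 = ∫⁻ ω, ‖X ω‖ₑ ^ 2 ∂P := by
  rw [eLpNorm_eq_lintegral_rpow_enorm_toReal two_ne_zero ENNReal.ofNat_ne_top,
    ← ENNReal.rpow_natCast, ← ENNReal.rpow_mul]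
  simp

theorem enorm_sq_eq_ofReal (x : ℝ) : ‖x‖ₑ ^ 2 = ENNReal.ofReal (x ^ 2) := by
  rw [Real.enorm_eq_ofReal_abs, ← ENNReal.ofReal_pow (abs_nonneg _), sq_abs]

theorem lintegral_enorm_sq {X : Ω → ℝ} (hX : MemLp X 2 P) :
    ∫⁻ ω, ‖X ω‖ₑ ^ 2 ∂P = ENNReal.ofReal (∫ ω, X ω ^ 2 ∂P) := by
  rw [ofReal_integral_eq_lintegral_ofReal hX.integrable_sq (ae_of_all _ fun _ => sq_nonneg _)]
  simp_rw [enorm_sq_eq_ofReal]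

theorem eLpNorm_two_sq_eq {X : Ω → ℝ} (hX : MemLp X 2 P) :
    eLpNorm X 2 P ^ 2 = ENNReal.ofReal (∫ ω, X ω ^ 2 ∂P) := by
  rw [eLpNorm_two_sq, lintegral_enorm_sq hX]

theorem tendsto_zero_of_sq_tendsto_zero {u : ℕ → ℝ≥0∞}
    (h : Tendsto (fun n => u n ^ 2) atTop (𝓝 0)) : Tendsto u atTop (𝓝 0) := by
  have := (ENNReal.continuous_rpow_const (y := (2 : ℝ)⁻¹)).continuousAt.tendsto.comp h
  refine (this.congr fun n => ?_).trans ?_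
  · simp only [Function.comp]
    rw [← ENNReal.rpow_natCast, ← ENNReal.rpow_mul]; simp
  · rw [ENNReal.zero_rpow_of_pos (by norm_num)]

theorem tendsto_eLpNorm_zero_of_integral_sq {X : ℕ → Ω → ℝ} (hX : ∀ n, MemLp (X n) 2 P)
    (h : Tendsto (fun n => ∫ ω, X n ω ^ 2 ∂P) atTop (𝓝 0)) :
    Tendsto (fun n => eLpNorm (X n) 2 P) atTop (𝓝 0) := by
  refine tendsto_zero_of_sq_tendsto_zero ?_
  simp_rw [fun n => eLpNorm_two_sq_eq (hX n)]
  simpa using ENNReal.tendsto_ofReal h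

theorem TendstoMeanSquare.congr {X X' : ℕ → Ω → ℝ} {Y Y' : Ω → ℝ} (h : TendstoMeanSquare P X Y)
    (hX : ∀ n, X n =ᵐ[P] X' n) (hY : Y =ᵐ[P] Y') : TendstoMeanSquare P X' Y' where
  memLp n := (h.memLp n).ae_eq (hX n)
  memLp_limit := h.memLp_limit.ae_eq hY
  tendsto := h.tendsto.congr fun n => eLpNorm_congr_ae ((hX n).sub hY)

theorem TendstoMeanSquare.unique {X : ℕ → Ω → ℝ} {Y Y' : Ω → ℝ} (h : TendstoMeanSquare P X Y)
    (h' : TendstoMeanSquare P X Y') : Y =ᵐ[P] Y' := by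
  have h0 : eLpNorm (Y - Y') 2 P = 0 := by
    refine le_antisymm (ge_of_tendsto' (by simpa using h.tendsto.add h'.tendsto)
      fun n => ?_) zero_le
    have : Y - Y' = (X n - Y') - (X n - Y) := by simp
    rw [this, add_comm]
    exact eLpNorm_sub_le ((h.memLp n).sub h'.memLp_limit).1 ((h.memLp n).sub h.memLp_limit).1
      one_le_two
  rw [eLpNorm_eq_zero_iff (h.memLp_limit.sub h'.memLp_limit).1 two_ne_zero] at h0
  filter_upwards [h0] with ω hω
  simpa [sub_eq_zero] using hω

theorem TendstoMeanSquare.sub {X X' : ℕ → Ω → ℝ} {Y Y' : Ω → ℝ} (h : TendstoMeanSquare P X Y)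
    (h' : TendstoMeanSquare P X' Y') :
    TendstoMeanSquare P (fun n => X n - X' n) (Y - Y') where
  memLp n := (h.memLp n).sub (h'.memLp n)
  memLp_limit := h.memLp_limit.sub h'.memLp_limit
  tendsto := by
    refine tendsto_of_tendsto_of_tendsto_of_le_of_le tendsto_const_nhds
      (by simpa using h.tendsto.add h'.tendsto) (fun _ => zero_le) fun n => ?_
    have : X n - X' n - (Y - Y') = (X n - Y) - (X' n - Y') := by abel
    simp only [this]
    exact eLpNorm_sub_le ((h.memLp n).sub h.memLp_limit).1 ((h'.memLp n).sub h'.memLp_limit).1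
      one_le_two

theorem TendstoMeanSquare.const {Y : Ω → ℝ} (h : MemLp Y 2 P) :
    TendstoMeanSquare P (fun _ => Y) Y where
  memLp _ := h
  memLp_limit := h
  tendsto := by simp

theorem inner_toLp {X Y : Ω → ℝ} (hX : MemLp X 2 P) (hY : MemLp Y 2 P) :
    inner ℝ (hX.toLp X) (hY.toLp Y) = ∫ ω, X ω * Y ω ∂P := by
  rw [L2.inner_def]
  refine integral_congr_ae ?_
  filter_upwards [hX.coeFn_toLp, hY.coeFn_toLp] with ω h1 h2
  rw [h1, h2]; simp [mul_comm]

/-- Continuity of the inner product of `L²`. Second moments of stochastic integrals are obtained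
from those of their approximating sums in this way. -/
theorem TendstoMeanSquare.tendsto_integral_mul {X X' : ℕ → Ω → ℝ} {Y Y' : Ω → ℝ}
    (h : TendstoMeanSquare P X Y) (h' : TendstoMeanSquare P X' Y') :
    Tendsto (fun n => ∫ ω, X n ω * X' n ω ∂P) atTop (𝓝 (∫ ω, Y ω * Y' ω ∂P)) := by
  have t : ∀ {X : ℕ → Ω → ℝ} {Y : Ω → ℝ} (h : TendstoMeanSquare P X Y),
      Tendsto (fun n => (h.memLp n).toLp (X n)) atTop (𝓝 (h.memLp_limit.toLp Y)) := fun h =>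
    (Lp.tendsto_Lp_iff_tendsto_eLpNorm'' _ _ _ _).2 h.tendsto
  have := (t h).inner (𝕜 := ℝ) (t h')
  simpa only [inner_toLp] using this

/-- Mean-square completeness. -/
theorem exists_tendstoMeanSquare_of_cauchy {X : ℕ → Ω → ℝ} (hX : ∀ n, MemLp (X n) 2 P)
    (hc : ∀ ε > 0, ∃ N, ∀ n ≥ N, ∀ k ≥ N, eLpNorm (X n - X k) 2 P < ε) :
    ∃ Y, TendstoMeanSquare P X Y := by
  have : CauchySeq fun n => (hX n).toLp (X n) := by
    rw [EMetric.cauchySeq_iff]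
    intro ε hε
    obtain ⟨N, hN⟩ := hc ε hε
    refine ⟨N, fun n hn k hk => ?_⟩
    rw [Lp.edist_toLp_toLp]
    exact hN n hn k hk
  obtain ⟨Z, hZ⟩ := cauchySeq_tendsto_of_complete this
  refine ⟨Z, hX, Lp.memLp Z, ?_⟩
  rw [Lp.tendsto_Lp_iff_tendsto_eLpNorm'] at hZ
  refine hZ.congr fun n => eLpNorm_congr_ae ?_
  exact (hX n).coeFn_toLp.sub EventuallyEq.rfl

end MeanSquare

/-! ### Brownian motion and the Itô isometry -/

/-- A one-dimensional Brownian motion on `[0, T]` with respect to `F`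
(path continuity and the starting point are not needed). -/
structure IsBrownian {Ω : Type*} {mΩ : MeasurableSpace Ω} (F : Filtration ℝ mΩ) (P : Measure Ω)
    (T : ℝ) (B : ℝ → Ω → ℝ) : Prop where
  adapted : ∀ t ∈ Icc 0 T, StronglyMeasurable[F t] (B t)
  law_increment : ∀ s t, 0 ≤ s → s ≤ t → t ≤ T →
    HasLaw (fun ω => B t ω - B s ω) (gaussianReal 0 (t - s).toNNReal) P
  indep_past : ∀ s t, 0 ≤ s → s ≤ t → t ≤ T →
    Indep (MeasurableSpace.comap (fun ω => B t ω - B s ω) inferInstance) (F s) P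

section Brownian

variable {Ω : Type*} {mΩ : MeasurableSpace Ω} {P : Measure Ω} {F : Filtration ℝ mΩ} {T : ℝ}

theorem IsWienerProcess.isBrownian {m : ℕ} {f : Fin m → ℝ → Ω → ℝ} (hf : IsWienerProcess F P T f)
    (i : Fin m) : IsBrownian F P T (f i) where
  adapted := hf.adapted i
  law_increment := hf.law_increment i
  indep_past s t h0 hst ht := by
    refine indep_of_indep_of_le_left (hf.indep_past s t h0 hst ht) ?_
    rintro _ ⟨A, hA, rfl⟩
    exact ⟨(fun x : Fin m → ℝ => x i) ⁻¹' A, measurable_pi_apply i hA, rfl⟩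

theorem integral_sq_gaussianReal (v : NNReal) : ∫ x, x ^ 2 ∂gaussianReal 0 v = v := by
  have h := variance_fun_id_gaussianReal (μ := 0) (v := v)
  rw [variance_eq_integral measurable_id'.aemeasurable] at h
  simpa using h

/-- Scaling by the standard deviation. Only the quadratic dependence on the variance matters later,
so the fourth moment of the standard normal law is left unevaluated. -/
theorem integral_pow_four_gaussianReal (v : NNReal) :
    ∫ x, x ^ 4 ∂gaussianReal 0 v = (v : ℝ) ^ 2 * ∫ x, x ^ 4 ∂gaussianReal 0 1 := by
  have h := gaussianReal_map_const_mul (μ := 0) (v := 1) (√v)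
  have hv : NNReal.mk (√v ^ 2) (sq_nonneg _) * 1 = v := by
    ext; simp
  rw [hv, mul_zero] at h
  rw [← h, integral_map (by fun_prop) (by fun_prop), ← integral_const_mul]
  refine integral_congr_ae (ae_of_all _ fun x => ?_)
  have : √(v : ℝ) ^ 2 = v := Real.sq_sqrt v.2
  simp only [mul_pow]
  rw [show √(v : ℝ) ^ 4 = (√(v : ℝ) ^ 2) ^ 2 by ring, this]

namespace IsBrownian

variable {B : ℝ → Ω → ℝ} {s t : ℝ}

theorem memLp_increment (hB : IsBrownian F P T B) (h0 : 0 ≤ s) (hst : s ≤ t) (ht : t ≤ T)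
    {p : ℝ≥0∞} (hp : p ≠ ∞) : MemLp (fun ω => B t ω - B s ω) p P := by
  have hl := hB.law_increment s t h0 hst ht
  have h := memLp_id_gaussianReal' (μ := 0) (v := (t - s).toNNReal) p hp
  rw [← hl.map_eq] at h
  exact h.comp_of_map hl.aemeasurable

theorem integral_increment (hB : IsBrownian F P T B) (h0 : 0 ≤ s) (hst : s ≤ t) (ht : t ≤ T) :
    ∫ ω, (B t ω - B s ω) ∂P = 0 := by
  have hl := hB.law_increment s t h0 hst ht
  rw [hl.integral_eq, integral_id_gaussianReal]

theorem integral_increment_sq (hB : IsBrownian F P T B) (h0 : 0 ≤ s) (hst : s ≤ t) (ht : t ≤ T) :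
    ∫ ω, (B t ω - B s ω) ^ 2 ∂P = t - s := by
  have hl := hB.law_increment s t h0 hst ht
  have := hl.integral_comp (f := fun x => x ^ 2) (by fun_prop)
  rw [integral_sq_gaussianReal, Real.coe_toNNReal _ (sub_nonneg.2 hst)] at this
  exact this

theorem integral_increment_pow_four (hB : IsBrownian F P T B) (h0 : 0 ≤ s) (hst : s ≤ t)
    (ht : t ≤ T) :
    ∫ ω, (B t ω - B s ω) ^ 4 ∂P = (t - s) ^ 2 * ∫ x, x ^ 4 ∂gaussianReal 0 1 := by
  have hl := hB.law_increment s t h0 hst ht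
  have := hl.integral_comp (f := fun x => x ^ 4) (by fun_prop)
  rw [integral_pow_four_gaussianReal, Real.coe_toNNReal _ (sub_nonneg.2 hst)] at this
  exact this

theorem indepFun (hB : IsBrownian F P T B) (h0 : 0 ≤ s) (hst : s ≤ t) (ht : t ≤ T) {X : Ω → ℝ}
    (hX : StronglyMeasurable[F s] X) : IndepFun X (fun ω => B t ω - B s ω) P := by
  rw [IndepFun_iff_Indep]
  exact (indep_of_indep_of_le_right (hB.indep_past s t h0 hst ht) hX.measurable.comap_le).symm

theorem integral_mul_increment (hB : IsBrownian F P T B) (h0 : 0 ≤ s) (hst : s ≤ t) (ht : t ≤ T)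
    {X : Ω → ℝ} (hX : StronglyMeasurable[F s] X) : ∫ ω, X ω * (B t ω - B s ω) ∂P = 0 := by
  rw [(hB.indepFun h0 hst ht hX).integral_fun_mul_eq_mul_integral
    (hX.mono (F.le s)).aestronglyMeasurable (hB.memLp_increment h0 hst ht ENNReal.ofNat_ne_top
      (p := 2)).1, hB.integral_increment h0 hst ht, mul_zero]

theorem integral_mul_increment_sq (hB : IsBrownian F P T B) (h0 : 0 ≤ s) (hst : s ≤ t)
    (ht : t ≤ T) {X : Ω → ℝ} (hX : StronglyMeasurable[F s] X) :
    ∫ ω, X ω * (B t ω - B s ω) ^ 2 ∂P = (∫ ω, X ω ∂P) * (t - s) := by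
  have hi := (hB.indepFun h0 hst ht hX).comp measurable_id (measurable_id.pow_const 2)
  rw [← hB.integral_increment_sq h0 hst ht]
  exact hi.integral_fun_mul_eq_mul_integral (hX.mono (F.le s)).aestronglyMeasurable
    ((hB.memLp_increment h0 hst ht ENNReal.ofNat_ne_top (p := 2)).1.pow 2)

/-- Independence makes the squares of the factors multiply to an integrable function, so two moments
of `X` are enough. -/
theorem memLp_mul_increment (hB : IsBrownian F P T B) (h0 : 0 ≤ s) (hst : s ≤ t) (ht : t ≤ T)
    {X : Ω → ℝ} (hX : StronglyMeasurable[F s] X) (hX2 : MemLp X 2 P) :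
    MemLp (fun ω => X ω * (B t ω - B s ω)) 2 P := by
  have hd := hB.memLp_increment h0 hst ht ENNReal.ofNat_ne_top (p := 2)
  refine (memLp_two_iff_integrable_sq (f := fun ω => X ω * (B t ω - B s ω)) (hX2.1.mul hd.1)).2 ?_
  have hi := (hB.indepFun h0 hst ht hX).comp (measurable_id.pow_const 2) (measurable_id.pow_const 2)
  refine (hi.integrable_mul hX2.integrable_sq hd.integrable_sq).congr (ae_of_all _ fun ω => ?_)
  simp [mul_pow]

theorem measurable_mul_increment (hB : IsBrownian F P T B) (h0 : 0 ≤ s) (hst : s ≤ t) (ht : t ≤ T)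
    {X : Ω → ℝ} (hX : StronglyMeasurable[F s] X) :
    StronglyMeasurable[F t] (fun ω => X ω * (B t ω - B s ω)) :=
  (hX.mono (F.mono hst)).mul ((hB.adapted t ⟨h0.trans hst, ht⟩).sub
    ((hB.adapted s ⟨h0, hst.trans ht⟩).mono (F.mono hst)))

/-- The covariance of two elementary stochastic integrals, the first of which starts earlier. -/
theorem integral_mul_of_le (hB : IsBrownian F P T B) {a b c d : ℝ} {ξ η : Ω → ℝ}
    (ha : 0 ≤ a) (hab : a ≤ b) (hbT : b ≤ T) (hcd : c ≤ d) (hdT : d ≤ T) (hac : a ≤ c)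
    (hξ : StronglyMeasurable[F a] ξ) (hξ2 : MemLp ξ 2 P)
    (hη : StronglyMeasurable[F c] η) (hη2 : MemLp η 2 P) :
    ∫ ω, (ξ ω * (B b ω - B a ω)) * (η ω * (B d ω - B c ω)) ∂P
      = (∫ ω, ξ ω * η ω ∂P) * volume.real (Ioc a b ∩ Ioc c d) := by
  have hc := ha.trans hac
  rw [Ioc_inter_Ioc, Real.volume_real_Ioc, max_eq_right hac]
  rcases le_total b c with hbc | hcb
  -- Disjoint intervals: everything but the last increment is measurable at time `c`, and that
  -- increment is centred and independent of the past.
  · have : min b d - c ≤ 0 := by linarith [min_le_left b d]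
    rw [max_eq_right this, mul_zero, ← hB.integral_mul_increment hc hcd hdT
      (((hB.measurable_mul_increment ha hab hbT hξ).mono (F.mono hbc)).mul hη)]
    congr 1; ext ω; simp only [Pi.mul_apply]; ring
  have hcT := hcb.trans hbT
  have hξc := hξ.mono (F.mono hac)
  have hξη : StronglyMeasurable[F c] (fun ω => ξ ω * η ω) := hξc.mul hη
  have m1 := hB.memLp_mul_increment ha hac hcT hξ hξ2
  have m2 := hB.memLp_mul_increment hc hcb hbT hξc hξ2
  have m3 := hB.memLp_mul_increment hc hcd hdT hη hη2
  -- Overlapping intervals: cut `(a, b]` at `c`. The piece before `c` is orthogonal to the increment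
  -- over `(c, d]`, so both increments may be taken to start at `c`.
  have e1 : ∫ ω, (ξ ω * (B c ω - B a ω)) * (η ω * (B d ω - B c ω)) ∂P = 0 := by
    rw [← hB.integral_mul_increment hc hcd hdT ((hB.measurable_mul_increment ha hac hcT hξ).mul hη)]
    congr 1; ext ω; simp only [Pi.mul_apply]; ring
  have e2 : ∫ ω, (ξ ω * (B b ω - B a ω)) * (η ω * (B d ω - B c ω)) ∂P
      = ∫ ω, (ξ ω * (B b ω - B c ω)) * (η ω * (B d ω - B c ω)) ∂P := by
    have h := integral_add (m1.integrable_mul m3) (m2.integrable_mul m3)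
    simp only [Pi.mul_apply] at h
    rw [← zero_add (∫ ω, (ξ ω * (B b ω - B c ω)) * (η ω * (B d ω - B c ω)) ∂P), ← e1, ← h]
    congr 1; ext ω; ring
  rw [e2, max_eq_left (sub_nonneg.2 (le_min hcb hcd))]
  -- Cut the longer increment at the end of the shorter one. The common part gives the length of the
  -- overlap and the tail is orthogonal.
  rcases le_total b d with hbd | hdb
  · have m4 := hB.memLp_mul_increment hc hcb hbT hη hη2
    have m5 := hB.memLp_mul_increment (hc.trans hcb) hbd hdT (hη.mono (F.mono hcb)) hη2
    rw [min_eq_left hbd, ← hB.integral_mul_increment_sq hc hcb hbT hξη,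
      ← add_zero (∫ ω, (ξ ω * η ω) * (B b ω - B c ω) ^ 2 ∂P),
      ← hB.integral_mul_increment (hc.trans hcb) hbd hdT
      ((hB.measurable_mul_increment hc hcb hbT hξc).mul (hη.mono (F.mono hcb))), ← integral_add]
    · congr 1; ext ω; simp only [Pi.mul_apply]; ring
    · convert m2.integrable_mul m4 using 1; ext ω; simp only [Pi.mul_apply]; ring
    · convert m2.integrable_mul m5 using 1; ext ω; simp only [Pi.mul_apply]; ring
  · have m4 := hB.memLp_mul_increment hc hcd hdT hξc hξ2
    have m5 := hB.memLp_mul_increment (hc.trans hcd) hdb hbT (hξ.mono (F.mono (hac.trans hcd))) hξ2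
    rw [min_eq_right hdb, ← hB.integral_mul_increment_sq hc hcd hdT hξη,
      ← add_zero (∫ ω, (ξ ω * η ω) * (B d ω - B c ω) ^ 2 ∂P),
      ← hB.integral_mul_increment (hc.trans hcd) hdb hbT
      ((hB.measurable_mul_increment hc hcd hdT hη).mul (hξ.mono (F.mono (hac.trans hcd)))),
      ← integral_add]
    · congr 1; ext ω; simp only [Pi.mul_apply]; ring
    · convert m4.integrable_mul m3 using 1; ext ω; simp only [Pi.mul_apply]; ring
    · convert m3.integrable_mul m5 using 1; ext ω; simp only [Pi.mul_apply]; ring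

theorem integral_mul (hB : IsBrownian F P T B) {a b c d : ℝ} {ξ η : Ω → ℝ}
    (ha : 0 ≤ a) (hab : a ≤ b) (hbT : b ≤ T) (hc : 0 ≤ c) (hcd : c ≤ d) (hdT : d ≤ T)
    (hξ : StronglyMeasurable[F a] ξ) (hξ2 : MemLp ξ 2 P)
    (hη : StronglyMeasurable[F c] η) (hη2 : MemLp η 2 P) :
    ∫ ω, (ξ ω * (B b ω - B a ω)) * (η ω * (B d ω - B c ω)) ∂P
      = (∫ ω, ξ ω * η ω ∂P) * volume.real (Ioc a b ∩ Ioc c d) := by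
  rcases le_total a c with hac | hca
  · exact hB.integral_mul_of_le ha hab hbT hcd hdT hac hξ hξ2 hη hη2
  · have := hB.integral_mul_of_le hc hcd hdT hab hbT hca hη hη2 hξ hξ2
    rw [inter_comm]
    simpa only [mul_comm] using this

end IsBrownian

end Brownian

/-! ### The Itô integral: isometry, uniqueness, existence -/

section Ito

variable {Ω : Type*} {mΩ : MeasurableSpace Ω} {P : Measure Ω} {F : Filtration ℝ mΩ} {T : ℝ}
  {B : ℝ → Ω → ℝ}

/-- Expanding the square leaves products of indicators, whose integrals are the lengths of the
overlaps. This is the same double sum as in `IsBrownian.integral_sum_sq`, and the coincidence of the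
two is the isometry. The intervals may overlap. -/
theorem lintegral_lintegral_sum_indicator_sq {ι : Type*} (u : Finset ι) {a b : ℝ} (A C : ι → ℝ)
    (ξ : ι → Ω → ℝ) (hA : ∀ i ∈ u, a ≤ A i) (hC : ∀ i ∈ u, C i ≤ b)
    (hξ : ∀ i ∈ u, MemLp (ξ i) 2 P) :
    ∫⁻ s in Icc a b, ∫⁻ ω, ‖∑ i ∈ u, (Ioc (A i) (C i)).indicator (fun _ => ξ i ω) s‖ₑ ^ 2 ∂P
      = ENNReal.ofReal (∑ i ∈ u, ∑ j ∈ u, (∫ ω, ξ i ω * ξ j ω ∂P) *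
          volume.real (Ioc (A i) (C i) ∩ Ioc (A j) (C j))) := by
  set e : ι → ℝ → ℝ := fun i => (Ioc (A i) (C i)).indicator 1
  have h1 : ∀ i s ω, (Ioc (A i) (C i)).indicator (fun _ => ξ i ω) s = e i s * ξ i ω := by
    intro i s ω
    by_cases hs : s ∈ Ioc (A i) (C i) <;> simp [e, hs]
  have hm : ∀ s, MemLp (fun ω => ∑ i ∈ u, e i s * ξ i ω) 2 P := fun s =>
    memLp_finsetSum _ fun i hi => (hξ i hi).const_mul _
  have h2 : ∀ s, ∫ ω, (∑ i ∈ u, e i s * ξ i ω) ^ 2 ∂P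
      = ∑ i ∈ u, ∑ j ∈ u, (∫ ω, ξ i ω * ξ j ω ∂P) * (e i s * e j s) := by
    intro s
    have hint : ∀ i ∈ u, ∀ j ∈ u, Integrable (fun ω => e i s * ξ i ω * (e j s * ξ j ω)) P :=
      fun i hi j hj => ((hξ i hi).const_mul _).integrable_mul ((hξ j hj).const_mul _)
    simp_rw [sq, Finset.sum_mul_sum]
    rw [integral_finsetSum _ fun i hi => integrable_finsetSum _ fun j hj => hint i hi j hj]
    refine Finset.sum_congr rfl fun i hi => ?_
    rw [integral_finsetSum _ fun j hj => hint i hi j hj]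
    refine Finset.sum_congr rfl fun j hj => ?_
    rw [← integral_mul_const]
    congr 1; ext ω; ring
  have h3 : ∀ i j s, e i s * e j s = (Ioc (A i) (C i) ∩ Ioc (A j) (C j)).indicator 1 s := by
    intro i j s
    simp only [e, inter_indicator_one, Pi.mul_apply]
  have hint : ∀ i j, Integrable (fun s => (∫ ω, ξ i ω * ξ j ω ∂P) * (e i s * e j s))
      (volume.restrict (Icc a b)) := by
    intro i j
    simp_rw [h3]
    exact ((integrable_const (1 : ℝ)).indicator
      (measurableSet_Ioc.inter measurableSet_Ioc)).const_mul _
  simp_rw [h1]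
  simp_rw [fun s => lintegral_enorm_sq (hm s), h2]
  rw [← ofReal_integral_eq_lintegral_ofReal
    (integrable_finsetSum _ fun i _ => integrable_finsetSum _ fun j _ => hint i j)
    (ae_of_all _ fun s => by
      exact (integral_nonneg fun _ => sq_nonneg _).trans_eq (h2 s))]
  congr 1
  rw [integral_finsetSum _ fun i _ => integrable_finsetSum _ fun j _ => hint i j]
  refine Finset.sum_congr rfl fun i hi => ?_
  rw [integral_finsetSum _ fun j _ => hint i j]
  refine Finset.sum_congr rfl fun j hj => ?_
  rw [integral_const_mul]
  simp_rw [h3]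
  rw [integral_indicator_one (measurableSet_Ioc.inter measurableSet_Ioc),
    measureReal_restrict_apply (measurableSet_Ioc.inter measurableSet_Ioc), inter_eq_left.2]
  exact fun x hx => ⟨(hA i hi).trans hx.1.1.le, hx.1.2.trans (hC i hi)⟩

theorem IsBrownian.integral_sum_sq (hB : IsBrownian F P T B) {ι : Type*} (u : Finset ι)
    (A C : ι → ℝ) (ξ : ι → Ω → ℝ) (hA : ∀ i ∈ u, 0 ≤ A i) (hAC : ∀ i ∈ u, A i ≤ C i)
    (hC : ∀ i ∈ u, C i ≤ T) (hξ : ∀ i ∈ u, StronglyMeasurable[F (A i)] (ξ i))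
    (hξ2 : ∀ i ∈ u, MemLp (ξ i) 2 P) :
    ∫ ω, (∑ i ∈ u, ξ i ω * (B (C i) ω - B (A i) ω)) ^ 2 ∂P
      = ∑ i ∈ u, ∑ j ∈ u, (∫ ω, ξ i ω * ξ j ω ∂P) *
          volume.real (Ioc (A i) (C i) ∩ Ioc (A j) (C j)) := by
  have hm : ∀ i ∈ u, MemLp (fun ω => ξ i ω * (B (C i) ω - B (A i) ω)) 2 P := fun i hi =>
    hB.memLp_mul_increment (hA i hi) (hAC i hi) (hC i hi) (hξ i hi) (hξ2 i hi)
  have hint : ∀ i ∈ u, ∀ j ∈ u, Integrable (fun ω => ξ i ω * (B (C i) ω - B (A i) ω) *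
      (ξ j ω * (B (C j) ω - B (A j) ω))) P :=
    fun i hi j hj => (hm i hi).integrable_mul (hm j hj)
  simp_rw [sq, Finset.sum_mul_sum]
  rw [integral_finsetSum _ fun i hi => integrable_finsetSum _ fun j hj => hint i hi j hj]
  refine Finset.sum_congr rfl fun i hi => ?_
  rw [integral_finsetSum _ fun j hj => hint i hi j hj]
  exact Finset.sum_congr rfl fun j hj => hB.integral_mul (hA i hi) (hAC i hi) (hC i hi)
    (hA j hj) (hAC j hj) (hC j hj) (hξ i hi) (hξ2 i hi) (hξ j hj) (hξ2 j hj)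

namespace SimpleProcess

variable {a b : ℝ}

theorem memLp_value (S : SimpleProcess F P a b) (s : ℝ) : MemLp (S.value s) 2 P := by
  refine memLp_finsetSum _ fun k hk => ?_
  by_cases hs : s ∈ Ioc (S.t k) (S.t (k + 1))
  · simpa [hs] using S.memLp_ξ k (Finset.mem_range.1 hk)
  · simp [hs]

theorem memLp_integral (S : SimpleProcess F P a b) (hB : IsBrownian F P T B) (ha : 0 ≤ a)
    (hb : b ≤ T) : MemLp (S.integral B) 2 P := by
  refine memLp_finsetSum _ fun k hk => ?_
  have hk := Finset.mem_range.1 hk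
  exact hB.memLp_mul_increment (ha.trans (S.toPartition.mem_Icc hk.le).1) (S.step_le k)
    ((S.toPartition.mem_Icc hk).2.trans hb) (S.measurable_ξ k hk) (S.memLp_ξ k hk)

/-- The Itô isometry for the difference of two simple processes. -/
theorem eLpNorm_integral_sub (hB : IsBrownian F P T B) (ha : 0 ≤ a) (hb : b ≤ T)
    (S S' : SimpleProcess F P a b) :
    eLpNorm (S.integral B - S'.integral B) 2 P ^ 2
      = ∫⁻ s in Icc a b, ∫⁻ ω, ‖S.value s ω - S'.value s ω‖ₑ ^ 2 ∂P := by
  rw [eLpNorm_two_sq_eq ((S.memLp_integral hB ha hb).sub (S'.memLp_integral hB ha hb))]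
  -- The difference of the two processes is a single sum over the disjoint union of the indices,
  -- with the sign put into the values. Since the intervals may overlap, no common refinement is
  -- needed.
  set u : Finset (ℕ ⊕ ℕ) := (Finset.range S.n).disjSum (Finset.range S'.n)
  set A : ℕ ⊕ ℕ → ℝ := Sum.elim S.t S'.t
  set C : ℕ ⊕ ℕ → ℝ := Sum.elim (fun k => S.t (k + 1)) (fun k => S'.t (k + 1))
  set ξ : ℕ ⊕ ℕ → Ω → ℝ := Sum.elim S.ξ (fun k => - S'.ξ k)
  have hu : ∀ {p : ℕ ⊕ ℕ → Prop}, (∀ k < S.n, p (.inl k)) → (∀ k < S'.n, p (.inr k)) →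
      ∀ i ∈ u, p i := by
    intro p h1 h2 i hi
    rcases i with k | k
    · exact h1 k (by simpa [u] using hi)
    · exact h2 k (by simpa [u] using hi)
  have e1 : ∀ ω, (S.integral B - S'.integral B) ω
      = ∑ i ∈ u, ξ i ω * (B (C i) ω - B (A i) ω) := by
    intro ω
    simp [u, A, C, ξ, Finset.sum_disjSum, SimpleProcess.integral, sub_eq_add_neg]
  have e2 : ∀ s ω, S.value s ω - S'.value s ω
      = ∑ i ∈ u, (Ioc (A i) (C i)).indicator (fun _ => ξ i ω) s := by
    intro s ω
    simp only [u, A, C, ξ, Finset.sum_disjSum, SimpleProcess.value, sub_eq_add_neg, Sum.elim_inl,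
      Sum.elim_inr, Pi.neg_apply, ← Finset.sum_neg_distrib]
    congr 1
    refine Finset.sum_congr rfl fun k _ => ?_
    by_cases hs : s ∈ Ioc (S'.t k) (S'.t (k + 1)) <;> simp [hs]
  have hA : ∀ i ∈ u, a ≤ A i := hu (fun k hk => (S.toPartition.mem_Icc hk.le).1)
    (fun k hk => (S'.toPartition.mem_Icc hk.le).1)
  have hC : ∀ i ∈ u, C i ≤ b := hu (fun k hk => (S.toPartition.mem_Icc hk).2)
    (fun k hk => (S'.toPartition.mem_Icc hk).2)
  have hξ2 : ∀ i ∈ u, MemLp (ξ i) 2 P := hu S.memLp_ξ (fun k hk => (S'.memLp_ξ k hk).neg)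
  simp_rw [e1, e2]
  rw [lintegral_lintegral_sum_indicator_sq u A C ξ hA hC hξ2,
    hB.integral_sum_sq u A C ξ (fun i hi => ha.trans (hA i hi))
      (hu (fun k _ => S.step_le k) (fun k _ => S'.step_le k)) (fun i hi => (hC i hi).trans hb)
      (hu S.measurable_ξ (fun k hk => (S'.measurable_ξ k hk).neg)) hξ2]

/-- Isometry combined with `(x - y) ^ 2 ≤ 2 * (x - z) ^ 2 + 2 * (y - z) ^ 2`. Two good
approximations of the same integrand have close integrals, which serves both uniqueness and the
Cauchy property. -/
theorem eLpNorm_integral_sub_le (hB : IsBrownian F P T B) (ha : 0 ≤ a) (hb : b ≤ T)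
    (S S' : SimpleProcess F P a b) {X : ℝ → Ω → ℝ}
    (hX : ∀ s ∈ Icc a b, AEStronglyMeasurable (X s) P)
    (hS : AEMeasurable (fun s => ∫⁻ ω, ‖S.value s ω - X s ω‖ₑ ^ 2 ∂P)
      (volume.restrict (Icc a b))) :
    eLpNorm (S.integral B - S'.integral B) 2 P ^ 2
      ≤ 2 * ((∫⁻ s in Icc a b, ∫⁻ ω, ‖S.value s ω - X s ω‖ₑ ^ 2 ∂P)
        + ∫⁻ s in Icc a b, ∫⁻ ω, ‖S'.value s ω - X s ω‖ₑ ^ 2 ∂P) := by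
  rw [eLpNorm_integral_sub hB ha hb, ← lintegral_add_left' hS,
    ← lintegral_const_mul' _ _ ENNReal.ofNat_ne_top]
  refine setLIntegral_mono' measurableSet_Icc fun s hs => ?_
  have hm : AEMeasurable (fun ω => ‖S.value s ω - X s ω‖ₑ ^ 2) P :=
    ((S.memLp_value s).1.sub (hX s hs)).enorm.pow_const 2
  rw [← lintegral_add_left' hm, ← lintegral_const_mul' _ _ ENNReal.ofNat_ne_top]
  refine lintegral_mono fun ω => ?_
  simp only [enorm_sq_eq_ofReal]
  rw [← ENNReal.ofReal_add (sq_nonneg _) (sq_nonneg _),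
    show (2 : ℝ≥0∞) = ENNReal.ofReal 2 by simp, ← ENNReal.ofReal_mul zero_le_two]
  refine ENNReal.ofReal_le_ofReal ?_
  nlinarith [sq_nonneg ((S.value s ω - X s ω) + (S'.value s ω - X s ω))]

theorem value_of_mem (S : SimpleProcess F P a b) {k : ℕ} (hk : k < S.n) {s : ℝ}
    (hs : s ∈ Ioc (S.t k) (S.t (k + 1))) (ω : Ω) : S.value s ω = S.ξ k ω := by
  rw [value, Finset.sum_eq_single_of_mem k (Finset.mem_range.2 hk)]
  · simp [hs]
  · intro j _ hjk
    refine indicator_of_notMem (fun hj => ?_) _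
    rcases lt_or_gt_of_ne hjk with h | h
    · exact absurd (hj.2.trans (S.mono (Nat.succ_le_of_lt h))) (not_le.2 hs.1)
    · exact absurd (hs.2.trans (S.mono (Nat.succ_le_of_lt h))) (not_le.2 hj.1)

end SimpleProcess

/-- The Itô integral is unique up to null sets. -/
theorem HasItoIntegral.unique (hB : IsBrownian F P T B) {a b : ℝ} (ha : 0 ≤ a) (hb : b ≤ T)
    {X X' : ℝ → Ω → ℝ} {Y Y' : Ω → ℝ} (h : HasItoIntegral F P B a b X Y)
    (h' : HasItoIntegral F P B a b X' Y') (hX : ∀ s ∈ Icc a b, X s =ᵐ[P] X' s) : Y =ᵐ[P] Y' := by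
  obtain ⟨hXm, S, hS, hS0, hSY⟩ := h
  obtain ⟨-, S', -, hS0', hSY'⟩ := h'
  -- For each `s` the inner integral is an expectation, so it does not distinguish `X s` from `X'
  -- s`.
  have e : ∀ n, ∫⁻ s in Icc a b, ∫⁻ ω, ‖(S' n).value s ω - X' s ω‖ₑ ^ 2 ∂P
      = ∫⁻ s in Icc a b, ∫⁻ ω, ‖(S' n).value s ω - X s ω‖ₑ ^ 2 ∂P := fun n =>
    setLIntegral_congr_fun measurableSet_Icc fun s hs => lintegral_congr_ae <| by
      filter_upwards [hX s hs] with ω hω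
      rw [hω]
  simp_rw [e] at hS0'
  have h0 : Tendsto (fun n => eLpNorm ((S n).integral B - (S' n).integral B) 2 P) atTop (𝓝 0) := by
    refine tendsto_zero_of_sq_tendsto_zero ?_
    refine tendsto_of_tendsto_of_tendsto_of_le_of_le tendsto_const_nhds ?_ (fun _ => zero_le)
      fun n => SimpleProcess.eLpNorm_integral_sub_le hB ha hb (S n) (S' n) hXm (hS n)
    simpa using ENNReal.Tendsto.const_mul (hS0.add hS0') (Or.inr ENNReal.ofNat_ne_top)
  have h1 := hSY.sub hSY'
  have h2 : TendstoMeanSquare P (fun n => (S n).integral B - (S' n).integral B) 0 :=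
    ⟨h1.memLp, MemLp.zero, by simpa using h0⟩
  filter_upwards [h1.unique h2] with ω hω
  simpa [sub_eq_zero] using hω

/-- The left-point sum `∑ X(t_k) (B(t_{k+1}) - B(t_k))`. -/
def leftSum {a b : ℝ} (X B : ℝ → Ω → ℝ) (π : Partition a b) (ω : Ω) : ℝ :=
  ∑ k ∈ Finset.range π.n, X (π.t k) ω * (B (π.t (k + 1)) ω - B (π.t k) ω)

/-- The random sums `σ π` tend to `Y` in mean square as the mesh of `π` tends to `0`. -/
def MeshTendsto (P : Measure Ω) {a b : ℝ} (σ : Partition a b → Ω → ℝ) (Y : Ω → ℝ) : Prop :=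
  MemLp Y 2 P ∧ (∀ π, MemLp (σ π) 2 P) ∧
    ∀ ε : ℝ, 0 < ε → ∃ δ > 0, ∀ π, π.MeshLT δ → eLpNorm (σ π - Y) 2 P < ENNReal.ofReal ε

theorem MeshTendsto.tendsto {a b : ℝ} (hab : a ≤ b) {σ : Partition a b → Ω → ℝ} {Y : Ω → ℝ}
    (h : MeshTendsto P σ Y) : TendstoMeanSquare P (fun N => σ (Partition.equi hab N)) Y where
  memLp _ := h.2.1 _
  memLp_limit := h.1
  tendsto := by
    rw [ENNReal.tendsto_nhds_zero]
    intro ε hε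
    rcases eq_or_ne ε ∞ with rfl | hε'
    · simp
    obtain ⟨δ, hδ, H⟩ := h.2.2 ε.toReal (ENNReal.toReal_pos hε.ne' hε')
    filter_upwards [Partition.eventually_meshLT hab hδ] with N hN
    have := H _ hN
    rw [ENNReal.ofReal_toReal hε'] at this
    exact this.le

theorem MeshTendsto.congr {a b : ℝ} {σ σ' : Partition a b → Ω → ℝ} {Y Y' : Ω → ℝ}
    (h : MeshTendsto P σ Y) (hσ : ∀ π, σ π =ᵐ[P] σ' π) (hY : Y =ᵐ[P] Y') : MeshTendsto P σ' Y' := by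
  refine ⟨h.1.ae_eq hY, fun π => (h.2.1 π).ae_eq (hσ π), fun ε hε => ?_⟩
  obtain ⟨δ, hδ, H⟩ := h.2.2 ε hε
  exact ⟨δ, hδ, fun π hπ => (eLpNorm_congr_ae ((hσ π).sub hY)).symm.trans_lt (H π hπ)⟩

theorem MeshTendsto.add {a b : ℝ} {σ σ' : Partition a b → Ω → ℝ} {Y Y' : Ω → ℝ}
    (h : MeshTendsto P σ Y) (h' : MeshTendsto P σ' Y') :
    MeshTendsto P (fun π => σ π + σ' π) (Y + Y') := by
  refine ⟨h.1.add h'.1, fun π => (h.2.1 π).add (h'.2.1 π), fun ε hε => ?_⟩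
  obtain ⟨δ, hδ, H⟩ := h.2.2 (ε / 2) (by positivity)
  obtain ⟨δ', hδ', H'⟩ := h'.2.2 (ε / 2) (by positivity)
  refine ⟨min δ δ', lt_min hδ hδ', fun π hπ => ?_⟩
  have e : σ π + σ' π - (Y + Y') = (σ π - Y) + (σ' π - Y') := by abel
  rw [e, ← add_halves ε, ENNReal.ofReal_add (by positivity) (by positivity)]
  exact (eLpNorm_add_le ((h.2.1 π).sub h.1).1 ((h'.2.1 π).sub h'.1).1 one_le_two).trans_lt
    (ENNReal.add_lt_add (H π fun k hk => (hπ k hk).trans_le (min_le_left _ _))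
      (H' π fun k hk => (hπ k hk).trans_le (min_le_right _ _)))

/-- An adapted mean-square continuous process, with `E (X s - X t) ^ 2 = g s t`. -/
structure IsMSContinuous (F : Filtration ℝ mΩ) (P : Measure Ω) (a b : ℝ) (X : ℝ → Ω → ℝ)
    (g : ℝ → ℝ → ℝ) : Prop where
  adapted : ∀ s ∈ Icc a b, StronglyMeasurable[F s] (X s)
  memLp : ∀ s ∈ Icc a b, MemLp (X s) 2 P
  continuous : Continuous (Function.uncurry g)
  diag : ∀ t, g t t = 0
  eq : ∀ s ∈ Icc a b, ∀ t ∈ Icc a b, ∫⁻ ω, ‖X s ω - X t ω‖ₑ ^ 2 ∂P = ENNReal.ofReal (g s t)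

/-! ### Left-point sums of mean-square continuous processes -/

namespace IsMSContinuous

variable {a b : ℝ} {X : ℝ → Ω → ℝ} {g : ℝ → ℝ → ℝ}

/-- The simple process with the values of `X` at the left end points. -/
def leftProcess (hX : IsMSContinuous F P a b X g) (π : Partition a b) : SimpleProcess F P a b where
  toPartition := π
  ξ k := X (π.t k)
  measurable_ξ _ hk := hX.adapted _ (π.mem_Icc hk.le)
  memLp_ξ _ hk := hX.memLp _ (π.mem_Icc hk.le)

theorem exists_step (π : Partition a b) {s : ℝ} (hs : s ∈ Ioc a b) :
    ∃ k < π.n, s ∈ Ioc (π.t k) (π.t (k + 1)) := by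
  have h : s ∈ Ioc (π.t 0) (π.t π.n) := by rwa [π.t_zero, π.t_n]
  rw [← π.mono.biUnion_Ico_Ioc_map_succ] at h
  simp only [mem_iUnion] at h
  obtain ⟨k, hk, h⟩ := h
  exact ⟨k, hk.2, h⟩

theorem lintegral_leftProcess_sub (hX : IsMSContinuous F P a b X g) (π : Partition a b) {k : ℕ}
    (hk : k < π.n) {s : ℝ} (hs : s ∈ Ioc (π.t k) (π.t (k + 1))) :
    ∫⁻ ω, ‖(hX.leftProcess π).value s ω - X s ω‖ₑ ^ 2 ∂P = ENNReal.ofReal (g (π.t k) s) := by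
  rw [← hX.eq _ (π.mem_Icc hk.le) s ⟨(π.mem_Icc hk.le).1.trans hs.1.le,
    hs.2.trans (π.mem_Icc hk).2⟩]
  simp_rw [SimpleProcess.value_of_mem (hX.leftProcess π) hk hs]
  rfl

/-- Joint measurability of `X` is not assumed. Measurability in `s` comes from the error being
almost everywhere the piecewise continuous function `g (π.t k) s`. -/
theorem aemeasurable (hX : IsMSContinuous F P a b X g) (π : Partition a b) :
    AEMeasurable (fun s => ∫⁻ ω, ‖(hX.leftProcess π).value s ω - X s ω‖ₑ ^ 2 ∂P)
      (volume.restrict (Icc a b)) := by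
  -- A simple process vanishes at `a`, so the formula for the error holds only on `(a, b]`.
  rw [← Measure.restrict_congr_set Ioc_ae_eq_Icc]
  refine ⟨fun s => ∑ k ∈ Finset.range π.n, (Ioc (π.t k) (π.t (k + 1))).indicator
    (fun s => ENNReal.ofReal (g (π.t k) s)) s, ?_, ?_⟩
  · refine Finset.measurable_fun_sum _ fun k _ => Measurable.indicator ?_ measurableSet_Ioc
    have : Continuous fun s => g (π.t k) s :=
      hX.continuous.comp (continuous_const.prodMk continuous_id)
    exact this.measurable.ennreal_ofReal
  · filter_upwards [ae_restrict_mem measurableSet_Ioc] with s hs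
    obtain ⟨k, hk, hks⟩ := exists_step π hs
    rw [hX.lintegral_leftProcess_sub π hk hks,
      Finset.sum_eq_single_of_mem k (Finset.mem_range.2 hk)]
    · simp [hks]
    · intro j _ hjk
      refine indicator_of_notMem (fun hj => ?_) _
      rcases lt_or_gt_of_ne hjk with h | h
      · exact absurd (hj.2.trans (π.mono (Nat.succ_le_of_lt h))) (not_le.2 hks.1)
      · exact absurd (hks.2.trans (π.mono (Nat.succ_le_of_lt h))) (not_le.2 hj.1)

/-- `g` vanishes on the diagonal and is uniformly continuous on the square; comparing `(π.t k, s)`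
with `(s, s)` bounds the error uniformly in `s`. -/
theorem exists_mesh (hX : IsMSContinuous F P a b X g) {ε : ℝ} (hε : 0 < ε) :
    ∃ δ > 0, ∀ π : Partition a b, π.MeshLT δ →
      ∫⁻ s in Icc a b, ∫⁻ ω, ‖(hX.leftProcess π).value s ω - X s ω‖ₑ ^ 2 ∂P
        ≤ ENNReal.ofReal ε := by
  rcases lt_or_ge b a with hab | hab
  · exact ⟨1, one_pos, fun π => absurd π.le (not_le.2 hab)⟩
  have huc := (isCompact_Icc.prod isCompact_Icc).uniformContinuousOn_of_continuous
    (s := Icc a b ×ˢ Icc a b) hX.continuous.continuousOn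
  rw [Metric.uniformContinuousOn_iff] at huc
  have hba : 0 ≤ b - a := sub_nonneg.2 hab
  obtain ⟨δ, hδ, H⟩ := huc (ε / (b - a + 1)) (by positivity)
  refine ⟨δ, hδ, fun π hπ => ?_⟩
  rw [← Measure.restrict_congr_set Ioc_ae_eq_Icc]
  calc _ ≤ ∫⁻ s in Ioc a b, ENNReal.ofReal (ε / (b - a + 1)) := by
        refine setLIntegral_mono' measurableSet_Ioc fun s hs => ?_
        obtain ⟨k, hk, hks⟩ := exists_step π hs
        rw [hX.lintegral_leftProcess_sub π hk hks]
        refine ENNReal.ofReal_le_ofReal ?_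
        have hk' := π.mem_Icc hk.le
        have hs' : s ∈ Icc a b := ⟨hs.1.le, hs.2⟩
        have := H (π.t k, s) ⟨hk', hs'⟩ (s, s) ⟨hs', hs'⟩ (by
          rw [Prod.dist_eq, dist_self, max_eq_left dist_nonneg, Real.dist_eq, abs_lt]
          have := hπ k hk
          constructor <;> linarith [hks.1, hks.2])
        rw [Real.dist_eq] at this
        simp only [Function.uncurry, hX.diag, sub_zero] at this
        exact (le_abs_self _).trans this.le
    _ ≤ ENNReal.ofReal ε := by
        rw [setLIntegral_const, Real.volume_Ioc, ← ENNReal.ofReal_mul (by positivity)]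
        refine ENNReal.ofReal_le_ofReal ?_
        rw [div_mul_eq_mul_div, div_le_iff₀ (by positivity)]
        nlinarith

/-- The Itô integral of a mean-square continuous process exists and is the limit of the
left-point sums. -/
theorem exists_hasItoIntegral (hX : IsMSContinuous F P a b X g) (hB : IsBrownian F P T B)
    (ha : 0 ≤ a) (hab : a ≤ b) (hb : b ≤ T) :
    ∃ Y, HasItoIntegral F P B a b X Y ∧ MeshTendsto P (leftSum X B (a := a) (b := b)) Y := by
  have hXm : ∀ s ∈ Icc a b, AEStronglyMeasurable (X s) P := fun s hs => (hX.memLp s hs).1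
  have hI : ∀ π, (hX.leftProcess π).integral B = leftSum X B π := fun _ => rfl
  have hmem : ∀ π : Partition a b, MemLp (leftSum X B π) 2 P := fun π =>
    (hX.leftProcess π).memLp_integral hB ha hb
  have key : ∀ ε : ℝ, 0 < ε → ∃ δ > 0, ∀ π π' : Partition a b, π.MeshLT δ → π'.MeshLT δ →
      eLpNorm (leftSum X B π - leftSum X B π') 2 P < ENNReal.ofReal ε := by
    intro ε hε
    -- The comparison lemma gives `2 * (ε ^ 2 / 8 + ε ^ 2 / 8) = ε ^ 2 / 2 < ε ^ 2`.
    obtain ⟨δ, hδ, H⟩ := hX.exists_mesh (ε := ε ^ 2 / 8) (by positivity)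
    refine ⟨δ, hδ, fun π π' hπ hπ' => ?_⟩
    have h := SimpleProcess.eLpNorm_integral_sub_le hB ha hb (hX.leftProcess π)
      (hX.leftProcess π') hXm (hX.aemeasurable π)
    rw [hI, hI] at h
    have h2 : eLpNorm (leftSum X B π - leftSum X B π') 2 P ^ 2 < ENNReal.ofReal ε ^ 2 := by
      refine (h.trans (mul_le_mul_right (add_le_add (H π hπ) (H π' hπ')) 2)).trans_lt ?_
      rw [← ENNReal.ofReal_add (by positivity) (by positivity),
        show (2 : ℝ≥0∞) = ENNReal.ofReal 2 by simp, ← ENNReal.ofReal_mul zero_le_two,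
        ← ENNReal.ofReal_pow hε.le, ENNReal.ofReal_lt_ofReal_iff (by positivity)]
      nlinarith [sq_pos_of_pos hε]
    exact lt_of_pow_lt_pow_left' 2 h2
  obtain ⟨Y, hY⟩ := exists_tendstoMeanSquare_of_cauchy (P := P)
    (X := fun N => leftSum X B (Partition.equi hab N)) (fun N => hmem _) (by
      intro ε hε
      obtain ⟨ε', h0, hε'⟩ := ENNReal.lt_iff_exists_real_btwn.1 hε
      obtain ⟨δ, hδ, H⟩ := key ε' (by simpa using hε'.1)
      obtain ⟨N, hN⟩ := eventually_atTop.1 (Partition.eventually_meshLT hab hδ)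
      exact ⟨N, fun n hn k hk => (H _ _ (hN n hn) (hN k hk)).trans hε'.2⟩)
  refine ⟨Y, ⟨hXm, fun N => hX.leftProcess (Partition.equi hab N), fun N => hX.aemeasurable _,
    ?_, hY⟩, hY.memLp_limit, hmem, fun ε hε => ?_⟩
  · rw [ENNReal.tendsto_nhds_zero]
    intro ε hε
    obtain ⟨ε', h0, hε'⟩ := ENNReal.lt_iff_exists_real_btwn.1 hε
    obtain ⟨δ, hδ, H⟩ := hX.exists_mesh (ε := ε') (by simpa using hε'.1)
    filter_upwards [Partition.eventually_meshLT hab hδ] with N hN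
    exact (H _ hN).trans hε'.2.le
  · obtain ⟨δ, hδ, H⟩ := key (ε / 2) (by positivity)
    refine ⟨δ, hδ, fun π hπ => ?_⟩
    have h2 := hY.tendsto.eventually (gt_mem_nhds (show (0 : ℝ≥0∞) < ENNReal.ofReal (ε / 2) by
      simpa using hε))
    obtain ⟨N, hN, hN2⟩ := (h2.and (Partition.eventually_meshLT hab hδ)).exists
    have e : leftSum X B π - Y = (leftSum X B π - leftSum X B (Partition.equi hab N))
      + (leftSum X B (Partition.equi hab N) - Y) := by abel
    rw [e, ← add_halves ε, ENNReal.ofReal_add (by positivity) (by positivity)]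
    exact (eLpNorm_add_le ((hmem _).sub (hmem _)).1 ((hmem _).sub hY.memLp_limit).1
      one_le_two).trans_lt (ENNReal.add_lt_add (H _ _ hπ hN2) hN)

/-- Every version of the Itô integral is the limit of the left-point sums. -/
theorem meshTendsto (hX : IsMSContinuous F P a b X g) (hB : IsBrownian F P T B)
    (ha : 0 ≤ a) (hab : a ≤ b) (hb : b ≤ T) {X' : ℝ → Ω → ℝ} {Y : Ω → ℝ}
    (h : HasItoIntegral F P B a b X' Y) (hXX' : ∀ s ∈ Icc a b, X s =ᵐ[P] X' s) :
    MeshTendsto P (leftSum X B (a := a) (b := b)) Y := by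
  obtain ⟨Y', h1, h2⟩ := hX.exists_hasItoIntegral hB ha hab hb
  exact h2.congr (fun _ => EventuallyEq.rfl) (h1.unique hB ha hb h hXX')

end IsMSContinuous

end Ito

/-! ### Iterated Itô and Stratonovich integrals as mesh limits -/

section IteratedIntegrals

variable {Ω : Type*} {mΩ : MeasurableSpace Ω} {P : Measure Ω} {F : Filtration ℝ mΩ} {T : ℝ}

theorem MeshTendsto.unique {a b : ℝ} (hab : a ≤ b) {σ : Partition a b → Ω → ℝ} {Y Y' : Ω → ℝ}
    (h : MeshTendsto P σ Y) (h' : MeshTendsto P σ Y') : Y =ᵐ[P] Y' :=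
  (h.tendsto hab).unique (h'.tendsto hab)

theorem MeshTendsto.const {a b : ℝ} {Y : Ω → ℝ} (hY : MemLp Y 2 P) :
    MeshTendsto P (fun _ : Partition a b => Y) Y :=
  ⟨hY, fun _ => hY, fun ε hε => ⟨1, one_pos, fun π _ => by simpa using hε⟩⟩

theorem MeshTendsto.const_smul {a b : ℝ} {σ : Partition a b → Ω → ℝ} {Y : Ω → ℝ}
    (h : MeshTendsto P σ Y) (c : ℝ) : MeshTendsto P (fun π => c • σ π) (c • Y) := by
  refine ⟨h.1.const_smul c, fun π => (h.2.1 π).const_smul c, fun ε hε => ?_⟩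
  obtain ⟨δ, hδ, H⟩ := h.2.2 (ε / (|c| + 1)) (by positivity)
  refine ⟨δ, hδ, fun π hπ => ?_⟩
  rw [← smul_sub, eLpNorm_const_smul, Real.enorm_eq_ofReal_abs]
  calc _ ≤ ENNReal.ofReal |c| * ENNReal.ofReal (ε / (|c| + 1)) := by
        gcongr; exact (H π hπ).le
    _ < ENNReal.ofReal ε := by
        rw [← ENNReal.ofReal_mul (abs_nonneg _), ENNReal.ofReal_lt_ofReal_iff hε,
          mul_div_assoc', div_lt_iff₀ (by positivity)]
        nlinarith [abs_nonneg c]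

theorem HasItoIntegral.congr {B : ℝ → Ω → ℝ} {a b : ℝ} {X : ℝ → Ω → ℝ} {Y Y' : Ω → ℝ}
    (h : HasItoIntegral F P B a b X Y) (hY : Y =ᵐ[P] Y') : HasItoIntegral F P B a b X Y' := by
  obtain ⟨h1, S, h2, h3, h4⟩ := h
  exact ⟨h1, S, h2, h3, h4.congr (fun _ => EventuallyEq.rfl) hY⟩

theorem isMSContinuous_deterministic [IsProbabilityMeasure P] {φ : ℝ → ℝ} (hφ : Continuous φ)
    (a b : ℝ) : IsMSContinuous F P a b (fun s _ => φ s) (fun s t => (φ s - φ t) ^ 2) where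
  adapted _ _ := stronglyMeasurable_const
  memLp _ _ := memLp_const _
  continuous := by unfold Function.uncurry; fun_prop
  diag := by simp
  eq s _ t _ := by simp [enorm_sq_eq_ofReal]

/-- The process started at `0`. -/
def shift (W : ℝ → Ω → ℝ) (s : ℝ) (ω : Ω) : ℝ := W s ω - W 0 ω

variable {W B : ℝ → Ω → ℝ}

theorem IsBrownian.stronglyMeasurable_shift (hW : IsBrownian F P T W) {s : ℝ} (hs : s ∈ Icc 0 T) :
    StronglyMeasurable[F s] (shift W s) :=
  (hW.adapted s hs).sub ((hW.adapted 0 ⟨le_rfl, hs.1.trans hs.2⟩).mono (F.mono hs.1))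

theorem IsBrownian.memLp_shift (hW : IsBrownian F P T W) {s : ℝ} (hs : s ∈ Icc 0 T) :
    MemLp (shift W s) 2 P := hW.memLp_increment le_rfl hs.1 hs.2 ENNReal.ofNat_ne_top

theorem IsBrownian.isMSContinuous_shift (hW : IsBrownian F P T W) :
    IsMSContinuous F P 0 T (shift W) (fun s t => |s - t|) where
  adapted _ hs := hW.stronglyMeasurable_shift hs
  memLp _ hs := hW.memLp_shift hs
  continuous := by unfold Function.uncurry; fun_prop
  diag := by simp
  eq := by
    have key : ∀ s t, 0 ≤ s → s ≤ t → t ≤ T →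
        ∫⁻ ω, ‖shift W t ω - shift W s ω‖ₑ ^ 2 ∂P = ENNReal.ofReal (t - s) := by
      intro s t hs hst ht
      rw [← hW.integral_increment_sq hs hst ht,
        ← lintegral_enorm_sq (hW.memLp_increment hs hst ht ENNReal.ofNat_ne_top)]
      simp [shift]
    intro s hs t ht
    rcases le_total s t with h | h
    · rw [abs_sub_comm, abs_of_nonneg (sub_nonneg.2 h), ← key s t hs.1 h ht.2]
      simp_rw [enorm_sub_rev]
    · rw [abs_of_nonneg (sub_nonneg.2 h), ← key t s ht.1 h hs.2]

theorem leftSum_one {a b : ℝ} (π : Partition a b) :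
    leftSum (fun _ _ => 1) B π = fun ω => B b ω - B a ω := by
  ext ω
  simp only [leftSum, one_mul]
  exact π.sum_sub fun t => B t ω

/-- All left-point sums of the constant `1` telescope to the same increment, which must then be the
integral. -/
theorem IsBrownian.hasItoIntegral_one [IsProbabilityMeasure P] (hB : IsBrownian F P T B) {s : ℝ}
    (hs : s ∈ Icc 0 T) : HasItoIntegral F P B 0 s (fun _ _ => 1) (shift B s) := by
  obtain ⟨Y, h1, h2⟩ := (isMSContinuous_deterministic (F := F) (P := P)
    (continuous_const (y := (1 : ℝ))) 0 s).exists_hasItoIntegral hB le_rfl hs.1 hs.2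
  refine h1.congr (MeshTendsto.unique hs.1 (h2.congr (fun π => ?_) EventuallyEq.rfl)
    (MeshTendsto.const (hB.memLp_shift hs)))
  rw [leftSum_one]
  rfl

theorem IsBrownian.exists_hasIteratedItoIntegral [IsProbabilityMeasure P]
    (hW : IsBrownian F P T W) (hB : IsBrownian F P T B) (hT : 0 ≤ T) :
    ∃ J, HasIteratedItoIntegral F P W B T J := by
  obtain ⟨J, hJ, -⟩ := hW.isMSContinuous_shift.exists_hasItoIntegral hB le_rfl hT le_rfl
  exact ⟨J, shift W, fun s hs => hW.hasItoIntegral_one hs, hJ⟩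

/-- Whatever versions of the inner integrals are chosen, each agrees almost surely with `shift W s`.
Later statements about `J` are derived from these concrete sums. -/
theorem HasIteratedItoIntegral.meshTendsto [IsProbabilityMeasure P]
    (hW : IsBrownian F P T W) (hB : IsBrownian F P T B) (hT : 0 ≤ T) {J : Ω → ℝ}
    (h : HasIteratedItoIntegral F P W B T J) :
    MeshTendsto P (leftSum (shift W) B (a := 0) (b := T)) J := by
  obtain ⟨X, h1, h2⟩ := h
  exact hW.isMSContinuous_shift.meshTendsto hB le_rfl hT le_rfl h2 fun s hs =>
    (hW.hasItoIntegral_one hs).unique hW le_rfl hs.2 (h1 s hs) fun _ _ => EventuallyEq.rfl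

/-- The trapezoidal sum `∑ (X(t_k) + X(t_{k+1})) / 2 * (B(t_{k+1}) - B(t_k))`. -/
noncomputable def trapezoidSum {a b : ℝ} (X B : ℝ → Ω → ℝ) (π : Partition a b) (ω : Ω) : ℝ :=
  ∑ k ∈ Finset.range π.n, (X (π.t k) ω + X (π.t (k + 1)) ω) / 2 *
    (B (π.t (k + 1)) ω - B (π.t k) ω)

/-- The sum `∑ (W(t_{k+1}) - W(t_k)) * (B(t_{k+1}) - B(t_k))`. -/
def crossSum {a b : ℝ} (W B : ℝ → Ω → ℝ) (π : Partition a b) (ω : Ω) : ℝ :=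
  ∑ k ∈ Finset.range π.n, (W (π.t (k + 1)) ω - W (π.t k) ω) * (B (π.t (k + 1)) ω - B (π.t k) ω)

theorem trapezoidSum_one {a b : ℝ} (π : Partition a b) :
    trapezoidSum (fun _ _ => 1) B π = fun ω => B b ω - B a ω := by
  rw [← leftSum_one π]
  ext ω
  simp [trapezoidSum, leftSum]

/-- The average of the end values exceeds the left value by half an increment of `W`: this is the
Stratonovich correction before the limit. -/
theorem trapezoidSum_shift {a b : ℝ} (π : Partition a b) :
    trapezoidSum (shift W) B π = leftSum (shift W) B π + (1 / 2 : ℝ) • crossSum W B π := by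
  ext ω
  simp only [trapezoidSum, leftSum, crossSum, Pi.add_apply, Pi.smul_apply, smul_eq_mul,
    Finset.mul_sum, ← Finset.sum_add_distrib]
  refine Finset.sum_congr rfl fun k _ => ?_
  simp only [shift]
  ring

/-- `(x + y) * (x - y) = x ^ 2 - y ^ 2` telescopes, so the sum does not depend on the partition. -/
theorem trapezoidSum_shift_self {a b : ℝ} (π : Partition a b) (ω : Ω) :
    trapezoidSum (shift W) W π ω = 1 / 2 * (shift W b ω ^ 2 - shift W a ω ^ 2) := by
  have h := π.sum_sub fun t => 1 / 2 * shift W t ω ^ 2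
  rw [mul_sub, ← h]
  refine Finset.sum_congr rfl fun k _ => ?_
  simp only [shift]
  ring

theorem hasStratonovichIntegral_iff {a b : ℝ} (hab : a ≤ b) {X : ℝ → Ω → ℝ} {Y : Ω → ℝ}
    (hX : ∀ s ∈ Icc a b, AEStronglyMeasurable (X s) P)
    (hm : ∀ π : Partition a b, MemLp (trapezoidSum X B π) 2 P) :
    HasStratonovichIntegral P B a b X Y ↔ MeshTendsto P (trapezoidSum X B (a := a) (b := b)) Y :=
  ⟨fun h => ⟨h.2.2.1, hm, h.2.2.2⟩, fun h => ⟨hab, hX, h.1, h.2.2⟩⟩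

theorem IsBrownian.hasStratonovichIntegral_one_iff [IsProbabilityMeasure P]
    (hW : IsBrownian F P T W) {s : ℝ} (hs : s ∈ Icc 0 T) {Y : Ω → ℝ} :
    HasStratonovichIntegral P W 0 s (fun _ _ => 1) Y ↔ shift W s =ᵐ[P] Y := by
  have hm : ∀ π : Partition 0 s, shift W s =ᵐ[P] trapezoidSum (fun _ _ => 1) W π := fun π => by
    rw [trapezoidSum_one]; rfl
  have hc := (MeshTendsto.const (a := 0) (b := s) (hW.memLp_shift hs)).congr hm EventuallyEq.rfl
  rw [hasStratonovichIntegral_iff hs.1 (fun _ _ => aestronglyMeasurable_const) hc.2.1]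
  exact ⟨fun h => hc.unique hs.1 h, fun h => hc.congr (fun _ => EventuallyEq.rfl) h⟩

theorem IsBrownian.memLp_crossSum (hW : IsBrownian F P T W) (hB : IsBrownian F P T B)
    (π : Partition 0 T) : MemLp (crossSum W B π) 2 P := by
  refine memLp_finsetSum _ fun k hk => ?_
  have hk := Finset.mem_range.1 hk
  have h0 := (π.mem_Icc hk.le).1
  have h1 := (π.mem_Icc hk).2
  -- Hölder with `1/4 + 1/4 = 1/2`: fourth moments of the increments suffice, whatever the
  -- dependence between `W` and `B`.
  have : ENNReal.HolderTriple 4 4 2 := ⟨by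
    rw [← ENNReal.toReal_eq_toReal_iff' (by simp) (by simp), ENNReal.toReal_add (by simp) (by simp)]
    simp; norm_num⟩
  exact (hB.memLp_increment h0 (π.step_le k) h1 (p := 4) ENNReal.ofNat_ne_top).mul
    (hW.memLp_increment h0 (π.step_le k) h1 (p := 4) ENNReal.ofNat_ne_top)

theorem IsBrownian.memLp_leftSum (hW : IsBrownian F P T W) (hB : IsBrownian F P T B)
    (π : Partition 0 T) : MemLp (leftSum (shift W) B π) 2 P :=
  (hW.isMSContinuous_shift.leftProcess π).memLp_integral hB le_rfl le_rfl

/-- The inner integral is almost surely `shift W s`. Each partition involves finitely many times, so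
the exceptional null sets can be united and the definition reduces to one mesh limit. -/
theorem hasIteratedStratonovichIntegral_iff [IsProbabilityMeasure P]
    (hW : IsBrownian F P T W) (hB : IsBrownian F P T B) (hT : 0 ≤ T) {S : Ω → ℝ} :
    HasIteratedStratonovichIntegral P W B T S ↔
      MeshTendsto P (trapezoidSum (shift W) B (a := 0) (b := T)) S := by
  have hm : ∀ π : Partition 0 T, MemLp (trapezoidSum (shift W) B π) 2 P := fun π => by
    rw [trapezoidSum_shift]
    exact (hW.memLp_leftSum hB π).add ((hW.memLp_crossSum hB π).const_smul _)
  constructor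
  · rintro ⟨X, h1, h2⟩
    have hX : ∀ s ∈ Icc 0 T, shift W s =ᵐ[P] X s := fun s hs =>
      (hW.hasStratonovichIntegral_one_iff hs).1 (h1 s hs)
    have he : ∀ π : Partition 0 T, trapezoidSum (shift W) B π =ᵐ[P] trapezoidSum X B π := by
      intro π
      have : ∀ᵐ ω ∂P, ∀ k ∈ Finset.range (π.n + 1), shift W (π.t k) ω = X (π.t k) ω :=
        (Finset.eventually_all _).2 fun k hk =>
          hX _ (π.mem_Icc (Nat.lt_succ_iff.1 (Finset.mem_range.1 hk)))
      filter_upwards [this] with ω hω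
      refine Finset.sum_congr rfl fun k hk => ?_
      have hk := Finset.mem_range.1 hk
      rw [hω k (Finset.mem_range.2 (by lia)), hω (k + 1) (Finset.mem_range.2 (by lia))]
    rw [hasStratonovichIntegral_iff hT h2.2.1 fun π => (hm π).ae_eq (he π)] at h2
    exact h2.congr (fun π => (he π).symm) EventuallyEq.rfl
  · intro h
    exact ⟨shift W, fun s hs => (hW.hasStratonovichIntegral_one_iff hs).2 EventuallyEq.rfl,
      (hasStratonovichIntegral_iff hT (fun s hs => (hW.memLp_shift hs).1) hm).2 h⟩

/-- Sums of orthogonal terms of quadratic size over the intervals of a partition tend to `0`. -/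
theorem meshTendsto_zero_of_orthogonal {a b : ℝ} {u : ℝ → ℝ → Ω → ℝ} {M : ℝ} (hM : 0 ≤ M)
    (hu : ∀ s t, a ≤ s → s ≤ t → t ≤ b → MemLp (u s t) 2 P)
    (hu2 : ∀ s t, a ≤ s → s ≤ t → t ≤ b → ∫ ω, u s t ω * u s t ω ∂P ≤ M * (t - s) ^ 2)
    (horth : ∀ s t s' t', a ≤ s → s ≤ t → t ≤ s' → s' ≤ t' → t' ≤ b →
      ∫ ω, u s t ω * u s' t' ω ∂P = 0) :
    MeshTendsto P (fun (π : Partition a b) ω => ∑ k ∈ Finset.range π.n, u (π.t k) (π.t (k + 1)) ω)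
      0 := by
  have hm : ∀ π : Partition a b, ∀ k ∈ Finset.range π.n, MemLp (u (π.t k) (π.t (k + 1))) 2 P :=
    fun π k hk => hu _ _ (π.mem_Icc (Finset.mem_range.1 hk).le).1 (π.step_le k)
      (π.mem_Icc (Finset.mem_range.1 hk)).2
  have hsum : ∀ π : Partition a b,
      MemLp (fun ω => ∑ k ∈ Finset.range π.n, u (π.t k) (π.t (k + 1)) ω) 2 P := fun π =>
    memLp_finsetSum _ (hm π)
  refine ⟨MemLp.zero, hsum, fun ε hε => ?_⟩
  -- Chosen so that the bound `M * δ * (b - a)` on the second moment is at most `ε ^ 2 / 2`; the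
  -- added ones keep the denominator positive.
  set δ := ε ^ 2 / (2 * (M + 1) * (|b - a| + 1))
  have hδ : 0 < δ := by positivity
  refine ⟨δ, hδ, fun π hπ => ?_⟩
  rw [sub_zero]
  refine lt_of_pow_lt_pow_left' 2 ?_
  rw [eLpNorm_two_sq_eq (hsum π), ← ENNReal.ofReal_pow hε.le,
    ENNReal.ofReal_lt_ofReal_iff (by positivity)]
  have hint : ∀ i ∈ Finset.range π.n, ∀ j ∈ Finset.range π.n, Integrable
      (fun ω => u (π.t i) (π.t (i + 1)) ω * u (π.t j) (π.t (j + 1)) ω) P :=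
    fun i hi j hj => (hm π i hi).integrable_mul (hm π j hj)
  calc ∫ ω, (∑ k ∈ Finset.range π.n, u (π.t k) (π.t (k + 1)) ω) ^ 2 ∂P
      = ∑ i ∈ Finset.range π.n, ∑ j ∈ Finset.range π.n,
          ∫ ω, u (π.t i) (π.t (i + 1)) ω * u (π.t j) (π.t (j + 1)) ω ∂P := by
        simp_rw [sq, Finset.sum_mul_sum]
        rw [integral_finsetSum _ fun i hi => integrable_finsetSum _ fun j hj => hint i hi j hj]
        exact Finset.sum_congr rfl fun i hi => integral_finsetSum _ fun j hj => hint i hi j hj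
    _ = ∑ i ∈ Finset.range π.n, ∫ ω, u (π.t i) (π.t (i + 1)) ω * u (π.t i) (π.t (i + 1)) ω ∂P := by
        refine Finset.sum_congr rfl fun i hi => Finset.sum_eq_single_of_mem i hi fun j hj hji => ?_
        have hi := Finset.mem_range.1 hi
        have hj := Finset.mem_range.1 hj
        rcases lt_or_gt_of_ne hji with h | h
        · simp_rw [mul_comm (u (π.t i) _ _)]
          exact horth _ _ _ _ (π.mem_Icc hj.le).1 (π.step_le j) (π.mono (Nat.succ_le_of_lt h))
            (π.step_le i) (π.mem_Icc hi).2
        · exact horth _ _ _ _ (π.mem_Icc hi.le).1 (π.step_le i) (π.mono (Nat.succ_le_of_lt h))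
            (π.step_le j) (π.mem_Icc hj).2
    _ ≤ ∑ i ∈ Finset.range π.n, M * δ * (π.t (i + 1) - π.t i) := by
        refine Finset.sum_le_sum fun i hi => ?_
        have hi := Finset.mem_range.1 hi
        refine (hu2 _ _ (π.mem_Icc hi.le).1 (π.step_le i) (π.mem_Icc hi).2).trans ?_
        rw [sq, mul_assoc]
        have := sub_nonneg.2 (π.step_le i)
        exact mul_le_mul_of_nonneg_left (mul_le_mul_of_nonneg_right (hπ i hi).le this) hM
    _ = M * δ * (b - a) := by rw [← Finset.mul_sum, π.sum_sub fun x => x]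
    _ ≤ (M + 1) * δ * (|b - a| + 1) := by
        have := le_abs_self (b - a)
        have := sub_nonneg.2 π.le
        gcongr <;> linarith
    _ = ε ^ 2 / 2 := by simp only [δ]; field_simp
    _ < ε ^ 2 := by linarith [sq_pos_of_pos hε]

theorem IsBrownian.memLp_increment_sq (hW : IsBrownian F P T W) {s t : ℝ} (hs : 0 ≤ s)
    (hst : s ≤ t) (ht : t ≤ T) : MemLp (fun ω => (W t ω - W s ω) ^ 2) 2 P := by
  have h := hW.memLp_increment hs hst ht (p := 4) ENNReal.ofNat_ne_top
  refine (memLp_two_iff_integrable_sq (f := fun ω => (W t ω - W s ω) ^ 2) (h.1.pow 2)).2 ?_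
  refine (h.integrable_norm_pow (p := 4) (by norm_num)).congr (ae_of_all _ fun ω => ?_)
  simp only [Real.norm_eq_abs]
  rw [← pow_mul, (by decide : Even 4).pow_abs]

/-- Quadratic variation: the variables `(W t - W s) ^ 2 - (t - s)` over non-overlapping intervals
are orthogonal, with second moment `(K - 1) * (t - s) ^ 2`, and the subtracted lengths add up to
`T`. -/
theorem IsBrownian.meshTendsto_crossSum_self [IsProbabilityMeasure P] (hW : IsBrownian F P T W) :
    MeshTendsto P (crossSum W W (a := 0) (b := T)) (fun _ => T) := by
  set K := ∫ x, x ^ 4 ∂gaussianReal 0 1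
  have hK : 0 ≤ K := integral_nonneg fun x => by positivity
  have hm2 : ∀ s t, 0 ≤ s → s ≤ t → t ≤ T → MemLp (fun ω => (W t ω - W s ω) ^ 2) 2 P :=
    fun s t hs hst ht => hW.memLp_increment_sq hs hst ht
  have hm : ∀ s t, 0 ≤ s → s ≤ t → t ≤ T →
      MemLp (fun ω => (W t ω - W s ω) ^ 2 - (t - s)) 2 P := fun s t hs hst ht =>
    (hm2 s t hs hst ht).sub (memLp_const _)
  have h0 := meshTendsto_zero_of_orthogonal (P := P) (a := 0) (b := T)
    (u := fun s t ω => (W t ω - W s ω) ^ 2 - (t - s)) hK hm (fun s t hs hst ht => ?_)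
    (fun s t s' t' hs hst hts hs't' ht' => ?_)
  · refine (h0.add (MeshTendsto.const (memLp_const T))).congr (fun π => ?_) ?_
    · refine ae_of_all _ fun ω => ?_
      simp only [Pi.add_apply, crossSum, Finset.sum_sub_distrib _ _]
      have := π.sum_sub fun x => x
      rw [Finset.sum_sub_distrib] at this
      rw [this]
      simp [sq]
    · exact ae_of_all _ fun ω => by simp
  · have i2 := (hm2 s t hs hst ht).integrable one_le_two
    have i4 := (hm2 s t hs hst ht).integrable_sq
    have i5 : Integrable (fun ω => ((W t ω - W s ω) ^ 2) ^ 2 - 2 * (t - s) * (W t ω - W s ω) ^ 2)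
        P := i4.sub (i2.const_mul _)
    have e : ∫ ω, ((W t ω - W s ω) ^ 2 - (t - s)) * ((W t ω - W s ω) ^ 2 - (t - s)) ∂P
        = (t - s) ^ 2 * K - (t - s) ^ 2 := by
      have e1 : ∀ ω, ((W t ω - W s ω) ^ 2 - (t - s)) * ((W t ω - W s ω) ^ 2 - (t - s))
          = (((W t ω - W s ω) ^ 2) ^ 2 - 2 * (t - s) * (W t ω - W s ω) ^ 2) + (t - s) ^ 2 :=
        fun ω => by ring
      simp_rw [e1]
      rw [integral_add i5 (integrable_const _),
        integral_sub i4 (i2.const_mul _), integral_const_mul, hW.integral_increment_sq hs hst ht]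
      simp_rw [← pow_mul]
      rw [hW.integral_increment_pow_four hs hst ht]
      simp
      ring
    rw [e]
    nlinarith [sq_nonneg (t - s)]
  · have hs' := hs.trans (hst.trans hts)
    have htT := hts.trans (hs't'.trans ht')
    have hX : StronglyMeasurable[F s'] (fun ω => (W t ω - W s ω) ^ 2 - (t - s)) :=
      ((((hW.adapted t ⟨hs.trans hst, htT⟩).mono (F.mono hts)).sub
        ((hW.adapted s ⟨hs, hst.trans htT⟩).mono (F.mono (hst.trans hts)))).pow 2).sub
        stronglyMeasurable_const
    have hXm := hm s t hs hst htT
    simp_rw [mul_sub (_ - _)]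
    have i1 : Integrable (fun ω => ((W t ω - W s ω) ^ 2 - (t - s)) * (W t' ω - W s' ω) ^ 2) P :=
      hXm.integrable_mul (hm2 s' t' hs' hs't' ht')
    have i2 : Integrable (fun ω => ((W t ω - W s ω) ^ 2 - (t - s)) * t') P :=
      (hXm.integrable one_le_two).mul_const _
    have i3 : Integrable (fun ω => ((W t ω - W s ω) ^ 2 - (t - s)) * s') P :=
      (hXm.integrable one_le_two).mul_const _
    have i4 : Integrable (fun ω => ((W t ω - W s ω) ^ 2 - (t - s)) * t'
        - ((W t ω - W s ω) ^ 2 - (t - s)) * s') P := i2.sub i3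
    rw [integral_sub i1 i4, integral_sub i2 i3,
      hW.integral_mul_increment_sq hs' hs't' ht' hX, integral_mul_const, integral_mul_const]
    ring

/-- The iterated Stratonovich integral of a Brownian motion against itself. -/
theorem IsBrownian.meshTendsto_trapezoidSum_self (hW : IsBrownian F P T W) (hT : 0 ≤ T) :
    MeshTendsto P (trapezoidSum (shift W) W (a := 0) (b := T))
      (fun ω => 1 / 2 * shift W T ω ^ 2) := by
  have hm : MemLp (fun ω => shift W T ω ^ 2) 2 P := hW.memLp_increment_sq le_rfl hT le_rfl
  refine (MeshTendsto.const (hm.const_mul (1 / 2))).congr (fun π => ae_of_all _ fun ω => ?_)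
    EventuallyEq.rfl
  rw [trapezoidSum_shift_self]
  simp [shift]

/-- The iterated Itô integral of a Brownian motion against itself. -/
theorem HasIteratedItoIntegral.ae_eq_self [IsProbabilityMeasure P] (hW : IsBrownian F P T W)
    (hT : 0 ≤ T) {J : Ω → ℝ} (h : HasIteratedItoIntegral F P W W T J) :
    J =ᵐ[P] fun ω => 1 / 2 * shift W T ω ^ 2 - T / 2 := by
  have h1 := (h.meshTendsto hW hW hT).add (hW.meshTendsto_crossSum_self.const_smul (1 / 2))
  have h2 := (h1.congr (fun π => by rw [trapezoidSum_shift]) EventuallyEq.rfl).unique hT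
    (hW.meshTendsto_trapezoidSum_self hT)
  filter_upwards [h2] with ω hω
  simp only [Pi.add_apply, Pi.smul_apply, smul_eq_mul] at hω
  linarith

end IteratedIntegrals

/-! ### Deterministic properties of the coefficients -/

/-- A continuous orthonormal system whose zeroth function is constant. -/
structure IsOrthonormalSystem (φ : ℕ → ℝ → ℝ) (T : ℝ) : Prop where
  continuous : ∀ j, Continuous (φ j)
  zero : ∀ x, φ 0 x = 1 / √T
  orthonormal : ∀ i j, ∫ x in (0 : ℝ)..T, φ i x * φ j x = if i = j then 1 else 0

/-- The partial sums of the squared coefficients of the indicator function of the triangle. -/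
noncomputable def coeffSqSum (φ : ℕ → ℝ → ℝ) (T : ℝ) (p : ℕ) : ℝ :=
  ∑ j₁ ∈ Finset.range p, ∑ j₂ ∈ Finset.range p, doubleCoeff φ T j₂ j₁ ^ 2

/-- An orthonormal system that satisfies the nontrivial inequality in Parseval's identity for the
indicator function of the triangle `τ < s`. -/
structure IsAdmissibleSystem (φ : ℕ → ℝ → ℝ) (T : ℝ) : Prop extends IsOrthonormalSystem φ T where
  parseval : ∀ ε > 0, ∃ p, T ^ 2 / 2 - ε ≤ coeffSqSum φ T p

/-- Integration by parts for the two primitives, which vanish at `0`. Both the diagonal formula and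
the antisymmetry of the remaining coefficients come from it. -/
theorem doubleCoeff_add_swap {φ : ℕ → ℝ → ℝ} (hφ : ∀ j, Continuous (φ j)) (T : ℝ) (i j : ℕ) :
    doubleCoeff φ T i j + doubleCoeff φ T j i
      = (∫ τ in (0 : ℝ)..T, φ i τ) * ∫ τ in (0 : ℝ)..T, φ j τ := by
  have hd : ∀ k x, HasDerivAt (fun s => ∫ τ in (0 : ℝ)..s, φ k τ) (φ k x) x := fun k x =>
    intervalIntegral.integral_hasDerivAt_right ((hφ k).intervalIntegrable _ _)
      ((hφ k).stronglyMeasurableAtFilter _ _) (hφ k).continuousAt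
  have h := intervalIntegral.integral_mul_deriv_eq_deriv_mul (a := 0) (b := T) (fun x _ => hd i x)
    (fun x _ => hd j x) ((hφ i).intervalIntegrable _ _) ((hφ j).intervalIntegrable _ _)
  simp only [intervalIntegral.integral_same, mul_zero, sub_zero] at h
  simp_rw [mul_comm _ (φ j _)] at h
  unfold doubleCoeff
  rw [h]; ring

namespace IsOrthonormalSystem

variable {φ : ℕ → ℝ → ℝ} {T : ℝ}

/-- Orthogonality to the constant function `φ 0` says that the mean is zero. -/
theorem integral_eq (h : IsOrthonormalSystem φ T) (hT : 0 < T) (j : ℕ) :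
    ∫ x in (0 : ℝ)..T, φ j x = if j = 0 then √T else 0 := by
  have h0 := h.orthonormal j 0
  simp_rw [h.zero, intervalIntegral.integral_mul_const] at h0
  have hs : √T ≠ 0 := (Real.sqrt_pos.2 hT).ne'
  field_simp at h0
  rw [h0]; split_ifs <;> simp

theorem doubleCoeff_self (h : IsOrthonormalSystem φ T) (j : ℕ) :
    doubleCoeff φ T j j = 1 / 2 * (∫ x in (0 : ℝ)..T, φ j x) ^ 2 := by
  linarith [doubleCoeff_add_swap h.continuous T j j]

theorem half_integral_zero_sq (h : IsOrthonormalSystem φ T) (hT : 0 < T) :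
    1 / 2 * (∫ x in (0 : ℝ)..T, φ 0 x) ^ 2 = T / 2 := by
  rw [h.integral_eq hT, if_pos rfl, Real.sq_sqrt hT.le]; ring

theorem doubleCoeff_self_eq (h : IsOrthonormalSystem φ T) (hT : 0 < T) (j : ℕ) :
    doubleCoeff φ T j j = if j = 0 then T / 2 else 0 := by
  split_ifs with hj
  · rw [hj, h.doubleCoeff_self, h.half_integral_zero_sq hT]
  · rw [h.doubleCoeff_self, h.integral_eq hT, if_neg hj]; simp

theorem hasSum_doubleCoeff_self (h : IsOrthonormalSystem φ T) (hT : 0 < T) :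
    HasSum (fun j => doubleCoeff φ T j j) (T / 2) := by
  simp_rw [h.doubleCoeff_self_eq hT]
  exact hasSum_ite_eq 0 (T / 2)

/-- Only the symmetric part of the coefficients acts on `z j₁ * z j₂`. It has rank one, so the sum
is half the square of `∑ (∫ φ j) * z j`, in which only `j = 0` survives. Hence the value is the same
for every `p`. -/
theorem sum_doubleCoeff_mul (h : IsOrthonormalSystem φ T) (hT : 0 < T) (z : ℕ → ℝ) (p : ℕ) :
    ∑ j₁ ∈ Finset.range (p + 1), ∑ j₂ ∈ Finset.range (p + 1),
      doubleCoeff φ T j₂ j₁ * (z j₁ * z j₂) = T / 2 * z 0 ^ 2 := by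
  set c : ℕ → ℝ := fun j => ∫ x in (0 : ℝ)..T, φ j x
  have h1 : ∑ j₁ ∈ Finset.range (p + 1), ∑ j₂ ∈ Finset.range (p + 1),
      doubleCoeff φ T j₂ j₁ * (z j₁ * z j₂) + ∑ j₁ ∈ Finset.range (p + 1),
      ∑ j₂ ∈ Finset.range (p + 1), doubleCoeff φ T j₁ j₂ * (z j₁ * z j₂)
      = (∑ j ∈ Finset.range (p + 1), c j * z j) * ∑ j ∈ Finset.range (p + 1), c j * z j := by
    rw [Finset.sum_mul_sum, ← Finset.sum_add_distrib]
    refine Finset.sum_congr rfl fun i _ => ?_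
    rw [← Finset.sum_add_distrib]
    refine Finset.sum_congr rfl fun j _ => ?_
    rw [← add_mul, doubleCoeff_add_swap h.continuous]
    ring
  have h2 : ∑ j₁ ∈ Finset.range (p + 1), ∑ j₂ ∈ Finset.range (p + 1),
      doubleCoeff φ T j₁ j₂ * (z j₁ * z j₂) = ∑ j₁ ∈ Finset.range (p + 1),
      ∑ j₂ ∈ Finset.range (p + 1), doubleCoeff φ T j₂ j₁ * (z j₁ * z j₂) := by
    rw [Finset.sum_comm]
    simp_rw [mul_comm (z _) (z _)]
  have h3 : ∑ j ∈ Finset.range (p + 1), c j * z j = √T * z 0 := by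
    rw [Finset.sum_eq_single_of_mem 0 (by simp)]
    · simp only [c]; rw [h.integral_eq hT, if_pos rfl]
    · intro j _ hj
      simp only [c]; rw [h.integral_eq hT, if_neg hj, zero_mul]
  rw [h2, h3] at h1
  have : √T * √T = T := Real.mul_self_sqrt hT.le
  linear_combination (1 / 2 : ℝ) * h1 + (z 0 ^ 2 / 2) * this

theorem sum_doubleCoeff_diag (h : IsOrthonormalSystem φ T) (hT : 0 < T) (p : ℕ) :
    ∑ j₁ ∈ Finset.range (p + 1), ∑ j₂ ∈ Finset.range (p + 1),
      doubleCoeff φ T j₂ j₁ * (if j₁ = j₂ then 1 else 0) = T / 2 := by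
  simp_rw [mul_ite, mul_one, mul_zero]
  rw [Finset.sum_congr rfl fun j₁ hj => by rw [Finset.sum_ite_eq, if_pos hj]]
  simp_rw [h.doubleCoeff_self_eq hT]
  simp

theorem doubleCoeff_swap (h : IsOrthonormalSystem φ T) (hT : 0 < T) {j p : ℕ} (hp : p ≠ 0) :
    doubleCoeff φ T p j = - doubleCoeff φ T j p := by
  have := doubleCoeff_add_swap h.continuous T p j
  rw [h.integral_eq hT p, if_neg hp, zero_mul] at this
  linarith

theorem coeffSqSum_one (h : IsOrthonormalSystem φ T) (hT : 0 < T) :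
    coeffSqSum φ T 1 = T ^ 2 / 4 := by
  simp only [coeffSqSum, Finset.sum_range_one]
  rw [h.doubleCoeff_self_eq hT, if_pos rfl]; ring

/-- Enlarging the square adds a row and a column; one entry of each is kept, and they have equal
squares by antisymmetry. Such single entries are enough to reach `T ^ 2 / 2` for both systems. -/
theorem coeffSqSum_succ_le (h : IsOrthonormalSystem φ T) (hT : 0 < T) {j p : ℕ} (hj : j < p) :
    coeffSqSum φ T p + 2 * doubleCoeff φ T j p ^ 2 ≤ coeffSqSum φ T (p + 1) := by
  have h1 : ∀ u : ℕ → ℝ, u j ^ 2 ≤ ∑ i ∈ Finset.range p, u i ^ 2 := fun u =>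
    Finset.single_le_sum (f := fun i => u i ^ 2) (fun i _ => sq_nonneg _) (Finset.mem_range.2 hj)
  have h2 := h1 fun i => doubleCoeff φ T i p
  have h3 := h1 fun i => doubleCoeff φ T p i
  have h4 : doubleCoeff φ T p j ^ 2 = doubleCoeff φ T j p ^ 2 := by
    rw [h.doubleCoeff_swap hT (Nat.ne_zero_of_lt hj), neg_sq]
  simp only [coeffSqSum, Finset.sum_range_succ, Finset.sum_add_distrib]
  nlinarith [sq_nonneg (doubleCoeff φ T p p)]

end IsOrthonormalSystem

/-! ### Independent components -/

section Independence

variable {Ω : Type*} {mΩ : MeasurableSpace Ω} {P : Measure Ω} {F : Filtration ℝ mΩ} {T : ℝ}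
  {W : ℝ → Ω → ℝ}

/-- The `σ`-algebra generated by a process on `[0, T]`. -/
abbrev pathSigma (W : ℝ → Ω → ℝ) (T : ℝ) : MeasurableSpace Ω :=
  MeasurableSpace.comap (fun ω (t : Icc (0 : ℝ) T) => W t ω) inferInstance

theorem stronglyMeasurable_pathSigma {t : ℝ} (ht : t ∈ Icc 0 T) :
    StronglyMeasurable[pathSigma W T] (W t) := by
  have h : Measurable[pathSigma W T] (W t) :=
    (measurable_pi_apply (⟨t, ht⟩ : Icc (0 : ℝ) T)).comp
      (comap_measurable (fun ω (t : Icc (0 : ℝ) T) => W t ω))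
  exact h.stronglyMeasurable

theorem IsBrownian.pathSigma_le (hW : IsBrownian F P T W) : pathSigma W T ≤ mΩ := by
  refine Measurable.comap_le (measurable_pi_lambda _ fun t => ?_)
  exact ((hW.adapted t t.2).mono (F.le _)).measurable

/-- The functions measurable for `m` form a closed subspace of `L²`. Thus a Wiener integral is
determined by its own path up to null sets, and independence of the paths passes to the integrals.
-/
theorem TendstoMeanSquare.aestronglyMeasurable {m : MeasurableSpace Ω} (hm : m ≤ mΩ)
    {X : ℕ → Ω → ℝ} {Y : Ω → ℝ} (h : TendstoMeanSquare P X Y)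
    (hX : ∀ n, AEStronglyMeasurable[m] (X n) P) : AEStronglyMeasurable[m] Y P := by
  have ht : Tendsto (fun n => (h.memLp n).toLp (X n)) atTop (𝓝 (h.memLp_limit.toLp Y)) :=
    (Lp.tendsto_Lp_iff_tendsto_eLpNorm'' _ _ _ _).2 h.tendsto
  have hc := (isClosed_aestronglyMeasurable (F := ℝ) (p := 2) (μ := P) hm).mem_of_tendsto ht
    (Eventually.of_forall fun n => (hX n).congr (h.memLp n).coeFn_toLp.symm)
  exact AEStronglyMeasurable.congr hc h.memLp_limit.coeFn_toLp

theorem indepFun_of_indep {m₁ m₂ : MeasurableSpace Ω} (h : Indep m₁ m₂ P) {X Y : Ω → ℝ}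
    (hX : AEStronglyMeasurable[m₁] X P) (hY : AEStronglyMeasurable[m₂] Y P) : IndepFun X Y P := by
  have : IndepFun (hX.mk X) (hY.mk Y) P := by
    rw [IndepFun_iff_Indep]
    exact indep_of_indep_of_le_left (indep_of_indep_of_le_right h
      hY.stronglyMeasurable_mk.measurable.comap_le) hX.stronglyMeasurable_mk.measurable.comap_le
  exact this.congr hX.ae_eq_mk.symm hY.ae_eq_mk.symm

theorem integral_mul_of_indep {m₁ m₂ : MeasurableSpace Ω} (h₁ : m₁ ≤ mΩ) (h₂ : m₂ ≤ mΩ)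
    (h : Indep m₁ m₂ P) {X Y : Ω → ℝ}
    (hX : AEStronglyMeasurable[m₁] X P) (hY : AEStronglyMeasurable[m₂] Y P) :
    ∫ ω, X ω * Y ω ∂P = (∫ ω, X ω ∂P) * ∫ ω, Y ω ∂P :=
  (indepFun_of_indep h hX hY).integral_fun_mul_eq_mul_integral (hX.mono h₁) (hY.mono h₂)

theorem memLp_mul_of_indep {m₁ m₂ : MeasurableSpace Ω} (h : Indep m₁ m₂ P) {X Y : Ω → ℝ}
    (hX : AEStronglyMeasurable[m₁] X P) (hY : AEStronglyMeasurable[m₂] Y P)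
    (hX2 : MemLp X 2 P) (hY2 : MemLp Y 2 P) : MemLp (fun ω => X ω * Y ω) 2 P := by
  refine (memLp_two_iff_integrable_sq (f := fun ω => X ω * Y ω) (hX2.1.mul hY2.1)).2 ?_
  have hi := indepFun_of_indep h (hX.pow 2) (hY.pow 2)
  refine (hi.integrable_mul hX2.integrable_sq hY2.integrable_sq).congr (ae_of_all _ fun ω => ?_)
  simp [mul_pow]

/-- The expansion of a square-integrable variable in a finite orthonormal family. -/
theorem integral_sub_sum_sq {ι : Type*} [DecidableEq ι] (u : Finset ι) {J : Ω → ℝ}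
    (hJ : MemLp J 2 P) {η : ι → Ω → ℝ} (hη : ∀ i ∈ u, MemLp (η i) 2 P) (c : ι → ℝ)
    (hc : ∀ i ∈ u, ∫ ω, J ω * η i ω ∂P = c i)
    (horth : ∀ i ∈ u, ∀ j ∈ u, ∫ ω, η i ω * η j ω ∂P = if i = j then 1 else 0) :
    ∫ ω, (J ω - ∑ i ∈ u, c i * η i ω) ^ 2 ∂P = (∫ ω, J ω * J ω ∂P) - ∑ i ∈ u, c i ^ 2 := by
  set D : Ω → ℝ := fun ω => ∑ i ∈ u, c i * η i ω
  have hD : MemLp D 2 P := memLp_finsetSum _ fun i hi => (hη i hi).const_mul _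
  have e1 : ∀ X : Ω → ℝ, MemLp X 2 P → ∫ ω, X ω * D ω ∂P = ∑ i ∈ u, c i * ∫ ω, X ω * η i ω ∂P := by
    intro X hX
    simp only [D, Finset.mul_sum]
    have hint : ∀ i ∈ u, Integrable (fun ω => X ω * (c i * η i ω)) P := fun i hi =>
      hX.integrable_mul ((hη i hi).const_mul _)
    rw [integral_finsetSum _ hint]
    refine Finset.sum_congr rfl fun i _ => ?_
    rw [← integral_const_mul]
    congr 1; ext ω; ring
  have e2 : ∫ ω, J ω * D ω ∂P = ∑ i ∈ u, c i ^ 2 := by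
    rw [e1 J hJ]
    exact Finset.sum_congr rfl fun i hi => by rw [hc i hi, sq]
  have e3 : ∫ ω, D ω * D ω ∂P = ∑ i ∈ u, c i ^ 2 := by
    rw [e1 D hD]
    refine Finset.sum_congr rfl fun i hi => ?_
    have : ∫ ω, D ω * η i ω ∂P = c i := by
      simp_rw [mul_comm (D _)]
      rw [e1 _ (hη i hi), Finset.sum_eq_single_of_mem i hi]
      · rw [horth i hi i hi, if_pos rfl, mul_one]
      · intro j hj hji
        rw [horth i hi j hj, if_neg hji.symm, mul_zero]
    rw [this, sq]
  have i1 : Integrable (fun ω => J ω * J ω) P := hJ.integrable_mul hJ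
  have i2 : Integrable (fun ω => J ω * D ω) P := hJ.integrable_mul hD
  have i3 : Integrable (fun ω => D ω * D ω) P := hD.integrable_mul hD
  have i4 : Integrable (fun ω => J ω * J ω - 2 * (J ω * D ω)) P := i1.sub (i2.const_mul 2)
  have e4 : ∀ ω, (J ω - D ω) ^ 2 = J ω * J ω - 2 * (J ω * D ω) + D ω * D ω := fun ω => by ring
  change ∫ ω, (J ω - D ω) ^ 2 ∂P = _
  simp_rw [e4]
  rw [integral_add i4 i3, integral_sub i1 (i2.const_mul 2), integral_const_mul, e2, e3]
  ring

end Independence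

/-! ### Wiener integrals of deterministic functions -/

section WienerIntegral

variable {Ω : Type*} {mΩ : MeasurableSpace Ω} {P : Measure Ω} [IsProbabilityMeasure P]
  {F : Filtration ℝ mΩ} {T : ℝ} {W B : ℝ → Ω → ℝ}

theorem HasItoIntegral.meshTendsto_deterministic (hW : IsBrownian F P T W) (hT : 0 ≤ T)
    {φ : ℝ → ℝ} (hφ : Continuous φ) {Z : Ω → ℝ}
    (hZ : HasItoIntegral F P W 0 T (fun s _ => φ s) Z) :
    MeshTendsto P (leftSum (fun s _ => φ s) W (a := 0) (b := T)) Z :=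
  (isMSContinuous_deterministic hφ 0 T).meshTendsto hW le_rfl hT le_rfl hZ
    fun _ _ => EventuallyEq.rfl

theorem HasItoIntegral.ae_eq_const (hW : IsBrownian F P T W) (hT : 0 ≤ T) {c : ℝ} {Z : Ω → ℝ}
    (hZ : HasItoIntegral F P W 0 T (fun _ _ => c) Z) : Z =ᵐ[P] fun ω => c * shift W T ω := by
  have h := hZ.meshTendsto_deterministic hW hT continuous_const
  refine h.unique hT ((MeshTendsto.const ((hW.memLp_shift ⟨hT, le_rfl⟩).const_mul c)).congr
    (fun π => ae_of_all _ fun ω => ?_) EventuallyEq.rfl)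
  simp only [leftSum, ← Finset.mul_sum]
  rw [π.sum_sub fun t => W t ω]
  rfl

/-- The covariance of a left-point sum with the increment is `∑ φ (t k)` times the length of the
overlap with `(c, d]`. This is a Riemann–Stieltjes sum against the primitive `ψ` integrates to,
where `ψ` is the indicator of `(c, d]`, so `c` and `d` need not be partition points. -/
theorem HasItoIntegral.integral_mul_increment (hW : IsBrownian F P T W) (hT : 0 ≤ T)
    {φ : ℝ → ℝ} (hφ : Continuous φ) {Z : Ω → ℝ}
    (hZ : HasItoIntegral F P W 0 T (fun s _ => φ s) Z) {c d : ℝ} (hc : 0 ≤ c) (hcd : c ≤ d)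
    (hd : d ≤ T) : ∫ ω, Z ω * (W d ω - W c ω) ∂P = ∫ x in c..d, φ x := by
  have h1 := ((hZ.meshTendsto_deterministic hW hT hφ).tendsto hT).tendsto_integral_mul
    (TendstoMeanSquare.const (hW.memLp_increment hc hcd hd ENNReal.ofNat_ne_top))
  set ψ : ℝ → ℝ := (Ioc c d).indicator 1
  have hψ : ∀ a b, IntervalIntegrable ψ volume a b := fun a b =>
    have h : IntervalIntegrable (fun _ : ℝ => (1 : ℝ)) volume a b := intervalIntegrable_const
    ⟨h.1.indicator measurableSet_Ioc, h.2.indicator measurableSet_Ioc⟩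
  have hψ2 : ∀ s t, s ≤ t → ∫ x in s..t, ψ x = volume.real (Ioc s t ∩ Ioc c d) := by
    intro s t hst
    rw [intervalIntegral.integral_of_le hst, integral_indicator_one measurableSet_Ioc,
      measureReal_restrict_apply measurableSet_Ioc, inter_comm]
  have h2 := (hasRSIntegral_of_primitive hT (g := φ) (h := fun t => ∫ x in (0 : ℝ)..t, ψ x) (ψ := ψ)
    hφ.continuousOn (hψ _ _) fun s _ t _ _ =>
      intervalIntegral.integral_interval_sub_left (hψ _ _) (hψ _ _)).tendsto_equi hT
  have e : ∫ x in (0 : ℝ)..T, φ x * ψ x = ∫ x in c..d, φ x := by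
    have : ∀ x, φ x * ψ x = (Ioc c d).indicator φ x := fun x => by
      by_cases hx : x ∈ Ioc c d <;> simp [ψ, hx]
    simp_rw [this]
    rw [intervalIntegral.integral_of_le hT, intervalIntegral.integral_of_le hcd,
      setIntegral_indicator measurableSet_Ioc, inter_eq_right.2 (Ioc_subset_Ioc hc hd)]
  rw [e] at h2
  refine tendsto_nhds_unique (h1.congr fun N => ?_) h2
  set π := Partition.equi hT N
  have hm : ∀ k ∈ Finset.range π.n, MemLp (fun ω => W (π.t (k + 1)) ω - W (π.t k) ω) 2 P :=
    fun k hk => hW.memLp_increment (π.mem_Icc (Finset.mem_range.1 hk).le).1 (π.step_le k)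
      (π.mem_Icc (Finset.mem_range.1 hk)).2 ENNReal.ofNat_ne_top
  simp only [leftSum, Finset.sum_mul]
  have hint : ∀ k ∈ Finset.range π.n, Integrable
      (fun ω => φ (π.t k) * (W (π.t (k + 1)) ω - W (π.t k) ω) * (W d ω - W c ω)) P :=
    fun k hk => ((hm k hk).const_mul _).integrable_mul
      (hW.memLp_increment hc hcd hd (p := 2) ENNReal.ofNat_ne_top)
  rw [integral_finsetSum _ hint]
  refine Finset.sum_congr rfl fun k hk => ?_
  have hk := Finset.mem_range.1 hk
  rw [intervalIntegral.integral_interval_sub_left (hψ _ _) (hψ _ _), hψ2 _ _ (π.step_le k)]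
  have := hW.integral_mul (π.mem_Icc hk.le).1 (π.step_le k) (π.mem_Icc hk).2 hc hcd hd
    (stronglyMeasurable_const (b := φ (π.t k))) (memLp_const _)
    (stronglyMeasurable_const (b := (1 : ℝ))) (memLp_const _)
  simpa using this

/-- Only `Z` is approximated. Against `Z'` each increment has a known covariance, so the moments are
Riemann–Stieltjes sums of `φ` against a primitive of `ψ`. -/
theorem HasItoIntegral.integral_mul (hW : IsBrownian F P T W) (hT : 0 ≤ T)
    {φ ψ : ℝ → ℝ} (hφ : Continuous φ) (hψ : Continuous ψ) {Z Z' : Ω → ℝ}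
    (hZ : HasItoIntegral F P W 0 T (fun s _ => φ s) Z)
    (hZ' : HasItoIntegral F P W 0 T (fun s _ => ψ s) Z') :
    ∫ ω, Z ω * Z' ω ∂P = ∫ x in (0 : ℝ)..T, φ x * ψ x := by
  have hZ2 := (hZ'.meshTendsto_deterministic hW hT hψ).1
  have h1 := ((hZ.meshTendsto_deterministic hW hT hφ).tendsto hT).tendsto_integral_mul
    (TendstoMeanSquare.const hZ2)
  have hi := fun a b => hψ.intervalIntegrable (μ := volume) a b
  have h2 := (hasRSIntegral_of_primitive hT (g := φ) (h := fun t => ∫ x in (0 : ℝ)..t, ψ x) (ψ := ψ)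
    hφ.continuousOn (hi _ _) fun s _ t _ _ =>
      intervalIntegral.integral_interval_sub_left (hi _ _) (hi _ _)).tendsto_equi hT
  refine tendsto_nhds_unique (h1.congr fun N => ?_) h2
  set π := Partition.equi hT N
  have hm : ∀ k ∈ Finset.range π.n, MemLp (fun ω => W (π.t (k + 1)) ω - W (π.t k) ω) 2 P :=
    fun k hk => hW.memLp_increment (π.mem_Icc (Finset.mem_range.1 hk).le).1 (π.step_le k)
      (π.mem_Icc (Finset.mem_range.1 hk)).2 ENNReal.ofNat_ne_top
  simp only [leftSum, Finset.sum_mul]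
  have hint : ∀ k ∈ Finset.range π.n,
      Integrable (fun ω => φ (π.t k) * (W (π.t (k + 1)) ω - W (π.t k) ω) * Z' ω) P :=
    fun k hk => ((hm k hk).const_mul _).integrable_mul hZ2
  rw [integral_finsetSum _ hint]
  refine Finset.sum_congr rfl fun k hk => ?_
  have hk := Finset.mem_range.1 hk
  rw [intervalIntegral.integral_interval_sub_left (hi _ _) (hi _ _),
    ← hZ'.integral_mul_increment hW hT hψ (π.mem_Icc hk.le).1 (π.step_le k) (π.mem_Icc hk).2,
    ← integral_const_mul]
  congr 1; ext ω; ring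

theorem HasItoIntegral.aestronglyMeasurable_pathSigma (hW : IsBrownian F P T W) (hT : 0 ≤ T)
    {φ : ℝ → ℝ} (hφ : Continuous φ) {Z : Ω → ℝ}
    (hZ : HasItoIntegral F P W 0 T (fun s _ => φ s) Z) :
    AEStronglyMeasurable[pathSigma W T] Z P := by
  refine ((hZ.meshTendsto_deterministic hW hT hφ).tendsto hT).aestronglyMeasurable
    hW.pathSigma_le fun N => StronglyMeasurable.aestronglyMeasurable ?_
  set π := Partition.equi hT N
  refine Finset.stronglyMeasurable_fun_sum _ fun k hk => ?_
  have hk := Finset.mem_range.1 hk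
  exact stronglyMeasurable_const.mul ((stronglyMeasurable_pathSigma (π.mem_Icc hk)).sub
    (stronglyMeasurable_pathSigma (π.mem_Icc hk.le)))

/-- By independence the covariance of two products of increments factors: it is `(t - s) ^ 2` on one
interval and `0` for non-overlapping intervals. -/
theorem meshTendsto_crossSum_of_indep (hW : IsBrownian F P T W) (hB : IsBrownian F P T B)
    (hWB : Indep (pathSigma W T) (pathSigma B T) P) :
    MeshTendsto P (crossSum W B (a := 0) (b := T)) 0 := by
  have mW : ∀ s t, 0 ≤ s → s ≤ t → t ≤ T →
      AEStronglyMeasurable[pathSigma W T] (fun ω => W t ω - W s ω) P := fun s t hs hst ht =>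
    ((stronglyMeasurable_pathSigma ⟨hs.trans hst, ht⟩).sub
      (stronglyMeasurable_pathSigma ⟨hs, hst.trans ht⟩)).aestronglyMeasurable
  have mB : ∀ s t, 0 ≤ s → s ≤ t → t ≤ T →
      AEStronglyMeasurable[pathSigma B T] (fun ω => B t ω - B s ω) P := fun s t hs hst ht =>
    ((stronglyMeasurable_pathSigma ⟨hs.trans hst, ht⟩).sub
      (stronglyMeasurable_pathSigma ⟨hs, hst.trans ht⟩)).aestronglyMeasurable
  have key : ∀ s t s' t', 0 ≤ s → s ≤ t → t ≤ T → 0 ≤ s' → s' ≤ t' → t' ≤ T →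
      ∫ ω, ((W t ω - W s ω) * (B t ω - B s ω)) * ((W t' ω - W s' ω) * (B t' ω - B s' ω)) ∂P
        = (∫ ω, (W t ω - W s ω) * (W t' ω - W s' ω) ∂P) *
          ∫ ω, (B t ω - B s ω) * (B t' ω - B s' ω) ∂P := by
    intro s t s' t' hs hst ht hs' hst' ht'
    have e := integral_mul_of_indep hW.pathSigma_le hB.pathSigma_le hWB
      ((mW s t hs hst ht).mul (mW s' t' hs' hst' ht'))
      ((mB s t hs hst ht).mul (mB s' t' hs' hst' ht'))
    simp only [Pi.mul_apply] at e
    rw [← e]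
    congr 1; ext ω; ring
  refine meshTendsto_zero_of_orthogonal (u := fun s t ω => (W t ω - W s ω) * (B t ω - B s ω))
    zero_le_one (fun s t hs hst ht => memLp_mul_of_indep hWB (mW s t hs hst ht) (mB s t hs hst ht)
      (hW.memLp_increment hs hst ht ENNReal.ofNat_ne_top)
      (hB.memLp_increment hs hst ht ENNReal.ofNat_ne_top)) (fun s t hs hst ht => ?_)
    (fun s t s' t' hs hst hts hst' ht' => ?_)
  · rw [key s t s t hs hst ht hs hst ht]
    simp_rw [← sq]
    rw [hW.integral_increment_sq hs hst ht, hB.integral_increment_sq hs hst ht]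
    linarith
  · have hs' := hs.trans (hst.trans hts)
    have htT := hts.trans (hst'.trans ht')
    rw [key s t s' t' hs hst htT hs' hst' ht']
    have := hW.integral_mul hs hst htT hs' hst' ht' (stronglyMeasurable_const (b := (1 : ℝ)))
      (memLp_const _) (stronglyMeasurable_const (b := (1 : ℝ))) (memLp_const _)
    rw [Ioc_inter_Ioc, max_eq_right (hst.trans hts), Ioc_eq_empty
      (not_lt.2 ((min_le_left _ _).trans hts))] at this
    simp only [one_mul, measureReal_empty, mul_zero] at this
    rw [this, zero_mul]

/-- By the isometry the left-point sums have second moment `∑ t k * (t (k + 1) - t k)`, which tends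
to the integral of `x` over `[0, T]`. No independence of `W` and `B` enters. -/
theorem HasIteratedItoIntegral.integral_mul_self (hW : IsBrownian F P T W)
    (hB : IsBrownian F P T B) (hT : 0 ≤ T) {J : Ω → ℝ} (h : HasIteratedItoIntegral F P W B T J) :
    ∫ ω, J ω * J ω ∂P = T ^ 2 / 2 := by
  have h0 := (h.meshTendsto hW hB hT).tendsto hT
  have h1 := h0.tendsto_integral_mul h0
  have h2 := (hasRSIntegral_of_primitive hT (g := fun t => t) (h := fun t => t) (ψ := fun _ => 1)
    continuousOn_id intervalIntegrable_const fun s _ t _ _ => by simp).tendsto_equi hT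
  have hI : ∫ x in (0 : ℝ)..T, x * 1 = T ^ 2 / 2 := by simp
  rw [hI] at h2
  refine tendsto_nhds_unique (h1.congr fun N => ?_) h2
  set π := Partition.equi hT N
  have e := hB.integral_sum_sq (Finset.range π.n) π.t (fun k => π.t (k + 1))
    (fun k => shift W (π.t k)) (fun k hk => (π.mem_Icc (Finset.mem_range.1 hk).le).1)
    (fun k _ => π.step_le k) (fun k hk => (π.mem_Icc (Finset.mem_range.1 hk)).2)
    (fun k hk => hW.stronglyMeasurable_shift (π.mem_Icc (Finset.mem_range.1 hk).le))
    (fun k hk => hW.memLp_shift (π.mem_Icc (Finset.mem_range.1 hk).le))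
  simp_rw [sq] at e
  refine e.trans (Finset.sum_congr rfl fun k hk => ?_)
  rw [Finset.sum_eq_single_of_mem k hk]
  · have hk := Finset.mem_range.1 hk
    rw [inter_self, Real.volume_real_Ioc_of_le (π.step_le k)]
    have := hW.integral_increment_sq le_rfl (π.mem_Icc hk.le).1 (π.mem_Icc hk.le).2
    simp_rw [sq] at this
    simp only [shift]
    rw [this, sub_zero]
  · intro j _ hjk
    have : Ioc (π.t k) (π.t (k + 1)) ∩ Ioc (π.t j) (π.t (j + 1)) = ∅ := by
      rw [← disjoint_iff_inter_eq_empty]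
      rcases lt_or_gt_of_ne hjk with h | h
      · exact (Ioc_disjoint_Ioc_of_le (π.mono (Nat.succ_le_of_lt h))).symm
      · exact Ioc_disjoint_Ioc_of_le (π.mono (Nat.succ_le_of_lt h))
    rw [this, measureReal_empty, mul_zero]

/-- Independence factors each term of the left-point sum into a covariance with `W (t k) - W 0` and
one with an increment of `B`. These are a value of the primitive of `φ j₁` and an increment of the
primitive of `φ j₂`, so the sum is a Riemann–Stieltjes sum for the coefficient. -/
theorem HasIteratedItoIntegral.integral_mul_mul (hW : IsBrownian F P T W)
    (hB : IsBrownian F P T B) (hT : 0 ≤ T) (hWB : Indep (pathSigma W T) (pathSigma B T) P)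
    {J : Ω → ℝ} (h : HasIteratedItoIntegral F P W B T J) {φ : ℕ → ℝ → ℝ}
    (hφ : ∀ j, Continuous (φ j)) {j₁ j₂ : ℕ} {Z Z' : Ω → ℝ}
    (hZ : HasItoIntegral F P W 0 T (fun s _ => φ j₁ s) Z)
    (hZ' : HasItoIntegral F P B 0 T (fun s _ => φ j₂ s) Z') :
    ∫ ω, J ω * (Z ω * Z' ω) ∂P = doubleCoeff φ T j₂ j₁ := by
  have mZ := hZ.aestronglyMeasurable_pathSigma hW hT (hφ j₁)
  have mZ' := hZ'.aestronglyMeasurable_pathSigma hB hT (hφ j₂)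
  have hm := memLp_mul_of_indep hWB mZ mZ' (hZ.meshTendsto_deterministic hW hT (hφ j₁)).1
    (hZ'.meshTendsto_deterministic hB hT (hφ j₂)).1
  have h1 := ((h.meshTendsto hW hB hT).tendsto hT).tendsto_integral_mul (TendstoMeanSquare.const hm)
  have hi := fun j a b => (hφ j).intervalIntegrable (μ := volume) a b
  have h2 := (hasRSIntegral_of_primitive hT (g := fun t => ∫ x in (0 : ℝ)..t, φ j₁ x)
    (h := fun t => ∫ x in (0 : ℝ)..t, φ j₂ x) (ψ := φ j₂)
    (intervalIntegral.continuous_primitive (hi j₁) _).continuousOn (hi j₂ _ _) fun s _ t _ _ =>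
      intervalIntegral.integral_interval_sub_left (hi j₂ _ _) (hi j₂ _ _)).tendsto_equi hT
  simp_rw [mul_comm _ (φ j₂ _)] at h2
  refine tendsto_nhds_unique (h1.congr fun N => ?_) h2
  set π := Partition.equi hT N
  simp only [leftSum, Finset.sum_mul]
  rw [integral_finsetSum _ fun k hk => ?_]
  · refine Finset.sum_congr rfl fun k hk => ?_
    have hk := Finset.mem_range.1 hk
    have e := integral_mul_of_indep hW.pathSigma_le hB.pathSigma_le hWB
      (mZ.mul ((stronglyMeasurable_pathSigma (π.mem_Icc hk.le)).sub
        (stronglyMeasurable_pathSigma (⟨le_rfl, hT⟩ : (0 : ℝ) ∈ Icc 0 T))).aestronglyMeasurable)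
      (mZ'.mul ((stronglyMeasurable_pathSigma (π.mem_Icc hk)).sub
        (stronglyMeasurable_pathSigma (π.mem_Icc hk.le))).aestronglyMeasurable)
    simp only [Pi.mul_apply, Pi.sub_apply] at e
    rw [hZ.integral_mul_increment hW hT (hφ j₁) le_rfl (π.mem_Icc hk.le).1 (π.mem_Icc hk.le).2,
      hZ'.integral_mul_increment hB hT (hφ j₂) (π.mem_Icc hk.le).1 (π.step_le k)
        (π.mem_Icc hk).2] at e
    rw [intervalIntegral.integral_interval_sub_left (hi j₂ _ _) (hi j₂ _ _), ← e]
    congr 1; ext ω; simp only [shift]; ring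
  · have hk := Finset.mem_range.1 hk
    exact (hB.memLp_mul_increment (π.mem_Icc hk.le).1 (π.step_le k) (π.mem_Icc hk).2
      (hW.stronglyMeasurable_shift (π.mem_Icc hk.le))
      (hW.memLp_shift (π.mem_Icc hk.le))).integrable_mul hm

/-- Convergence of the double series for two independent components. -/
theorem IsAdmissibleSystem.tendstoMeanSquare_of_indep {φ : ℕ → ℝ → ℝ} (h : IsAdmissibleSystem φ T)
    (hW : IsBrownian F P T W) (hB : IsBrownian F P T B) (hT : 0 ≤ T)
    (hWB : Indep (pathSigma W T) (pathSigma B T) P) {J : Ω → ℝ}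
    (hJ : HasIteratedItoIntegral F P W B T J) {Z Z' : ℕ → Ω → ℝ}
    (hZ : ∀ j, HasItoIntegral F P W 0 T (fun s _ => φ j s) (Z j))
    (hZ' : ∀ j, HasItoIntegral F P B 0 T (fun s _ => φ j s) (Z' j)) :
    TendstoMeanSquare P (fun p ω => ∑ j₁ ∈ Finset.range (p + 1), ∑ j₂ ∈ Finset.range (p + 1),
      doubleCoeff φ T j₂ j₁ * (Z j₁ ω * Z' j₂ ω)) J := by
  have hJ2 := (hJ.meshTendsto hW hB hT).1
  have mZ := fun j => (hZ j).aestronglyMeasurable_pathSigma hW hT (h.continuous j)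
  have mZ' := fun j => (hZ' j).aestronglyMeasurable_pathSigma hB hT (h.continuous j)
  set η : ℕ × ℕ → Ω → ℝ := fun j ω => Z j.1 ω * Z' j.2 ω
  have hη : ∀ j, MemLp (η j) 2 P := fun j => memLp_mul_of_indep hWB (mZ _) (mZ' _)
    ((hZ _).meshTendsto_deterministic hW hT (h.continuous _)).1
    ((hZ' _).meshTendsto_deterministic hB hT (h.continuous _)).1
  have horth : ∀ i j : ℕ × ℕ, ∫ ω, η i ω * η j ω ∂P = if i = j then 1 else 0 := by
    intro i j
    have e := integral_mul_of_indep hW.pathSigma_le hB.pathSigma_le hWB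
      ((mZ i.1).mul (mZ j.1)) ((mZ' i.2).mul (mZ' j.2))
    simp only [Pi.mul_apply] at e
    rw [(hZ _).integral_mul hW hT (h.continuous _) (h.continuous _) (hZ _),
      (hZ' _).integral_mul hB hT (h.continuous _) (h.continuous _) (hZ' _),
      h.orthonormal, h.orthonormal] at e
    have : (if i = j then (1 : ℝ) else 0)
        = (if i.1 = j.1 then 1 else 0) * (if i.2 = j.2 then 1 else 0) := by
      simp only [Prod.ext_iff]; split_ifs <;> simp_all
    rw [this, ← e]
    congr 1; ext ω; simp only [η]; ring
  set A : ℕ → ℝ := coeffSqSum φ T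
  set D : ℕ → Ω → ℝ := fun p ω => ∑ j₁ ∈ Finset.range (p + 1), ∑ j₂ ∈ Finset.range (p + 1),
      doubleCoeff φ T j₂ j₁ * (Z j₁ ω * Z' j₂ ω)
  have hDmem : ∀ p, MemLp (D p) 2 P := fun p =>
    memLp_finsetSum _ fun i _ => memLp_finsetSum _ fun j _ => (hη (i, j)).const_mul _
  -- The double sum is the orthogonal projection of `J` on the span of the products, so Pythagoras
  -- gives the error exactly.
  have key : ∀ p, ∫ ω, (D p - J) ω ^ 2 ∂P = T ^ 2 / 2 - A (p + 1) := by
    intro p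
    have := integral_sub_sum_sq (Finset.range (p + 1) ×ˢ Finset.range (p + 1)) hJ2
      (η := η) (fun i _ => hη i) (fun i => doubleCoeff φ T i.2 i.1)
      (fun i _ => hJ.integral_mul_mul hW hB hT hWB h.continuous (hZ _) (hZ' _))
      (fun i _ j _ => horth i j)
    simp_rw [Finset.sum_product] at this
    rw [hJ.integral_mul_self hW hB hT] at this
    refine Eq.trans ?_ this
    congr 1; ext ω
    simp only [D, η, Pi.sub_apply]
    ring
  -- The error decreases in `p`, so one index from `parseval` controls all later ones.
  have hAmono : Monotone A := fun p q hpq =>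
    (Finset.sum_le_sum_of_subset_of_nonneg (Finset.range_mono hpq) fun i _ _ =>
      Finset.sum_nonneg fun j _ => sq_nonneg _).trans' <| Finset.sum_le_sum fun i _ =>
        Finset.sum_le_sum_of_subset_of_nonneg (Finset.range_mono hpq) fun j _ _ => sq_nonneg _
  refine ⟨hDmem, hJ2, tendsto_eLpNorm_zero_of_integral_sq (fun p => (hDmem p).sub hJ2) ?_⟩
  rw [Metric.tendsto_atTop]
  intro ε hε
  obtain ⟨N, hN⟩ := h.parseval (ε / 2) (by positivity)
  refine ⟨N, fun p hp => ?_⟩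
  have h0 : 0 ≤ ∫ ω, (D p - J) ω ^ 2 ∂P := integral_nonneg fun _ => sq_nonneg _
  rw [Real.dist_eq, sub_zero, abs_of_nonneg h0, key]
  have := hAmono (hp.trans (Nat.le_succ p))
  linarith

end WienerIntegral

/-! ### The trigonometric system -/

section Trigonometric

variable {T : ℝ}

theorem integral_cos_int (hT : 0 < T) (k : ℤ) :
    ∫ x in (0 : ℝ)..T, Real.cos (2 * Real.pi * k * x / T) = if k = 0 then T else 0 := by
  split_ifs with hk
  · simp [hk]
  · have h : 2 * Real.pi * k / T ≠ 0 := by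
      have : (k : ℝ) ≠ 0 := by exact_mod_cast hk
      positivity
    simp_rw [fun x => (by ring : 2 * Real.pi * k * x / T = 2 * Real.pi * k / T * x)]
    rw [intervalIntegral.integral_comp_mul_left _ h, integral_cos, div_mul_cancel₀ _ hT.ne',
      show 2 * Real.pi * k = (2 * k : ℤ) * Real.pi by push_cast; ring, Real.sin_int_mul_pi]
    simp

theorem integral_sin_int (hT : 0 < T) (k : ℤ) :
    ∫ x in (0 : ℝ)..T, Real.sin (2 * Real.pi * k * x / T) = 0 := by
  rcases eq_or_ne k 0 with rfl | hk
  · simp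
  · have h : 2 * Real.pi * k / T ≠ 0 := by
      have : (k : ℝ) ≠ 0 := by exact_mod_cast hk
      positivity
    simp_rw [fun x => (by ring : 2 * Real.pi * k * x / T = 2 * Real.pi * k / T * x)]
    rw [intervalIntegral.integral_comp_mul_left _ h, integral_sin, div_mul_cancel₀ _ hT.ne',
      show 2 * Real.pi * k = k * (2 * Real.pi) by ring, Real.cos_int_mul_two_pi]
    simp

/-- Product to sum. Frequencies are written `r + 1`, so their sum is never zero and only the
difference can contribute. -/
theorem integral_cos_mul_cos (hT : 0 < T) (r q : ℕ) :
    ∫ x in (0 : ℝ)..T, Real.cos (2 * Real.pi * (r + 1 : ℕ) * x / T) *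
      Real.cos (2 * Real.pi * (q + 1 : ℕ) * x / T) = if r = q then T / 2 else 0 := by
  have e : ∀ x, Real.cos (2 * Real.pi * (r + 1 : ℕ) * x / T) *
      Real.cos (2 * Real.pi * (q + 1 : ℕ) * x / T)
      = 1 / 2 * Real.cos (2 * Real.pi * ((r - q : ℤ) : ℝ) * x / T)
        + 1 / 2 * Real.cos (2 * Real.pi * ((r + q + 2 : ℤ) : ℝ) * x / T) := fun x => by
    have h1 : 2 * Real.pi * ((r - q : ℤ) : ℝ) * x / T = 2 * Real.pi * (r + 1 : ℕ) * x / T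
      - 2 * Real.pi * (q + 1 : ℕ) * x / T := by push_cast; ring
    have h2 : 2 * Real.pi * ((r + q + 2 : ℤ) : ℝ) * x / T = 2 * Real.pi * (r + 1 : ℕ) * x / T
      + 2 * Real.pi * (q + 1 : ℕ) * x / T := by push_cast; ring
    rw [h1, h2, Real.cos_sub, Real.cos_add]
    ring
  simp_rw [e]
  rw [intervalIntegral.integral_add (Continuous.intervalIntegrable (by fun_prop) _ _)
    (Continuous.intervalIntegrable (by fun_prop) _ _), intervalIntegral.integral_const_mul,
    intervalIntegral.integral_const_mul, integral_cos_int hT, integral_cos_int hT,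
    if_neg (by lia : ¬ (r + q + 2 : ℤ) = 0)]
  rcases eq_or_ne r q with h | h
  · rw [if_pos (by lia), if_pos h]; ring
  · rw [if_neg (by lia), if_neg h]; ring

theorem integral_sin_mul_sin (hT : 0 < T) (r q : ℕ) :
    ∫ x in (0 : ℝ)..T, Real.sin (2 * Real.pi * (r + 1 : ℕ) * x / T) *
      Real.sin (2 * Real.pi * (q + 1 : ℕ) * x / T) = if r = q then T / 2 else 0 := by
  have e : ∀ x, Real.sin (2 * Real.pi * (r + 1 : ℕ) * x / T) *
      Real.sin (2 * Real.pi * (q + 1 : ℕ) * x / T)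
      = 1 / 2 * Real.cos (2 * Real.pi * ((r - q : ℤ) : ℝ) * x / T)
        - 1 / 2 * Real.cos (2 * Real.pi * ((r + q + 2 : ℤ) : ℝ) * x / T) := fun x => by
    have h1 : 2 * Real.pi * ((r - q : ℤ) : ℝ) * x / T = 2 * Real.pi * (r + 1 : ℕ) * x / T
      - 2 * Real.pi * (q + 1 : ℕ) * x / T := by push_cast; ring
    have h2 : 2 * Real.pi * ((r + q + 2 : ℤ) : ℝ) * x / T = 2 * Real.pi * (r + 1 : ℕ) * x / T
      + 2 * Real.pi * (q + 1 : ℕ) * x / T := by push_cast; ring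
    rw [h1, h2, Real.cos_sub, Real.cos_add]
    ring
  simp_rw [e]
  rw [intervalIntegral.integral_sub (Continuous.intervalIntegrable (by fun_prop) _ _)
    (Continuous.intervalIntegrable (by fun_prop) _ _), intervalIntegral.integral_const_mul,
    intervalIntegral.integral_const_mul, integral_cos_int hT, integral_cos_int hT,
    if_neg (by lia : ¬ (r + q + 2 : ℤ) = 0)]
  rcases eq_or_ne r q with h | h
  · rw [if_pos (by lia), if_pos h]; ring
  · rw [if_neg (by lia), if_neg h]; ring

theorem integral_sin_mul_cos (hT : 0 < T) (r q : ℕ) :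
    ∫ x in (0 : ℝ)..T, Real.sin (2 * Real.pi * (r + 1 : ℕ) * x / T) *
      Real.cos (2 * Real.pi * (q + 1 : ℕ) * x / T) = 0 := by
  have e : ∀ x, Real.sin (2 * Real.pi * (r + 1 : ℕ) * x / T) *
      Real.cos (2 * Real.pi * (q + 1 : ℕ) * x / T)
      = 1 / 2 * Real.sin (2 * Real.pi * ((r - q : ℤ) : ℝ) * x / T)
        + 1 / 2 * Real.sin (2 * Real.pi * ((r + q + 2 : ℤ) : ℝ) * x / T) := fun x => by
    have h1 : 2 * Real.pi * ((r - q : ℤ) : ℝ) * x / T = 2 * Real.pi * (r + 1 : ℕ) * x / T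
      - 2 * Real.pi * (q + 1 : ℕ) * x / T := by push_cast; ring
    have h2 : 2 * Real.pi * ((r + q + 2 : ℤ) : ℝ) * x / T = 2 * Real.pi * (r + 1 : ℕ) * x / T
      + 2 * Real.pi * (q + 1 : ℕ) * x / T := by push_cast; ring
    rw [h1, h2, Real.sin_sub, Real.sin_add]
    ring
  simp_rw [e]
  rw [intervalIntegral.integral_add (Continuous.intervalIntegrable (by fun_prop) _ _)
    (Continuous.intervalIntegrable (by fun_prop) _ _), intervalIntegral.integral_const_mul,
    intervalIntegral.integral_const_mul, integral_sin_int hT, integral_sin_int hT]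
  ring

theorem trigonometricSystem_zero (x : ℝ) : trigonometricSystem T 0 x = 1 / √T := by
  simp [trigonometricSystem]

theorem trigonometricSystem_odd (r : ℕ) (x : ℝ) : trigonometricSystem T (2 * r + 1) x
    = 1 / √T * √2 * Real.sin (2 * Real.pi * (r + 1 : ℕ) * x / T) := by
  have h : Odd (2 * r + 1) := ⟨r, rfl⟩
  rw [trigonometricSystem, if_neg (by lia), if_pos h, show (2 * r + 1 + 1) / 2 = r + 1 by lia]
  ring

theorem trigonometricSystem_even (r : ℕ) (x : ℝ) : trigonometricSystem T (2 * r + 2) x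
    = 1 / √T * √2 * Real.cos (2 * Real.pi * (r + 1 : ℕ) * x / T) := by
  have h : ¬ Odd (2 * r + 2) := by rw [Nat.not_odd_iff_even]; exact ⟨r + 1, by ring⟩
  rw [trigonometricSystem, if_neg (by lia), if_neg h, show (2 * r + 2 + 1) / 2 = r + 1 by lia]
  ring

theorem zero_or_odd_or_even (j : ℕ) : j = 0 ∨ (∃ r, j = 2 * r + 1) ∨ ∃ r, j = 2 * r + 2 := by
  rcases Nat.even_or_odd' j with ⟨k, rfl | rfl⟩
  · rcases k with _ | k
    · exact Or.inl rfl
    · exact Or.inr (Or.inr ⟨k, by ring⟩)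
  · exact Or.inr (Or.inl ⟨k, rfl⟩)

theorem isOrthonormalSystem_trigonometricSystem (hT : 0 < T) :
    IsOrthonormalSystem (trigonometricSystem T) T where
  continuous j := by
    unfold trigonometricSystem
    split_ifs <;> fun_prop
  zero := trigonometricSystem_zero
  orthonormal := by
    have hT2 : (1 / √T) * (1 / √T) = 1 / T := by
      rw [div_mul_div_comm, Real.mul_self_sqrt hT.le, one_mul]
    have h2 : √2 * √2 = 2 := Real.mul_self_sqrt zero_le_two
    have key : ∀ (f g : ℝ → ℝ), ∫ x in (0 : ℝ)..T, (1 / √T * √2 * f x) * (1 / √T * √2 * g x)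
        = 2 / T * ∫ x in (0 : ℝ)..T, f x * g x := by
      intro f g
      rw [← intervalIntegral.integral_const_mul]
      congr 1; ext x
      linear_combination (√2 * √2 * f x * g x) * hT2 + (1 / T * f x * g x) * h2
    have key0 : ∀ f : ℝ → ℝ, ∫ x in (0 : ℝ)..T, f x = 0 →
        ∫ x in (0 : ℝ)..T, (1 / √T) * (1 / √T * √2 * f x) = 0 := by
      intro f hf
      simp_rw [← mul_assoc]
      rw [intervalIntegral.integral_const_mul, hf, mul_zero]
    have hs0 : ∀ r : ℕ, ∫ x in (0 : ℝ)..T, Real.sin (2 * Real.pi * (r + 1 : ℕ) * x / T) = 0 :=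
      fun r => by simpa using integral_sin_int hT (r + 1 : ℤ)
    have hc0 : ∀ r : ℕ, ∫ x in (0 : ℝ)..T, Real.cos (2 * Real.pi * (r + 1 : ℕ) * x / T) = 0 :=
      fun r => by simpa [show (r : ℤ) + 1 ≠ 0 by lia] using integral_cos_int hT (r + 1 : ℤ)
    have hd : 2 / T * (T / 2) = 1 := by field_simp
    intro i j
    rcases zero_or_odd_or_even i with rfl | ⟨r, rfl⟩ | ⟨r, rfl⟩ <;>
    rcases zero_or_odd_or_even j with rfl | ⟨q, rfl⟩ | ⟨q, rfl⟩ <;>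
    simp only [trigonometricSystem_zero, trigonometricSystem_odd, trigonometricSystem_even]
    · simp_rw [hT2]
      simp [hT.ne']
    · rw [key0 _ (hs0 q), if_neg (by lia)]
    · rw [key0 _ (hc0 q), if_neg (by lia)]
    · simp_rw [mul_comm _ (1 / √T)]
      rw [key0 _ (hs0 r), if_neg (by lia)]
    · rw [key, integral_sin_mul_sin hT]
      rcases eq_or_ne r q with h | h
      · rw [if_pos h, if_pos (by lia), hd]
      · rw [if_neg h, if_neg (by lia), mul_zero]
    · rw [key, integral_sin_mul_cos hT, if_neg (by lia), mul_zero]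
    · simp_rw [mul_comm _ (1 / √T)]
      rw [key0 _ (hc0 r), if_neg (by lia)]
    · rw [key]
      simp_rw [mul_comm (Real.cos _)]
      rw [integral_sin_mul_cos hT, if_neg (by lia), mul_zero]
    · rw [key, integral_cos_mul_cos hT]
      rcases eq_or_ne r q with h | h
      · rw [if_pos h, if_pos (by lia), hd]
      · rw [if_neg h, if_neg (by lia), mul_zero]

/-- The primitive of a sine combines the constant and the cosine of the same frequency, both members
of the system; orthonormality then gives the whole column of coefficients. -/
theorem integral_trigonometricSystem_odd (hT : 0 < T) (r : ℕ) (s : ℝ) :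
    ∫ x in (0 : ℝ)..s, trigonometricSystem T (2 * r + 1) x
      = T / (2 * Real.pi * (r + 1)) *
        (√2 * trigonometricSystem T 0 s - trigonometricSystem T (2 * r + 2) s) := by
  have h : 2 * Real.pi * (r + 1) / T ≠ 0 := by positivity
  simp_rw [trigonometricSystem_zero, trigonometricSystem_odd, trigonometricSystem_even]
  rw [intervalIntegral.integral_const_mul]
  push_cast
  simp_rw [fun x => (by ring : 2 * Real.pi * (r + 1) * x / T = 2 * Real.pi * (r + 1) / T * x)]
  rw [intervalIntegral.integral_comp_mul_left _ h, integral_sin]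
  simp only [mul_zero, Real.cos_zero, smul_eq_mul, inv_div]
  ring

theorem doubleCoeff_trigonometricSystem_odd (hT : 0 < T) (r i : ℕ) :
    doubleCoeff (trigonometricSystem T) T i (2 * r + 1)
      = T / (2 * Real.pi * (r + 1)) *
        (√2 * (if i = 0 then 1 else 0) - (if i = 2 * r + 2 then 1 else 0)) := by
  have h := isOrthonormalSystem_trigonometricSystem hT
  have hc := h.continuous
  have ho := h.orthonormal
  rw [doubleCoeff, ← ho i 0, ← ho i (2 * r + 2), ← intervalIntegral.integral_const_mul,
    ← intervalIntegral.integral_sub, ← intervalIntegral.integral_const_mul]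
  · congr 1; ext x
    rw [integral_trigonometricSystem_odd hT]; ring
  · exact Continuous.intervalIntegrable (by have := hc i; have := hc 0; fun_prop) _ _
  · exact Continuous.intervalIntegrable (by have := hc i; have := hc (2 * r + 2); fun_prop) _ _

theorem isAdmissibleSystem_trigonometricSystem (hT : 0 < T) :
    IsAdmissibleSystem (trigonometricSystem T) T where
  toIsOrthonormalSystem := isOrthonormalSystem_trigonometricSystem hT
  parseval := by
    have h := isOrthonormalSystem_trigonometricSystem hT
    set A := coeffSqSum (trigonometricSystem T) T
    have h2 : √2 ^ 2 = 2 := Real.sq_sqrt zero_le_two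
    -- With `c = T / (2 * π * (r + 1))`, the sine pairs with the constant as `√2 * c` and with its
    -- cosine as `c` up to sign. Each square counts twice, giving `2 * (2 + 1) * c ^ 2`.
    have step : ∀ r : ℕ, A (2 * r + 1) + 6 * (T / (2 * Real.pi * (r + 1))) ^ 2
        ≤ A (2 * (r + 1) + 1) := by
      intro r
      have s1 := h.coeffSqSum_succ_le hT (j := 0) (p := 2 * r + 1) (by lia)
      have s2 := h.coeffSqSum_succ_le hT (j := 2 * r + 1) (p := 2 * r + 2) (by lia)
      rw [doubleCoeff_trigonometricSystem_odd hT, if_pos rfl, if_neg (by lia), mul_pow] at s1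
      rw [← neg_sq, ← h.doubleCoeff_swap hT (by lia), doubleCoeff_trigonometricSystem_odd hT,
        if_neg (by lia), if_pos rfl, mul_pow] at s2
      simp only [mul_one, mul_zero, sub_zero, zero_sub, h2] at s1 s2
      rw [show 2 * (r + 1) + 1 = 2 * r + 2 + 1 by ring]
      linarith
    have bound : ∀ N : ℕ, T ^ 2 / 4 + 6 * (T / (2 * Real.pi)) ^ 2 *
        ∑ r ∈ Finset.range N, 1 / ((r + 1 : ℕ) : ℝ) ^ 2 ≤ A (2 * N + 1) := by
      intro N
      induction N with
      | zero => simpa using (h.coeffSqSum_one hT).ge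
      | succ N ih =>
        refine le_trans (le_of_eq ?_) ((add_le_add_left ih _).trans (step N))
        rw [Finset.sum_range_succ]
        push_cast
        have : (N : ℝ) + 1 ≠ 0 := by positivity
        field_simp
        ring
    -- `6 * T² / (4 * π²)` times `π² / 6` is the missing `T² / 4`.
    have hlim : Tendsto (fun N : ℕ => T ^ 2 / 4 + 6 * (T / (2 * Real.pi)) ^ 2 *
        ∑ r ∈ Finset.range N, 1 / ((r + 1 : ℕ) : ℝ) ^ 2) atTop (𝓝 (T ^ 2 / 2)) := by
      have h1 := ((tendsto_add_atTop_iff_nat 1).2 hasSum_zeta_two.tendsto_sum_nat)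
      simp_rw [Finset.sum_range_succ'] at h1
      have h3 := (h1.const_mul (6 * (T / (2 * Real.pi)) ^ 2)).const_add (T ^ 2 / 4)
      convert h3 using 2
      · simp
      · have := Real.pi_ne_zero
        field_simp
        ring
    intro ε hε
    obtain ⟨N, hN⟩ := (hlim.eventually (lt_mem_nhds (sub_lt_self _ hε))).exists
    exact ⟨2 * N + 1, hN.le.trans (bound N)⟩

end Trigonometric

/-! ### The Legendre system -/

section Legendre

open Polynomial

/-- The shifted Legendre polynomial with real coefficients. -/
noncomputable def realLegendre (n : ℕ) : ℝ[X] := (shiftedLegendre n).map (Int.castRingHom ℝ)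

/-- The inner product of two polynomials in `L²([0, 1])`. -/
noncomputable def polyInner (p q : ℝ[X]) : ℝ := ∫ x in (0 : ℝ)..1, p.eval x * q.eval x

theorem polyInner_add_right (p q r : ℝ[X]) :
    polyInner p (q + r) = polyInner p q + polyInner p r := by
  simp only [polyInner, eval_add, mul_add]
  exact intervalIntegral.integral_add ((p.continuous.mul q.continuous).intervalIntegrable _ _)
    ((p.continuous.mul r.continuous).intervalIntegrable _ _)

theorem polyInner_C_mul_right (p q : ℝ[X]) (c : ℝ) :
    polyInner p (C c * q) = c * polyInner p q := by
  simp only [polyInner, eval_mul, eval_C]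
  rw [← intervalIntegral.integral_const_mul]
  congr 1; ext x; ring

theorem integral_eval_derivative (p : ℝ[X]) (a b : ℝ) :
    ∫ x in a..b, (derivative p).eval x = p.eval b - p.eval a :=
  intervalIntegral.integral_eq_sub_of_hasDerivAt (fun x _ => p.hasDerivAt x)
    ((derivative p).continuous.intervalIntegrable _ _)

theorem polyInner_derivative (p q : ℝ[X]) :
    polyInner (derivative p) q + polyInner p (derivative q)
      = p.eval 1 * q.eval 1 - p.eval 0 * q.eval 0 := by
  have h := integral_eval_derivative (p * q) 0 1
  rw [eval_mul, eval_mul] at h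
  have h' := intervalIntegral.integral_add (μ := volume)
    (((derivative p).continuous.mul q.continuous).intervalIntegrable 0 1)
    ((p.continuous.mul (derivative q).continuous).intervalIntegrable 0 1)
  refine h'.symm.trans (Eq.trans ?_ h)
  congr 1; ext x
  simp [derivative_mul]

/-- Repeated integration by parts against `X ^ n * (1 - X) ^ n`. -/
theorem polyInner_iterate_derivative (n k : ℕ) (hk : k ≤ n) (q : ℝ[X]) :
    polyInner (derivative^[k] (X ^ n * (1 - X) ^ n)) q
      = (-1) ^ k * polyInner (X ^ n * (1 - X) ^ n) (derivative^[k] q) := by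
  induction k generalizing q with
  | zero => simp
  | succ k ih =>
    set w : ℝ[X] := X ^ n * (1 - X) ^ n
    -- Fewer than `n` derivatives leave a factor `X` and a factor `1 - X`, so the boundary terms
    -- vanish.
    have hX : (derivative^[k] w).eval 0 = 0 := by
      have h : (X : ℝ[X]) ∣ derivative^[k] w :=
        (dvd_pow_self X (by lia : n - k ≠ 0)).trans
          (pow_sub_dvd_iterate_derivative_of_pow_dvd k (Dvd.intro _ rfl))
      obtain ⟨r, hr⟩ := h
      rw [hr]; simp
    have hX1 : (derivative^[k] w).eval 1 = 0 := by
      have h : (1 - X : ℝ[X]) ∣ derivative^[k] w :=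
        (dvd_pow_self (1 - X) (by lia : n - k ≠ 0)).trans
          (pow_sub_dvd_iterate_derivative_of_pow_dvd k (Dvd.intro_left _ rfl))
      obtain ⟨r, hr⟩ := h
      rw [hr]; simp
    have h := polyInner_derivative (derivative^[k] w) q
    rw [hX, hX1, ih (by lia)] at h
    rw [Function.iterate_succ_apply' derivative k w, Function.iterate_succ_apply]
    rw [pow_succ]
    linarith

/-- Rodrigues' formula: all `n` derivatives are moved to `q`, which they annihilate. -/
theorem polyInner_realLegendre_of_degree_lt {n : ℕ} {q : ℝ[X]} (hq : q.degree < n) :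
    polyInner (realLegendre n) q = 0 := by
  have h := polyInner_iterate_derivative n n le_rfl q
  rw [iterate_derivative_eq_zero_of_degree_lt hq] at h
  have hr : derivative^[n] (X ^ n * (1 - X) ^ n : ℝ[X]) = C (n.factorial : ℝ) * realLegendre n := by
    have := congrArg (Polynomial.map (Int.castRingHom ℝ)) (factorial_mul_shiftedLegendre_eq n)
    rw [← iterate_derivative_map] at this
    simp only [Polynomial.map_mul, Polynomial.map_pow, Polynomial.map_sub, map_X,
      Polynomial.map_one, Polynomial.map_natCast] at this
    rw [← this]
    simp [realLegendre]
  rw [hr] at h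
  have h2 : polyInner (C (n.factorial : ℝ) * realLegendre n) q
      = n.factorial * polyInner (realLegendre n) q := by
    rw [← polyInner_C_mul_right]
    simp only [polyInner, eval_mul, eval_C]
    congr 1; ext x; ring
  rw [h2] at h
  have h3 : (n.factorial : ℝ) ≠ 0 := by exact_mod_cast n.factorial_ne_zero
  simpa [polyInner, h3] using h

theorem coeff_realLegendre (n : ℕ) :
    (realLegendre n).coeff n = (-1) ^ n * (n.centralBinom : ℝ) := by
  rw [realLegendre, coeff_map, coeff_shiftedLegendre]
  simp [Nat.centralBinom, two_mul]

theorem coeff_realLegendre_ne_zero (n : ℕ) : (realLegendre n).coeff n ≠ 0 := by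
  rw [coeff_realLegendre]
  have := n.centralBinom_ne_zero
  simp [this]

theorem degree_realLegendre_le (n : ℕ) : (realLegendre n).degree ≤ n :=
  degree_map_le.trans (degree_shiftedLegendre n).le

/-- Removing the multiple of the Legendre polynomial that matches the top coefficient leaves a
remainder of lower degree. Inner products are thus read off leading coefficients. -/
theorem polyInner_realLegendre {n : ℕ} {q : ℝ[X]} (hq : q.degree ≤ n) :
    polyInner (realLegendre n) q
      = q.coeff n / (realLegendre n).coeff n * polyInner (realLegendre n) (realLegendre n) := by
  set c := q.coeff n / (realLegendre n).coeff n
  have hl := coeff_realLegendre_ne_zero n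
  have h : (q - C c * realLegendre n).degree < n := by
    rw [degree_lt_iff_coeff_zero]
    intro k hk
    rcases hk.eq_or_lt with rfl | hk
    · simp [c, hl]
    · have hk' : (n : WithBot ℕ) < k := by exact_mod_cast hk
      rw [coeff_sub, coeff_C_mul, coeff_eq_zero_of_degree_lt (hq.trans_lt hk'),
        coeff_eq_zero_of_degree_lt ((degree_realLegendre_le n).trans_lt hk')]
      simp
  have h0 := polyInner_realLegendre_of_degree_lt h
  have e : q = (q - C c * realLegendre n) + C c * realLegendre n := by ring
  rw [e, polyInner_add_right, h0, polyInner_C_mul_right, zero_add]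

theorem eval_realLegendre_symm (n : ℕ) (x : ℝ) :
    (realLegendre n).eval x = (-1) ^ n * (realLegendre n).eval (1 - x) := by
  have h := shiftedLegendre_eval_symm n x
  simpa [realLegendre, eval_map_algebraMap, aeval_def, eval_map] using h

theorem eval_one_realLegendre_sq (n : ℕ) : (realLegendre n).eval 1 ^ 2 = 1 := by
  have h0 : (realLegendre n).eval 0 = 1 := by
    rw [← coeff_zero_eq_eval_zero, realLegendre, coeff_map, coeff_shiftedLegendre]
    simp
  rw [eval_realLegendre_symm, sub_self, h0, mul_one, ← pow_mul, mul_comm, pow_mul]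
  simp

/-- Integrate `(x * L²)' = L² + 2 * x * L * L'`. The boundary value is `1`, and `x * L'` has `n`
times the leading coefficient of `L`, so `(2 * n + 1) * N = 1`. -/
theorem polyInner_realLegendre_self (n : ℕ) :
    polyInner (realLegendre n) (realLegendre n) = 1 / (2 * n + 1) := by
  set L := realLegendre n
  set N := polyInner L L
  have h1 : polyInner L (X * derivative L) = n * N := by
    have hd : (X * derivative L).degree ≤ (n : WithBot ℕ) := by
      rw [degree_le_iff_coeff_zero]
      intro k hk
      rcases k with _ | k
      · simp
      · rw [coeff_X_mul, coeff_derivative, coeff_eq_zero_of_degree_lt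
          ((degree_realLegendre_le n).trans_lt hk), zero_mul]
    rw [polyInner_realLegendre hd]
    have hc : (X * derivative L).coeff n = n * L.coeff n := by
      rcases n with _ | n
      · simp
      · rw [coeff_X_mul, coeff_derivative]; push_cast; ring
    rw [hc, mul_div_assoc, div_self (coeff_realLegendre_ne_zero n), mul_one]
  have h2 := polyInner_derivative L (X * L)
  have h3 : polyInner (derivative L) (X * L) = polyInner L (X * derivative L) := by
    simp only [polyInner, eval_mul]
    congr 1; ext x; ring
  have h4 : derivative (X * L) = L + X * derivative L := by simp [derivative_mul]
  rw [h3, h4, polyInner_add_right, h1] at h2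
  simp only [eval_mul, eval_X, one_mul, zero_mul, mul_zero, sub_zero] at h2
  rw [← sq, eval_one_realLegendre_sq] at h2
  rw [eq_div_iff (by positivity)]
  change n * N + (N + n * N) = 1 at h2
  linarith

/-- A polynomial primitive of `realLegendre n`. -/
theorem exists_primitive_realLegendre (n : ℕ) : ∃ M : ℝ[X], derivative M = realLegendre n ∧
    M.degree ≤ (n + 1 : ℕ) ∧ M.coeff (n + 1) = (realLegendre n).coeff n / (n + 1) := by
  set L := realLegendre n
  set M : ℝ[X] := ∑ k ∈ Finset.range (n + 1), monomial (k + 1) (L.coeff k / (k + 1))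
  have hc : ∀ k, M.coeff (k + 1) = if k < n + 1 then L.coeff k / (k + 1) else 0 := by
    intro k
    simp only [M, finsetSum_coeff, coeff_monomial, add_left_inj]
    rw [Finset.sum_ite_eq']
    simp only [Finset.mem_range]
  refine ⟨M, ?_, ?_, by rw [hc, if_pos (Nat.lt_succ_self n)]⟩
  · ext k
    rw [coeff_derivative, hc]
    split_ifs with h
    · have : (k : ℝ) + 1 ≠ 0 := by positivity
      field_simp
    · rw [zero_mul]
      have hk' : (n : WithBot ℕ) < k := by exact_mod_cast (by lia : n < k)
      rw [coeff_eq_zero_of_degree_lt ((degree_realLegendre_le n).trans_lt hk')]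
  · rw [degree_le_iff_coeff_zero]
    intro k hk
    have hk : n + 1 < k := by exact_mod_cast hk
    obtain ⟨k, rfl⟩ : ∃ j, k = j + 1 := ⟨k - 1, by lia⟩
    rw [hc, if_neg (by lia)]

/-- The leading coefficients are signed central binomial coefficients, and their recursion gives the
ratio. -/
theorem polyInner_realLegendre_succ_primitive (n : ℕ) {M : ℝ[X]} (hM : M.degree ≤ (n + 1 : ℕ))
    (hMc : M.coeff (n + 1) = (realLegendre n).coeff n / (n + 1)) :
    polyInner (realLegendre (n + 1)) M = - 1 / (2 * (2 * n + 1) * (2 * n + 3)) := by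
  rw [polyInner_realLegendre hM, hMc, polyInner_realLegendre_self, coeff_realLegendre,
    coeff_realLegendre]
  have hc : ((n : ℝ) + 1) * (n + 1).centralBinom = 2 * (2 * n + 1) * n.centralBinom := by
    exact_mod_cast n.succ_mul_centralBinom_succ
  have h0 : (n.centralBinom : ℝ) ≠ 0 := by exact_mod_cast n.centralBinom_ne_zero
  have h1 : ((n + 1).centralBinom : ℝ) ≠ 0 := by exact_mod_cast (n + 1).centralBinom_ne_zero
  have h2 : (-1 : ℝ) ^ n ≠ 0 := by positivity
  have h3 : ((n + 1).centralBinom : ℝ) = 2 * (2 * n + 1) * n.centralBinom / (n + 1) := by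
    rw [eq_div_iff (by positivity)]; linarith
  rw [h3, pow_succ]
  push_cast
  field_simp
  ring

/-! ### The Legendre system on `[0, T]` -/

variable {T : ℝ}

/-- The sign comes from the reflection `x ↦ 1 - x`, since `shiftedLegendre j` is `P_j(1 - 2x)`. -/
theorem legendreSystem_eq (hT : 0 < T) (j : ℕ) (x : ℝ) : legendreSystem T j x
    = √((2 * j + 1) / T) * (-1) ^ j * (realLegendre j).eval (x / T) := by
  have h : (1 - (x - T / 2) * (2 / T)) / 2 = 1 - x / T := by field_simp; ring
  rw [legendreSystem, legendre, h, shiftedLegendre_eval_symm, sub_sub_cancel, mul_assoc]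
  congr 2
  simp [realLegendre, aeval_def, eval_map]

theorem integral_eval_div_mul_eval_div (hT : 0 < T) (p q : ℝ[X]) :
    ∫ x in (0 : ℝ)..T, p.eval (x / T) * q.eval (x / T) = T * polyInner p q := by
  rw [intervalIntegral.integral_comp_div (fun x => p.eval x * q.eval x) hT.ne', zero_div,
    div_self hT.ne']
  rfl

theorem isOrthonormalSystem_legendreSystem (hT : 0 < T) :
    IsOrthonormalSystem (legendreSystem T) T where
  continuous j := by
    have : legendreSystem T j = fun x => √((2 * j + 1) / T) * (-1) ^ j *
      (realLegendre j).eval (x / T) := funext fun x => legendreSystem_eq hT j x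
    rw [this]
    exact continuous_const.mul ((realLegendre j).continuous.comp (continuous_id.div_const T))
  zero x := by simp [legendreSystem, legendre, shiftedLegendre]
  orthonormal := by
    have key : ∀ i j, ∫ x in (0 : ℝ)..T, legendreSystem T i x * legendreSystem T j x
        = √((2 * i + 1) / T) * (-1) ^ i * (√((2 * j + 1) / T) * (-1) ^ j) *
          (T * polyInner (realLegendre i) (realLegendre j)) := by
      intro i j
      rw [← integral_eval_div_mul_eval_div hT, ← intervalIntegral.integral_const_mul]
      congr 1; ext x
      rw [legendreSystem_eq hT, legendreSystem_eq hT]; ring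
    have hlt : ∀ i j, i < j →
        ∫ x in (0 : ℝ)..T, legendreSystem T j x * legendreSystem T i x = 0 := by
      intro i j hij
      have : (realLegendre i).degree < j :=
        (degree_realLegendre_le i).trans_lt (by exact_mod_cast hij)
      rw [key, polyInner_realLegendre_of_degree_lt this]; ring
    intro i j
    rcases lt_trichotomy i j with h | rfl | h
    · simp_rw [mul_comm (legendreSystem T i _)]
      rw [hlt i j h, if_neg h.ne]
    · have hs : √((2 * i + 1) / T) * √((2 * i + 1) / T) = (2 * i + 1) / T :=
        Real.mul_self_sqrt (by positivity)
      have h1 : ((-1 : ℝ) ^ i) * (-1) ^ i = 1 := by rw [← mul_pow]; simp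
      rw [key, if_pos rfl, polyInner_realLegendre_self,
        show √((2 * i + 1) / T) * (-1) ^ i * (√((2 * i + 1) / T) * (-1) ^ i)
          = (√((2 * i + 1) / T) * √((2 * i + 1) / T)) * ((-1) ^ i * (-1) ^ i) by ring, hs, h1]
      field_simp
    · rw [hlt j i h, if_neg h.ne']

theorem doubleCoeff_legendreSystem_succ_sq (hT : 0 < T) (n : ℕ) :
    doubleCoeff (legendreSystem T) T (n + 1) n ^ 2
      = T ^ 2 / (4 * (2 * n + 1) * (2 * n + 3)) := by
  obtain ⟨M, hM, hd, hc⟩ := exists_primitive_realLegendre n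
  set a : ℕ → ℝ := fun j => √((2 * j + 1) / T) * (-1) ^ j
  have ha : ∀ j, a j ^ 2 = (2 * j + 1) / T := fun j => by
    simp only [a]
    rw [mul_pow, Real.sq_sqrt (by positivity), ← pow_mul, mul_comm j, pow_mul]; simp
  have hint : ∀ s, ∫ x in (0 : ℝ)..s, legendreSystem T n x
      = a n * T * (M.eval (s / T) - M.eval 0) := by
    intro s
    simp_rw [legendreSystem_eq hT]
    rw [intervalIntegral.integral_const_mul,
      intervalIntegral.integral_comp_div (fun x => (realLegendre n).eval x) hT.ne', zero_div, ← hM,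
      integral_eval_derivative, smul_eq_mul, ← mul_assoc]
  -- The constant makes the primitive vanish at `0` and leaves the coefficient of degree `n + 1`
  -- unchanged.
  have hd' : (M - C (M.eval 0)).degree ≤ (n + 1 : ℕ) :=
    (degree_sub_le _ _).trans (max_le hd (degree_C_le.trans (by exact_mod_cast Nat.zero_le _)))
  have hc' : (M - C (M.eval 0)).coeff (n + 1) = (realLegendre n).coeff n / (n + 1) := by
    rw [coeff_sub, hc, coeff_C_succ, sub_zero]
  have e : doubleCoeff (legendreSystem T) T (n + 1) n
      = a (n + 1) * (a n * T) * (T * (- 1 / (2 * (2 * n + 1) * (2 * n + 3)))) := by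
    rw [← polyInner_realLegendre_succ_primitive n hd' hc', ← integral_eval_div_mul_eval_div hT,
      ← intervalIntegral.integral_const_mul, doubleCoeff]
    congr 1; ext x
    rw [hint, legendreSystem_eq hT, eval_sub, eval_C]
    simp only [a]; ring
  rw [e, mul_pow, mul_pow (a (n + 1)), mul_pow (a n), ha, ha]
  push_cast
  field_simp
  ring

theorem isAdmissibleSystem_legendreSystem (hT : 0 < T) :
    IsAdmissibleSystem (legendreSystem T) T where
  toIsOrthonormalSystem := isOrthonormalSystem_legendreSystem hT
  parseval := by
    have h := isOrthonormalSystem_legendreSystem hT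
    set A := coeffSqSum (legendreSystem T) T
    -- The neighbouring pair adds `2 * T² / (4 * (2n + 1) * (2n + 3)) = T² / 4 * (1 / (2n + 1) - 1 /
    -- (2n + 3))`, which telescopes.
    have bound : ∀ n : ℕ, T ^ 2 / 2 - T ^ 2 / (4 * (2 * n + 1)) ≤ A (n + 1) := by
      intro n
      induction n with
      | zero =>
        have h1 : A 1 = T ^ 2 / 4 := h.coeffSqSum_one hT
        rw [zero_add, h1]
        push_cast
        linarith
      | succ n ih =>
        have s := h.coeffSqSum_succ_le hT (Nat.lt_succ_self n)
        rw [← neg_sq, ← h.doubleCoeff_swap hT (Nat.succ_ne_zero n),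
          doubleCoeff_legendreSystem_succ_sq hT] at s
        refine le_trans (le_of_eq ?_) ((add_le_add_left ih _).trans s)
        push_cast
        field_simp
        ring
    have hlim : Tendsto (fun n : ℕ => T ^ 2 / 2 - T ^ 2 / (4 * (2 * (n : ℝ) + 1))) atTop
        (𝓝 (T ^ 2 / 2 - 0)) := by
      refine tendsto_const_nhds.sub (tendsto_const_nhds.div_atTop ?_)
      exact (tendsto_atTop_add_const_right _ _ (tendsto_natCast_atTop_atTop.const_mul_atTop
        two_pos)).const_mul_atTop four_pos
    rw [sub_zero] at hlim
    intro ε hε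
    obtain ⟨n, hn⟩ := (hlim.eventually (lt_mem_nhds (sub_lt_self _ hε))).exists
    exact ⟨n + 1, hn.le.trans (bound n)⟩

end Legendre

/-! ### Assembly for equal and for distinct components -/

section Main

variable {Ω : Type*} {mΩ : MeasurableSpace Ω} {P : Measure Ω} {F : Filtration ℝ mΩ} {T : ℝ}
  {m : ℕ} {f : Fin m → ℝ → Ω → ℝ}

theorem IsWienerProcess.indep_pathSigma (hf : IsWienerProcess F P T f) {i j : Fin m} (hij : i ≠ j) :
    Indep (pathSigma (f i) T) (pathSigma (f j) T) P := by
  have := hf.indep_components.indepFun hij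
  rwa [IndepFun_iff_Indep] at this


variable [IsProbabilityMeasure P]

theorem isAdmissibleSystem_of_eq (hT : 0 < T) {φ : ℕ → ℝ → ℝ}
    (hφ : φ = legendreSystem T ∨ φ = trigonometricSystem T) : IsAdmissibleSystem φ T := by
  rcases hφ with rfl | rfl
  · exact isAdmissibleSystem_legendreSystem hT
  · exact isAdmissibleSystem_trigonometricSystem hT

/-- The limits of the double sum, for independent or equal components. -/
theorem IsAdmissibleSystem.tendstoMeanSquare {φ : ℕ → ℝ → ℝ} (h : IsAdmissibleSystem φ T)
    (hT : 0 < T) (hf : IsWienerProcess F P T f) {i₁ i₂ : Fin m} {ζ : Fin m → ℕ → Ω → ℝ}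
    (hζ : ∀ i j, HasItoIntegral F P (f i) 0 T (fun s _ => φ j s) (ζ i j)) {J S : Ω → ℝ}
    (hJ : HasIteratedItoIntegral F P (f i₁) (f i₂) T J)
    (hS : HasIteratedStratonovichIntegral P (f i₁) (f i₂) T S) :
    TendstoMeanSquare P (fun p ω => ∑ j₁ ∈ Finset.range (p + 1), ∑ j₂ ∈ Finset.range (p + 1),
        doubleCoeff φ T j₂ j₁ * (ζ i₁ j₁ ω * ζ i₂ j₂ ω)) S ∧
      S =ᵐ[P] fun ω => J ω + (if i₁ = i₂ then 1 else 0) * (T / 2) := by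
  have hW := hf.isBrownian i₁
  have hB := hf.isBrownian i₂
  have hS' := (hasIteratedStratonovichIntegral_iff hW hB hT.le).1 hS
  rcases eq_or_ne i₁ i₂ with rfl | hne
  · have hSe := hS'.unique hT.le (hW.meshTendsto_trapezoidSum_self hT.le)
    have hJe := hJ.ae_eq_self hW hT.le
    have hζ0 : ζ i₁ 0 =ᵐ[P] fun ω => 1 / √T * shift (f i₁) T ω := by
      have := hζ i₁ 0
      simp_rw [h.zero] at this
      exact this.ae_eq_const hW hT.le
    have hs : √T ^ 2 = T := Real.sq_sqrt hT.le
    -- For equal components the double sum is almost surely `S` for every `p`: `ζ i₁ 0` is `1 / √T`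
    -- times the increment of the path over `[0, T]`.
    refine ⟨(TendstoMeanSquare.const hS'.1).congr (fun p => ?_) EventuallyEq.rfl, ?_⟩
    · filter_upwards [hSe, hζ0] with ω h1 h2
      rw [h1, h.sum_doubleCoeff_mul hT (fun j => ζ i₁ j ω), h2, mul_pow, div_pow, hs]
      field_simp
    · filter_upwards [hSe, hJe] with ω h1 h2
      rw [h1, h2, if_pos rfl]; ring
  · have hWB := hf.indep_pathSigma hne
    have hJ' := (hJ.meshTendsto hW hB hT.le).add
      ((meshTendsto_crossSum_of_indep hW hB hWB).const_smul (1 / 2))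
    have hSJ := hS'.unique hT.le (hJ'.congr (fun π => by rw [trapezoidSum_shift]) EventuallyEq.rfl)
    have hSJ' : S =ᵐ[P] J := by
      filter_upwards [hSJ] with ω hω
      simpa using hω
    refine ⟨(h.tendstoMeanSquare_of_indep hW hB hT.le hWB hJ (hζ i₁) (hζ i₂)).congr
      (fun _ => EventuallyEq.rfl) hSJ'.symm, ?_⟩
    filter_upwards [hSJ'] with ω hω
    rw [hω, if_neg hne]; ring

theorem IsWienerProcess.exists_hasIteratedStratonovichIntegral (hf : IsWienerProcess F P T f)
    (hT : 0 ≤ T) (i₁ i₂ : Fin m) :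
    ∃ S, HasIteratedStratonovichIntegral P (f i₁) (f i₂) T S := by
  have hW := hf.isBrownian i₁
  have hB := hf.isBrownian i₂
  simp_rw [hasIteratedStratonovichIntegral_iff hW hB hT]
  rcases eq_or_ne i₁ i₂ with rfl | hne
  · exact ⟨_, hW.meshTendsto_trapezoidSum_self hT⟩
  · obtain ⟨J, hJ⟩ := hW.exists_hasIteratedItoIntegral hB hT
    exact ⟨_, ((hJ.meshTendsto hW hB hT).add
      ((meshTendsto_crossSum_of_indep hW hB (hf.indep_pathSigma hne)).const_smul (1 / 2))).congr
        (fun π => by rw [trapezoidSum_shift]) EventuallyEq.rfl⟩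

end Main

end WongZakai

theorem mainTheorem1 {Ω : Type*} {mΩ : MeasurableSpace Ω} (P : Measure Ω) [IsProbabilityMeasure P]
    (F : Filtration ℝ mΩ) {m : ℕ} {T : ℝ} (hT : 0 < T)
    (f : Fin m → ℝ → Ω → ℝ) (hf : IsWienerProcess F P T f)
    (φ : ℕ → ℝ → ℝ) (hφ : φ = legendreSystem T ∨ φ = trigonometricSystem T)
    (i₁ i₂ : Fin m) :
    -- the stochastic integrals exist
    (∀ i j, ∃ Z, HasItoIntegral F P (f i) 0 T (fun s _ => φ j s) Z) ∧
    (∃ J, HasIteratedItoIntegral F P (f i₁) (f i₂) T J) ∧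
    (∃ S, HasIteratedStratonovichIntegral P (f i₁) (f i₂) T S) ∧
    -- the diagonal coefficients
    (∀ j, doubleCoeff φ T j j = 1 / 2 * (∫ τ in (0 : ℝ)..T, φ j τ) ^ 2) ∧
    1 / 2 * (∫ τ in (0 : ℝ)..T, φ 0 τ) ^ 2 = T / 2 ∧
    HasSum (fun j => doubleCoeff φ T j j) (T / 2) ∧
    -- for all versions of the stochastic integrals
    ∀ ζ : Fin m → ℕ → Ω → ℝ,
      (∀ i j, HasItoIntegral F P (f i) 0 T (fun s _ => φ j s) (ζ i j)) →
    ∀ J : Ω → ℝ, HasIteratedItoIntegral F P (f i₁) (f i₂) T J →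
    ∀ S : Ω → ℝ, HasIteratedStratonovichIntegral P (f i₁) (f i₂) T S →
      -- the iterated Riemann–Stieltjes integral exists for every path and equals the double sum
      (∀ p ω R, HasIteratedRSIntegral (seriesApprox φ (fun j => ζ i₁ j ω) p)
          (seriesApprox φ (fun j => ζ i₂ j ω) p) T R ↔
        R = ∑ j₁ ∈ Finset.range (p + 1), ∑ j₂ ∈ Finset.range (p + 1),
          doubleCoeff φ T j₂ j₁ * (ζ i₁ j₁ ω * ζ i₂ j₂ ω)) ∧
      -- it converges in mean square to the Stratonovich integral, and to the Itô integral
      -- plus the sum of the diagonal coefficients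
      (∀ R : ℕ → Ω → ℝ,
        (∀ p ω, HasIteratedRSIntegral (seriesApprox φ (fun j => ζ i₁ j ω) p)
          (seriesApprox φ (fun j => ζ i₂ j ω) p) T (R p ω)) →
        TendstoMeanSquare P R S ∧
        TendstoMeanSquare P R
          (fun ω => J ω + (if i₁ = i₂ then 1 else 0) * ∑' j, doubleCoeff φ T j j)) ∧
      -- the corrected double sums converge in mean square to the Itô integral
      TendstoMeanSquare P
        (fun p ω => ∑ j₁ ∈ Finset.range (p + 1), ∑ j₂ ∈ Finset.range (p + 1),
          doubleCoeff φ T j₂ j₁ *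
            (ζ i₁ j₁ ω * ζ i₂ j₂ ω - (if i₁ = i₂ then 1 else 0) * (if j₁ = j₂ then 1 else 0))) J := by
  have h := isAdmissibleSystem_of_eq hT hφ
  refine ⟨fun i j => ?_, (hf.isBrownian i₁).exists_hasIteratedItoIntegral (hf.isBrownian i₂) hT.le,
    hf.exists_hasIteratedStratonovichIntegral hT.le i₁ i₂, h.doubleCoeff_self,
    h.half_integral_zero_sq hT, h.hasSum_doubleCoeff_self hT, fun ζ hζ J hJ S hS => ?_⟩
  · obtain ⟨Z, hZ, -⟩ := (isMSContinuous_deterministic (h.continuous j) 0 T).exists_hasItoIntegral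
      (hf.isBrownian i) le_rfl hT.le le_rfl
    exact ⟨Z, hZ⟩
  obtain ⟨hlim, hSJ⟩ := h.tendstoMeanSquare hT hf hζ hJ hS
  have hJ2 : MemLp J 2 P := (hJ.meshTendsto (hf.isBrownian i₁) (hf.isBrownian i₂) hT.le).1
  refine ⟨fun p ω R => hasIteratedRSIntegral_seriesApprox_iff h.continuous hT.le _ _ p R,
    fun R hR => ?_, ?_⟩
  · have hRe : ∀ p, (fun ω => ∑ j₁ ∈ Finset.range (p + 1), ∑ j₂ ∈ Finset.range (p + 1),
        doubleCoeff φ T j₂ j₁ * (ζ i₁ j₁ ω * ζ i₂ j₂ ω)) =ᵐ[P] R p := fun p =>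
      ae_of_all _ fun ω =>
        ((hasIteratedRSIntegral_seriesApprox_iff h.continuous hT.le _ _ p _).1 (hR p ω)).symm
    rw [(h.hasSum_doubleCoeff_self hT).tsum_eq]
    exact ⟨hlim.congr hRe EventuallyEq.rfl, hlim.congr hRe hSJ⟩
  -- The diagonal correction is exactly `T / 2` for every `p`, so subtracting a constant sequence
  -- from the limit already found suffices.
  · refine (hlim.sub (TendstoMeanSquare.const
      (memLp_const ((if i₁ = i₂ then 1 else 0) * (T / 2))))).congr (fun p => ?_) ?_
    · refine ae_of_all _ fun ω => ?_
      simp only [Pi.sub_apply]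
      rw [← h.sum_doubleCoeff_diag hT p, Finset.mul_sum, ← Finset.sum_sub_distrib]
      refine Finset.sum_congr rfl fun j₁ _ => ?_
      rw [Finset.mul_sum, ← Finset.sum_sub_distrib]
      refine Finset.sum_congr rfl fun j₂ _ => ?_
      ring
    · filter_upwards [hSJ] with ω hω
      rw [Pi.sub_apply, hω]; ring
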